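/- Let $G$ be a countable group with a finite symmetric generating set $S$, and let $|\cdot|$ be the associated word-length norm. For $k\in\mathbb{N}$ put $\|f\|_{k,1}=\sum_{g\in G}(1+|g|)^k|f(g)|$ on $\mathbb{C}G$, and let $\ell^1_\infty G$ be the completion of $\mathbb{C}G$ for the family of norms $(\|\cdot\|_{k,1})_{k}$, a Fréchet algebra. For a $\mathbb{C}$-algebra $A$ let $HH_*(A)$ be the homology of the Hochschild complex $C_n(A)=A^{\otimes(n+1)}$ with $$b(a_0\otimes\cdots\otimes a_n)=\sum_{j=0}^{n-1}(-1)^j a_0\otimes\cdots\otimes a_ja_{j+1}\otimes\cdots\otimes a_n+(-1)^n a_na_0\otimes a_1\otimes\cdots\otimes a_{n-1},$$ and for a Fréchet algebra $A$ let $HH^{\mathrm{cont}}_*(A)$ be the homology (cycles modulo boundaries) of the complex formed in the same way with completed projective tensor products. For every conjugacy class $x$ of $G$ choose an element $h_x\in x$, with centralizer $Z_{h_x}$, and assume that for every $x$: 1. $G$ has a polynomially solvable conjugacy bound at $h_x$: there is a polynomial $P$ such that for each $h$ conjugate to $h_x$ there is $r\in G$ with $h=r^{-1}h_xr$ and $|r|\le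 P(|h|)$. 2. $Z_{h_x}$ is of type $F_\infty$, i.e. it has a $K(Z_{h_x},1)$ which is a CW complex with finitely many cells in each dimension. 3. $Z_{h_x}$ admits a word-length norm (for some finite symmetric generating set) such that the inclusion $Z_{h_x}\subset G$ is a quasi-isometric embedding. 4. $Z_{h_x}$ has polynomially bounded higher-order Dehn functions: there is a simplicial complex $BZ_{h_x}$ with finitely many simplices in each dimension and contractible universal cover $EZ_{h_x}$ (on which $Z_{h_x}$ acts as the deck group) such that for each $N\ge 1$ the function $$d^N(k)=\sup_{|b|\le k}\ \min\{|a| : \partial a=b\}$$ is bounded from above by a polynomial in $k$. Here $b$ runs over the integral simplicial $N$-boundaries of $EZ_{h_x}$, $a$ over the integral simplicial $(N+1)$-chains, and $|\cdot|$ is the $\ell^1$-norm. Then for every $n\ge 0$ the map $HH_n(\mathbb{C}G)\to HH^{\mathrm{cont}}_n(\ell^1_\infty G)$ induced by the inclusion $\mathbb{C}G\to\ell^1_\infty G$ is injective. -/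

import Mathlib

noncomputable section

namespace RapidDecay

open scoped TensorProduct Topology
open Filter CategoryTheory

/-! ### Word-length norms, conjugacy bounds, quasi-isometric embeddings -/

/-- A finite symmetric generating set of a group. -/
structure GenSet (G : Type*) [Group G] where
  carrier : Finset G
  inv_mem : ∀ g ∈ carrier, g⁻¹ ∈ carrier
  closure_eq_top : Subgroup.closure (carrier : Set G) = ⊤

/-- The word-length norm `|g|` : the least length of a word in the generators representing `g`. -/
def GenSet.wordLength {G : Type*} [Group G] (S : GenSet G) (g : G) : ℕ :=
  sInf {n : ℕ | ∃ l : List G, (∀ s ∈ l, s ∈ S.carrier) ∧ l.prod = g ∧ l.length = n}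

/-- `G` has a polynomially solvable conjugacy bound at `g` (with respect to the word length of
the generating set `S`). -/
def HasPolyConjugacyBound {G : Type*} [Group G] (S : GenSet G) (g : G) : Prop :=
  ∃ P : Polynomial ℝ, ∀ h : G, IsConj g h →
    ∃ r : G, h = r⁻¹ * g * r ∧ (S.wordLength r : ℝ) ≤ P.eval (S.wordLength h : ℝ)

/-- For some word-length norm on the subgroup `H`, the inclusion of `H` into `G` is a
quasi-isometric embedding for the word metrics `d(a, b) = |a⁻¹ b|`. -/
def IsQIEmbeddedSubgroup {G : Type*} [Group G] (S : GenSet G) (H : Subgroup G) : Prop :=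
  ∃ (T : GenSet H) (L C : ℝ), 1 ≤ L ∧ 0 ≤ C ∧ ∀ a b : H,
    (T.wordLength (a⁻¹ * b) : ℝ) / L - C ≤ S.wordLength ((a : G)⁻¹ * b) ∧
    (S.wordLength ((a : G)⁻¹ * b) : ℝ) ≤ L * T.wordLength (a⁻¹ * b) + C

/-! ### Groups of type `F_∞` -/

/-- `G` is of type `F_∞` : there is a CW complex with finitely many cells in every dimension
which is an Eilenberg-MacLane space `K(G, 1)`. -/
def IsTypeFInfty (G : Type*) [Group G] : Prop :=
  ∃ (X : Type) (_ : TopologicalSpace X) (_ : T2Space X)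
    (_ : Topology.CWComplex (Set.univ : Set X)) (x : X),
    (∀ n, Finite (Topology.CWComplex.cell (Set.univ : Set X) n)) ∧
    PathConnectedSpace X ∧
    Nonempty (FundamentalGroup X x ≃* G) ∧
    ∀ n, 2 ≤ n → Subsingleton (HomotopyGroup.Pi n X x)

/-! ### Simplicial complexes: geometric realization, simplicial chains, Dehn functions -/

section Simplicial

variable {V : Type*}

/-- The points of the geometric realization: barycentric coordinates carried by a face. -/
def Realization (X : AbstractSimplicialComplex V) : Type _ :=
  {x : V → ℝ // (∀ v, 0 ≤ x v) ∧ ∃ s ∈ X.faces, (∀ v ∉ s, x v = 0) ∧ ∑ v ∈ s, x v = 1}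

open Classical in
/-- The characteristic map of a face, from the standard simplex on its vertices. -/
def faceMap (X : AbstractSimplicialComplex V) (s : X.faces) (t : stdSimplex ℝ (s : Finset V)) :
    Realization X :=
  ⟨fun v => if h : v ∈ (s : Finset V) then t.1 ⟨v, h⟩ else 0, by
    refine ⟨fun v => ?_, s, s.2, fun v hv => dif_neg hv, ?_⟩
    · dsimp only
      split_ifs with h
      · exact t.2.1 _
      · exact le_rfl
    · rw [← t.2.2, ← Finset.sum_coe_sort]
      exact Finset.sum_congr rfl fun v _ => dif_pos v.2⟩

/-- The weak topology: a set is open iff its preimage in every closed simplex is open. -/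
instance (X : AbstractSimplicialComplex V) : TopologicalSpace (Realization X) :=
  ⨆ s : X.faces, TopologicalSpace.coinduced (faceMap X s) inferInstance

/-- The `n`-simplices of `X`. -/
def Simplices (X : AbstractSimplicialComplex V) (n : ℕ) : Type _ :=
  {s : Finset V // s ∈ X.faces ∧ s.card = n + 1}

/-- Simplicial `n`-chains with integer coefficients. -/
abbrev Chains (X : AbstractSimplicialComplex V) (n : ℕ) : Type _ := Simplices X n →₀ ℤ

/-- The `ℓ¹`-norm of a simplicial chain. -/
def chainNorm {X : AbstractSimplicialComplex V} {n : ℕ} (c : Chains X n) : ℕ :=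
  c.sum fun _ m => m.natAbs

variable [LinearOrder V]

/-- The codimension one face of a simplex opposite to the vertex `v`. -/
def Simplices.erase {X : AbstractSimplicialComplex V} {n : ℕ} (s : Simplices X (n + 1))
    (v : V) (hv : v ∈ s.1) : Simplices X n :=
  ⟨s.1.erase v, (X.isRelLowerSet_faces s.2.1).2 (Finset.erase_subset v s.1)
      (Finset.card_pos.mp (by rw [Finset.card_erase_of_mem hv, s.2.2]; simp)),
    by rw [Finset.card_erase_of_mem hv, s.2.2]; simp⟩

/-- The simplicial boundary. Simplices are oriented by the order of the vertices: the vertex in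
position `i` is removed with the sign `(-1)^i`. -/
def boundary (X : AbstractSimplicialComplex V) (n : ℕ) : Chains X (n + 1) →ₗ[ℤ] Chains X n :=
  Finsupp.linearCombination ℤ fun s : Simplices X (n + 1) =>
    ∑ v ∈ s.1.attach, Finsupp.single (s.erase v.1 v.2)
      ((-1 : ℤ) ^ (s.1.filter (· < v.1)).card)

/-- `l_f(b)`, the least `ℓ¹`-norm of a chain with boundary `b`. -/
def fillingNorm (X : AbstractSimplicialComplex V) (n : ℕ) (b : Chains X n) : ℕ∞ :=
  ⨅ (a : Chains X (n + 1)) (_ : boundary X n a = b), (chainNorm a : ℕ∞)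

/-- The `n`-th Dehn function of `X`. It does not depend on the order of the vertices. -/
def dehnFunction (X : AbstractSimplicialComplex V) (n k : ℕ) : ℕ∞ :=
  ⨆ (b : Chains X n) (_ : b ∈ LinearMap.range (boundary X n)) (_ : chainNorm b ≤ k),
    fillingNorm X n b

end Simplicial

open Classical in
/-- The universal cover `EG` of a simplicial complex which is a classifying space `BG`:
a contractible simplicial complex with a simplicial action of `G` such that the orbit complex
(vertices: orbits of vertices; simplices: images of simplices) is a simplicial complex covered
by `EG` with deck group `G`. -/
structure SimplicialEG (G : Type*) [Group G] where
  V : Type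
  /-- an auxiliary order, used to orient the simplices -/
  [order : LinearOrder V]
  [action : MulAction G V]
  X : AbstractSimplicialComplex V
  smul_mem : ∀ (g : G), ∀ s ∈ X.faces, s.image (g • ·) ∈ X.faces
  /-- `G` acts freely, and distinct vertices of a simplex lie in distinct orbits -/
  eq_one_of_smul_mem : ∀ s ∈ X.faces, ∀ v ∈ s, ∀ g : G, g • v ∈ s → g = 1
  /-- simplices with the same image in the orbit complex are translates of each other -/
  exists_smul_eq : ∀ s ∈ X.faces, ∀ t ∈ X.faces,
    MulAction.orbit G '' (s : Set V) = MulAction.orbit G '' (t : Set V) →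
      ∃ g : G, t = s.image (g • ·)
  contractible : ContractibleSpace (Realization X)

attribute [instance] SimplicialEG.order SimplicialEG.action

open Classical in
/-- The quotient `BG` has finitely many simplices in each dimension. -/
def SimplicialEG.HasFiniteSkeleta {G : Type*} [Group G] (E : SimplicialEG G) : Prop :=
  ∀ n : ℕ, ∃ F : Finset (Finset E.V), ∀ s ∈ E.X.faces, s.card = n + 1 →
    ∃ t ∈ F, ∃ g : G, s = t.image (g • ·)

/-- The higher-order Dehn functions (in degrees `≥ 1`) of `G`, computed on `EG` for a simplicial
model of `BG` with finite skeleta, are bounded by polynomials. Degree `0` is excluded because the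
difference of two far apart vertices is a boundary of norm `2`, so that the Dehn function in
degree `0` is infinite for every infinite group. -/
def HasPolyBoundedDehnFunctions (G : Type*) [Group G] : Prop :=
  ∃ E : SimplicialEG G, E.HasFiniteSkeleta ∧
    ∀ n : ℕ, 1 ≤ n → ∃ P : Polynomial ℕ, ∀ k : ℕ, dehnFunction E.X n k ≤ (P.eval k : ℕ)

/-! ### The Hochschild complex of an algebra -/

section Hochschild

/-- The `j`-th face of a tuple: `(a_0, …, a_j a_{j+1}, …, a_{n+1})` if `j ≤ n`, and
`(a_{n+1} a_0, a_1, …, a_n)` if `j = n + 1`. -/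
def face {A : Type*} [Mul A] {n : ℕ} (j : Fin (n + 2)) (a : Fin (n + 2) → A) (k : Fin (n + 1)) :
    A :=
  if j = Fin.last (n + 1) then
    if k = 0 then a (Fin.last (n + 1)) * a 0 else a k.castSucc
  else Fin.contractNth j (· * ·) a k

theorem face_face {A : Type*} [Semigroup A] {n : ℕ} (a : Fin (n + 3) → A) (i j : Fin (n + 2))
    (h : i ≤ j) : face i (face j.succ a) = face j (face i.castSucc a) := by
  obtain ⟨a', rfl⟩ : ∃ a' : ℕ → A, a = fun i : Fin (n + 3) => a' i.1 :=
    ⟨fun i => if h : i < n + 3 then a ⟨i, h⟩ else a 0, by ext i; simp⟩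
  funext k
  rcases i with ⟨i, hi⟩
  rcases j with ⟨j, hj⟩
  rcases k with ⟨k, hk⟩
  simp only [Fin.le_def] at h
  simp only [face, Fin.contractNth, Fin.ext_iff, Fin.val_succ, Fin.val_castSucc, Fin.val_last,
    Fin.val_zero]
  grind [mul_assoc]

variable (A : Type*) [Ring A] [Algebra ℂ A]

/-- The tensor power `A ⊗ ⋯ ⊗ A` with `n + 1` factors. -/
abbrev TensorPow (n : ℕ) : Type _ := ⨂[ℂ] _ : Fin (n + 1), A

theorem exists_face_update {A : Type*} [Ring A] [Algebra ℂ A] {n : ℕ} (j : Fin (n + 2))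
    (a : Fin (n + 2) → A) (i : Fin (n + 2)) :
    ∃ (k : Fin (n + 1)) (L : A →ₗ[ℂ] A), ∀ x,
      face j (Function.update a i x) = Function.update (face j a) k (L x) := by
  rcases i with ⟨i, hi⟩
  rcases j with ⟨j, hj⟩
  have key : ∀ (k : Fin (n + 1)) (L : A →ₗ[ℂ] A), (∀ x l,
      face ⟨j, hj⟩ (Function.update a ⟨i, hi⟩ x) l = if l = k then L x else face ⟨j, hj⟩ a l) →
      ∃ (k : Fin (n + 1)) (L : A →ₗ[ℂ] A), ∀ x,
      face ⟨j, hj⟩ (Function.update a ⟨i, hi⟩ x) = Function.update (face ⟨j, hj⟩ a) k (L x) :=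
    fun k L h => ⟨k, L, fun x => funext fun l => by rw [h, Function.update_apply]⟩
  by_cases hjn : j = n + 1
  · by_cases hin : i = n + 1
    · refine key 0 (LinearMap.mulRight ℂ (a 0)) fun x l => ?_
      rcases l with ⟨l, hl⟩
      simp only [face, Function.update_apply, Fin.ext_iff, Fin.val_last, Fin.val_zero,
        Fin.val_castSucc, LinearMap.mulRight_apply]
      grind
    · by_cases hi0 : i = 0
      · refine key 0 (LinearMap.mulLeft ℂ (a (Fin.last _))) fun x l => ?_
        rcases l with ⟨l, hl⟩
        simp only [face, Function.update_apply, Fin.ext_iff, Fin.val_last, Fin.val_zero,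
          Fin.val_castSucc, LinearMap.mulLeft_apply]
        grind
      · refine key ⟨i, by omega⟩ LinearMap.id fun x l => ?_
        rcases l with ⟨l, hl⟩
        simp only [face, Function.update_apply, Fin.ext_iff, Fin.val_last, Fin.val_zero,
          Fin.val_castSucc, LinearMap.id_apply]
        grind
  · by_cases h1 : i < j
    · refine key ⟨i, by omega⟩ LinearMap.id fun x l => ?_
      rcases l with ⟨l, hl⟩
      simp only [face, Fin.contractNth, Function.update_apply, Fin.ext_iff, Fin.val_last,
        Fin.val_succ, Fin.val_castSucc, LinearMap.id_apply]
      grind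
    · by_cases h2 : i = j
      · refine key ⟨j, by omega⟩ (LinearMap.mulRight ℂ (a ⟨j + 1, by omega⟩)) fun x l => ?_
        rcases l with ⟨l, hl⟩
        simp only [face, Fin.contractNth, Function.update_apply, Fin.ext_iff, Fin.val_last,
          Fin.val_succ, Fin.val_castSucc, LinearMap.mulRight_apply]
        grind
      · by_cases h3 : i = j + 1
        · refine key ⟨j, by omega⟩ (LinearMap.mulLeft ℂ (a (Fin.castSucc ⟨j, by omega⟩))) fun x l => ?_
          rcases l with ⟨l, hl⟩
          simp only [face, Fin.contractNth, Function.update_apply, Fin.ext_iff, Fin.val_last,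
            Fin.val_succ, Fin.val_castSucc, LinearMap.mulLeft_apply]
          grind
        · refine key ⟨i - 1, by omega⟩ LinearMap.id fun x l => ?_
          rcases l with ⟨l, hl⟩
          simp only [face, Fin.contractNth, Function.update_apply, Fin.ext_iff, Fin.val_last,
            Fin.val_succ, Fin.val_castSucc, LinearMap.id_apply]
          grind

theorem alternating_sum_sum_eq_zero {M : Type*} [AddCommGroup M] [Module ℂ M] (n : ℕ)
    (F : Fin (n + 2) → Fin (n + 3) → M)
    (hF : ∀ i j : Fin (n + 2), i ≤ j → F i j.succ = F j i.castSucc) :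
    ∑ j : Fin (n + 3), ∑ i : Fin (n + 2), (-1 : ℂ) ^ (j : ℕ) • (-1 : ℂ) ^ (i : ℕ) • F i j = 0 := by
  rw [Finset.sum_comm, ← Finset.sum_product', Finset.univ_product_univ]
  let P := Fin (n + 2) × Fin (n + 3)
  let S : Finset P := {ij : P | (ij.2 : ℕ) ≤ (ij.1 : ℕ)}
  rw [← Finset.sum_add_sum_compl S, ← eq_neg_iff_add_eq_zero, ← Finset.sum_neg_distrib]
  refine Finset.sum_bij (fun ij hij => (Fin.castLT ij.2
    (lt_of_le_of_lt (Finset.mem_filter.mp hij).right (Fin.is_lt ij.1)), ij.1.succ)) ?_ ?_ ?_ ?_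
  · rintro ⟨i, j⟩ hij
    simp [S] at hij ⊢
    omega
  · rintro ⟨i, j⟩ hij ⟨i', j'⟩ hij' h
    have e1 := congrArg (fun x : P => (x.1 : ℕ)) h
    have e2 := congrArg (fun x : P => (x.2 : ℕ)) h
    simp only [Fin.val_castLT, Fin.val_succ] at e1 e2
    exact Prod.ext (Fin.ext (show (i : ℕ) = i' by omega)) (Fin.ext (show (j : ℕ) = j' by omega))
  · rintro ⟨i', j'⟩ hij'
    simp only [S, Finset.mem_compl, Finset.mem_filter, Finset.mem_univ, true_and, not_le] at hij'
    refine ⟨(⟨j' - 1, by omega⟩, i'.castSucc), ?_, ?_⟩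
    · simp [S]; omega
    · exact Prod.ext (Fin.ext (by simp)) (Fin.ext (by simp; omega))
  · rintro ⟨i, j⟩ hij
    have hij : (j : ℕ) ≤ i := by simpa [S] using hij
    have h := hF (Fin.castLT j (by omega)) i (by simpa [Fin.le_def] using hij)
    rw [Fin.castSucc_castLT] at h
    simp only [h, smul_smul, ← neg_smul, Fin.val_succ, Fin.val_castLT]
    congr 1
    ring

/-- The multilinear map `(a_0, …, a_{n+1}) ↦ face j (a_0, …, a_{n+1})`, with values in tensors. -/
def faceMultilinear (n : ℕ) (j : Fin (n + 2)) :
    MultilinearMap ℂ (fun _ : Fin (n + 2) => A) (TensorPow A n) where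
  toFun a := PiTensorProduct.tprod ℂ (face j a)
  map_update_add' {inst} a i x y := by
    obtain rfl : inst = instDecidableEqFin _ := Subsingleton.elim _ _
    obtain ⟨k, L, h⟩ := exists_face_update j a i
    simp only [h, map_add, MultilinearMap.map_update_add]
  map_update_smul' {inst} a i c x := by
    obtain rfl : inst = instDecidableEqFin _ := Subsingleton.elim _ _
    obtain ⟨k, L, h⟩ := exists_face_update j a i
    simp only [h, map_smul, MultilinearMap.map_update_smul]

/-- The Hochschild boundary operator `b`. -/
def hochschildB (n : ℕ) : TensorPow A (n + 1) →ₗ[ℂ] TensorPow A n :=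
  PiTensorProduct.lift (∑ j : Fin (n + 2), (-1 : ℂ) ^ (j : ℕ) • faceMultilinear A n j)

theorem hochschildB_tprod (n : ℕ) (a : Fin (n + 2) → A) :
    hochschildB A n (PiTensorProduct.tprod ℂ a) =
      ∑ j : Fin (n + 2), (-1 : ℂ) ^ (j : ℕ) • PiTensorProduct.tprod ℂ (face j a) := by
  simp [hochschildB, faceMultilinear]

theorem hochschildB_comp (n : ℕ) : hochschildB A n ∘ₗ hochschildB A (n + 1) = 0 := by
  refine PiTensorProduct.ext (MultilinearMap.ext fun a => ?_)
  simp only [LinearMap.compMultilinearMap_apply, LinearMap.comp_apply, hochschildB_tprod,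
    map_sum, map_smul, LinearMap.zero_apply, Finset.smul_sum]
  exact alternating_sum_sum_eq_zero n
    (fun i j => PiTensorProduct.tprod ℂ (face i (face j a)))
    (fun i j h => by rw [face_face a i j h])

/-- The Hochschild complex `C_•(A)` of a `ℂ`-algebra. Its homology is `HH_*(A)`. -/
def hochschildComplex : ChainComplex (ModuleCat ℂ) ℕ :=
  ChainComplex.of (fun n => ModuleCat.of ℂ (TensorPow A n))
    (fun n => ModuleCat.ofHom (hochschildB A n))
    (fun n => by rw [← ModuleCat.ofHom_comp, hochschildB_comp]; rfl)

end Hochschild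

/-! ### Continuous Hochschild homology -/

section Continuous

/-- The tensor power of a locally convex space with `n + 1` factors, with the projective topology. -/
def ProjTensorPow (A : Type*) [AddCommGroup A] [Module ℂ A] (_n : ℕ) : Type _ :=
  ⨂[ℂ] _ : Fin (_n + 1), A

section Top

variable (A : Type*) [AddCommGroup A] [Module ℂ A] (n : ℕ)

instance : AddCommGroup (ProjTensorPow A n) :=
  inferInstanceAs (AddCommGroup (⨂[ℂ] _ : Fin (n + 1), A))

instance : Module ℂ (ProjTensorPow A n) :=
  inferInstanceAs (Module ℂ (⨂[ℂ] _ : Fin (n + 1), A))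

variable [TopologicalSpace A]

/-- The elementary tensor `a_0 ⊗ ⋯ ⊗ a_n`. -/
def ProjTensorPow.tprod {A : Type*} [AddCommGroup A] [Module ℂ A] {n : ℕ} (a : Fin (n + 1) → A) :
    ProjTensorPow A n :=
  PiTensorProduct.tprod ℂ a

/-- The seminorms `q` on the tensor power dominated by `p ⊗ ⋯ ⊗ p` for a continuous seminorm `p`,
that is, with `q (a_0 ⊗ ⋯ ⊗ a_n) ≤ p a_0 ⋯ p a_n`. -/
def ProjSeminorm : Type _ :=
  {q : Seminorm ℂ (ProjTensorPow A n) // ∃ p : Seminorm ℂ A, Continuous p ∧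
    ∀ a : Fin (n + 1) → A, q (ProjTensorPow.tprod a) ≤ ∏ i, p (a i)}

/-- The seminorms defining the projective topology. -/
def projSeminormFamily : SeminormFamily ℂ (ProjTensorPow A n) (ProjSeminorm A n) := fun q => q.1

instance : TopologicalSpace (ProjTensorPow A n) :=
  (projSeminormFamily A n).moduleFilterBasis.topology

theorem projTensorPow_withSeminorms : WithSeminorms (projSeminormFamily A n) := ⟨rfl⟩

instance : IsTopologicalAddGroup (ProjTensorPow A n) :=
  (projTensorPow_withSeminorms A n).topologicalAddGroup

instance : ContinuousSMul ℂ (ProjTensorPow A n) :=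
  (projTensorPow_withSeminorms A n).continuousSMul

instance : UniformSpace (ProjTensorPow A n) :=
  IsTopologicalAddGroup.rightUniformSpace (ProjTensorPow A n)

instance : IsUniformAddGroup (ProjTensorPow A n) :=
  isUniformAddGroup_of_addCommGroup

instance : UniformContinuousConstSMul ℂ (ProjTensorPow A n) :=
  uniformContinuousConstSMul_of_continuousConstSMul ℂ (ProjTensorPow A n)

/-- The completed projective tensor power `A ⊗̂ ⋯ ⊗̂ A` with `n + 1` factors. -/
abbrev CompletedTensorPow : Type _ := UniformSpace.Completion (ProjTensorPow A n)

end Top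

variable (A : Type*) [Ring A] [Algebra ℂ A] [TopologicalSpace A] [IsTopologicalRing A]
  [PolynormableSpace ℂ A]

theorem exists_seminorm_mul_le {A : Type*} [Ring A] [Algebra ℂ A] [TopologicalSpace A]
    [IsTopologicalRing A] [PolynormableSpace ℂ A] (p : Seminorm ℂ A) (hp : Continuous p) :
    ∃ q : Seminorm ℂ A, Continuous q ∧ ∀ a b, p (a * b) ≤ q a * q b := by
  have hw := PolynormableSpace.withSeminorms ℂ A
  have : ContinuousSMul ℂ A := hw.continuousSMul
  have h1 : Tendsto (fun x : A × A => p (x.1 * x.2)) (𝓝 0 ×ˢ 𝓝 0) (𝓝 0) := by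
    have : Continuous fun x : A × A => p (x.1 * x.2) := hp.comp continuous_mul
    simpa [← nhds_prod_eq] using this.tendsto (0, 0)
  have h2 := h1.eventually (gt_mem_nhds one_pos)
  obtain ⟨⟨s, r⟩, hr, hU⟩ := (hw.hasBasis_zero_ball.prod_self.eventually_iff).1 h2
  set q₀ : Seminorm ℂ A := s.sup fun p : {p : Seminorm ℂ A // Continuous p} => p.1 with hq₀
  have hr : 0 < r := hr
  have hq₀c : Continuous q₀ := Seminorm.continuous_finsetSup fun i _ => i.2
  have key : ∀ a b, q₀ a < r → q₀ b < r → p (a * b) ≤ 1 := fun a b ha hb =>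
    le_of_lt (@hU (a, b) ⟨by simpa using ha, by simpa using hb⟩)
  refine ⟨(r.toNNReal)⁻¹ • q₀, continuous_const.smul hq₀c, fun a b => ?_⟩
  have hlim : Tendsto (fun ε : ℝ => (r⁻¹ * q₀ a + ε) * (r⁻¹ * q₀ b + ε)) (𝓝[>] 0)
      (𝓝 ((r⁻¹ * q₀ a + 0) * (r⁻¹ * q₀ b + 0))) :=
    ((Continuous.tendsto (by fun_prop) 0).mono_left nhdsWithin_le_nhds)
  have hval : ∀ x, ((r.toNNReal)⁻¹ • q₀) x = r⁻¹ * q₀ x := fun x => by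
    simp [NNReal.smul_def, hr.le]
  rw [hval, hval]
  simp only [add_zero] at hlim
  refine ge_of_tendsto hlim ?_
  filter_upwards [self_mem_nhdsWithin] with ε hε
  have hε : 0 < ε := hε
  have hs : 0 < r⁻¹ * q₀ a + ε := by positivity
  have ht : 0 < r⁻¹ * q₀ b + ε := by positivity
  set s' := r⁻¹ * q₀ a + ε
  set t' := r⁻¹ * q₀ b + ε
  have hsc : ∀ (c : A) (u : ℝ), r⁻¹ * q₀ c + ε = u → 0 < u → q₀ (((u⁻¹ : ℝ) : ℂ) • c) < r := by
    intro c u hu hu0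
    rw [map_smul_eq_mul, Complex.norm_real, Real.norm_of_nonneg (by positivity),
      inv_mul_lt_iff₀ hu0, ← hu, add_mul, mul_right_comm, inv_mul_cancel₀ hr.ne', one_mul]
    have : 0 < ε * r := by positivity
    linarith
  have := key _ _ (hsc a s' rfl hs) (hsc b t' rfl ht)
  rw [smul_mul_smul_comm, map_smul_eq_mul, norm_mul, Complex.norm_real, Complex.norm_real,
    Real.norm_of_nonneg (by positivity), Real.norm_of_nonneg (by positivity), ← mul_inv,
    inv_mul_le_iff₀ (by positivity), mul_one] at this
  exact this

/-- The Hochschild boundary operator is continuous for the projective topologies. -/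
def hochschildBCont (n : ℕ) : ProjTensorPow A (n + 1) →L[ℂ] ProjTensorPow A n where
  toLinearMap := hochschildB A n
  cont := by
    let B : ProjTensorPow A (n + 1) →ₗ[ℂ] ProjTensorPow A n := hochschildB A n
    refine (projTensorPow_withSeminorms A n).continuous_of_continuous_comp B fun q => ?_
    obtain ⟨q, p, hp, hq⟩ := q
    obtain ⟨p', hp', hmul⟩ := exists_seminorm_mul_le p hp
    have hs := (PolynormableSpace.withSeminorms ℂ A).continuousSMul
    let P : Seminorm ℂ A := p ⊔ p'
    have hP : Continuous P := hp.max hp'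
    let P' : Seminorm ℂ A := ((n + 2 : ℕ) : NNReal) • P
    have hP' : Continuous P' := continuous_const.smul hP
    have hPP' : ∀ x, P' x = (n + 2 : ℕ) * P x := fun x => by
      simp [P', NNReal.smul_def]
    have hpP : ∀ x, p x ≤ P x := fun x => le_max_left _ _
    have hpP' : ∀ x, p' x ≤ P x := fun x => le_max_right _ _
    have hmulP : ∀ x y, p (x * y) ≤ P x * P y := fun x y =>
      (hmul x y).trans (mul_le_mul (hpP' x) (hpP' y) (apply_nonneg _ _) (apply_nonneg _ _))
    refine (projTensorPow_withSeminorms A (n + 1)).continuous_seminorm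
      ⟨q.comp B, P', hP', fun a => ?_⟩
    have hface : ∀ j : Fin (n + 2), ∏ k, p (face j a k) ≤ ∏ i, P (a i) := by
      intro j
      obtain ⟨m, k₀, hm⟩ : ∃ (m : Fin (n + 2)) (k₀ : Fin (n + 1)), ∀ k,
          p (face j a k) ≤ (if k = k₀ then P (a m) else 1) * P (a (m.succAbove k)) := by
        by_cases hj : j = Fin.last (n + 1)
        · refine ⟨Fin.last (n + 1), 0, fun k => ?_⟩
          by_cases hk : k = 0
          · simpa [face, hj, hk] using hmulP (a (Fin.last (n + 1))) (a 0)
          · simpa [face, hj, hk] using hpP _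
        · obtain ⟨j, rfl⟩ := Fin.exists_castSucc_eq.2 hj
          refine ⟨j.castSucc, j, fun k => ?_⟩
          rw [face, if_neg hj]
          by_cases hk : k = j
          · subst hk
            rw [Fin.contractNth_apply_of_eq _ _ _ _ (by simp), if_pos rfl,
              Fin.succAbove_castSucc_self]
            exact hmulP _ _
          · rw [Fin.contractNth_apply_of_ne _ _ _ _
              (by simpa [Fin.ext_iff, eq_comm] using hk), if_neg hk, one_mul]
            exact hpP _
      calc ∏ k, p (face j a k)
          ≤ ∏ k, (if k = k₀ then P (a m) else 1) * P (a (m.succAbove k)) :=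
            Finset.prod_le_prod (fun _ _ => apply_nonneg _ _) fun k _ => hm k
        _ = ∏ i, P (a i) := by
            rw [Finset.prod_mul_distrib, Finset.prod_ite_eq' Finset.univ k₀,
              if_pos (Finset.mem_univ _), Fin.prod_univ_succAbove _ m]
    have hB : B (ProjTensorPow.tprod a) =
        ∑ j : Fin (n + 2), (-1 : ℂ) ^ (j : ℕ) • ProjTensorPow.tprod (face j a) := hochschildB_tprod A n a
    have hPnn : 0 ≤ ∏ i, P (a i) := Finset.prod_nonneg fun _ _ => apply_nonneg _ _
    calc q.comp B (ProjTensorPow.tprod a)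
        = q (B (ProjTensorPow.tprod a)) := rfl
      _ ≤ ∑ j : Fin (n + 2), q ((-1 : ℂ) ^ (j : ℕ) • ProjTensorPow.tprod (face j a)) := by
          rw [hB]
          exact Finset.le_sum_of_subadditive q (map_zero q).le (map_add_le_add q) _ _
      _ ≤ ∑ _j : Fin (n + 2), ∏ i, P (a i) := by
          refine Finset.sum_le_sum fun j _ => ?_
          rw [map_smul_eq_mul, norm_pow, norm_neg, norm_one, one_pow, one_mul]
          exact (hq _).trans (hface j)
      _ = (n + 2 : ℕ) * ∏ i, P (a i) := by simp
      _ ≤ (n + 2 : ℕ) ^ (n + 1 + 1) * ∏ i, P (a i) := by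
          refine mul_le_mul_of_nonneg_right ?_ hPnn
          exact le_self_pow₀ (by push_cast; linarith [n.cast_nonneg (α := ℝ)]) (by omega)
      _ = ∏ i, P' (a i) := by
          simp only [hPP', Finset.prod_mul_distrib, Finset.prod_const, Finset.card_univ,
            Fintype.card_fin]

/-- The continuous Hochschild complex of a locally convex topological algebra `A`, with chain
groups the completed projective tensor powers and with the continuous extension of `b` as
boundary operator. Its homology is `HH^cont_*(A)`. -/
def contHochschildComplex : ChainComplex (ModuleCat ℂ) ℕ :=
  ChainComplex.of (fun n => ModuleCat.of ℂ (CompletedTensorPow A n))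
    (fun n => ModuleCat.ofHom (hochschildBCont A n).completion.toLinearMap)
    (fun n => by
      rw [← ModuleCat.ofHom_comp, ← ModuleCat.ofHom_zero]
      congr 1
      ext x
      refine UniformSpace.Completion.induction_on x (isClosed_eq ?_ continuous_const) fun a => ?_
      · exact (hochschildBCont A n).completion.continuous.comp
          (hochschildBCont A (n + 1)).completion.continuous
      · simp only [LinearMap.comp_apply, ContinuousLinearMap.coe_coe,
          ContinuousLinearMap.completion_apply_coe, LinearMap.zero_apply]
        have h := LinearMap.congr_fun (hochschildB_comp A n) a
        rw [← UniformSpace.Completion.coe_zero]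
        exact congrArg _ h)

/-- The canonical map of the tensor power into its completion. -/
def toCompletedTensorPow (n : ℕ) : TensorPow A n →ₗ[ℂ] CompletedTensorPow A n where
  toFun x := ((show ProjTensorPow A n from x : ProjTensorPow A n) : CompletedTensorPow A n)
  map_add' _ _ := UniformSpace.Completion.coe_add _ _
  map_smul' c x := UniformSpace.Completion.coe_smul c (show ProjTensorPow A n from x)

variable {A}

/-- The chain map induced by an algebra homomorphism `φ : B → A`, which on elementary tensors is
`b_0 ⊗ ⋯ ⊗ b_n ↦ φ b_0 ⊗ ⋯ ⊗ φ b_n`. -/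
def hochschildToCont {B : Type _} [Ring B] [Algebra ℂ B] (φ : B →ₐ[ℂ] A) :
    hochschildComplex B ⟶ contHochschildComplex A :=
  ChainComplex.ofHom
    (fun n => ModuleCat.ofHom
      (toCompletedTensorPow A n ∘ₗ PiTensorProduct.map fun _ => φ.toLinearMap))
    (fun n => by
      simp only [hochschildComplex, contHochschildComplex, ChainComplex.of_d]
      rw [← ModuleCat.ofHom_comp, ← ModuleCat.ofHom_comp]
      congr 1
      refine PiTensorProduct.ext (MultilinearMap.ext fun a => ?_)
      have hB : hochschildBCont A n
          (PiTensorProduct.tprod ℂ (fun i => φ (a i)) : ProjTensorPow A (n + 1)) =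
          PiTensorProduct.map (fun _ => φ.toLinearMap)
            (hochschildB _ n (PiTensorProduct.tprod ℂ a)) := by
        refine (hochschildB_tprod A n _).trans ?_
        rw [hochschildB_tprod, map_sum]
        refine Finset.sum_congr rfl fun j _ => ?_
        rw [map_smul, PiTensorProduct.map_tprod]
        congr 2
        funext k
        simp only [face, Fin.contractNth, AlgHom.toLinearMap_apply]
        split_ifs <;> simp
      simp only [LinearMap.compMultilinearMap_apply, LinearMap.comp_apply,
        PiTensorProduct.map_tprod, AlgHom.toLinearMap_apply]
      refine ((hochschildBCont A n).completion_apply_coe _).trans ?_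
      exact congrArg _ hB)

end Continuous

/-! ### The `ℓ¹`-rapid decay algebra -/

section RD

variable {G : Type*} [Group G] (S : GenSet G)

/-- The group ring, endowed with the topology defined by the norms `‖f‖_{k,1}`. -/
def RDGroupRing (_S : GenSet G) : Type _ := MonoidAlgebra ℂ G

instance : Ring (RDGroupRing S) := inferInstanceAs (Ring (MonoidAlgebra ℂ G))

instance : Algebra ℂ (RDGroupRing S) := inferInstanceAs (Algebra ℂ (MonoidAlgebra ℂ G))

/-- The coefficients of an element of the group ring. -/
def RDGroupRing.coeff {S : GenSet G} (f : RDGroupRing S) : G →₀ ℂ := MonoidAlgebra.coeff f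

theorem GenSet.exists_word (g : G) :
    ∃ l : List G, (∀ s ∈ l, s ∈ S.carrier) ∧ l.prod = g := by
  have hg : g ∈ Subgroup.closure (S.carrier : Set G) := by rw [S.closure_eq_top]; trivial
  rw [← Subgroup.mem_toSubmonoid, Subgroup.closure_toSubmonoid] at hg
  obtain ⟨l, hl, h⟩ := Submonoid.exists_list_of_mem_closure hg
  refine ⟨l, fun s hs => ?_, h⟩
  rcases hl s hs with h | h
  · exact h
  · simpa using S.inv_mem _ h

theorem GenSet.wordLength_mul_le (g h : G) :
    S.wordLength (g * h) ≤ S.wordLength g + S.wordLength h := by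
  obtain ⟨l, hl, hg⟩ := S.exists_word g
  obtain ⟨m, hm, hh⟩ := S.exists_word h
  obtain ⟨l, hl, hg, hlen⟩ := Nat.sInf_mem (s := {n : ℕ | ∃ l : List G,
    (∀ s ∈ l, s ∈ S.carrier) ∧ l.prod = g ∧ l.length = n}) ⟨_, l, hl, hg, rfl⟩
  obtain ⟨m, hm, hh, hmen⟩ := Nat.sInf_mem (s := {n : ℕ | ∃ l : List G,
    (∀ s ∈ l, s ∈ S.carrier) ∧ l.prod = h ∧ l.length = n}) ⟨_, m, hm, hh, rfl⟩
  refine Nat.sInf_le ⟨l ++ m, ?_, by simp [hg, hh], ?_⟩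
  · intro s hs
    rcases List.mem_append.1 hs with h | h
    exacts [hl s h, hm s h]
  · rw [List.length_append, hlen, hmen]
    rfl

/-- The norm `‖f‖_{k,1} = ∑_g (1 + |g|)^k |f(g)|`. -/
def rdNorm (k : ℕ) : Seminorm ℂ (RDGroupRing S) :=
  Seminorm.of (fun f => f.coeff.sum fun g c => (1 + S.wordLength g : ℝ) ^ k * ‖c‖)
    (fun f f' => by
      classical
      have h0 : ∀ g ∈ f.coeff.support ∪ f'.coeff.support,
          (1 + S.wordLength g : ℝ) ^ k * ‖(0 : ℂ)‖ = 0 := by simp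
      have hadd : (f + f').coeff = f.coeff + f'.coeff := rfl
      rw [hadd, Finsupp.sum_of_support_subset _ Finsupp.support_add _ h0,
        Finsupp.sum_of_support_subset f.coeff Finset.subset_union_left _ h0,
        Finsupp.sum_of_support_subset f'.coeff Finset.subset_union_right _ h0,
        ← Finset.sum_add_distrib]
      refine Finset.sum_le_sum fun g _ => ?_
      rw [← mul_add]
      exact mul_le_mul_of_nonneg_left (norm_add_le _ _) (by positivity))
    (fun c f => by
      have hsmul : (c • f).coeff = c • f.coeff := rfl
      rw [hsmul, Finsupp.sum_smul_index' (by simp), Finsupp.mul_sum]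
      refine Finset.sum_congr rfl fun g _ => ?_
      simp only [norm_smul]
      ring)

theorem rdNorm_apply (k : ℕ) (f : RDGroupRing S) :
    rdNorm S k f = f.coeff.sum fun g c => (1 + S.wordLength g : ℝ) ^ k * ‖c‖ := rfl

theorem rdNorm_mul_le (k : ℕ) (f f' : RDGroupRing S) :
    rdNorm S k (f * f') ≤ rdNorm S k f * rdNorm S k f' := by
  have hmul : f * f' = ∑ g ∈ f.coeff.support, ∑ h ∈ f'.coeff.support,
      (MonoidAlgebra.single (g * h) (f.coeff g * f'.coeff h) : RDGroupRing S) :=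
    MonoidAlgebra.mul_def (R := ℂ) (M := G) _ _
  rw [hmul, rdNorm_apply S k f, rdNorm_apply S k f', Finsupp.sum, Finsupp.sum,
    Finset.sum_mul_sum]
  refine (Finset.le_sum_of_subadditive (rdNorm S k) (map_zero _).le (map_add_le_add _) _ _).trans
    (Finset.sum_le_sum fun g _ => ?_)
  refine (Finset.le_sum_of_subadditive (rdNorm S k) (map_zero _).le (map_add_le_add _) _ _).trans
    (Finset.sum_le_sum fun h _ => ?_)
  have hs : rdNorm S k (MonoidAlgebra.single (g * h) (f.coeff g * f'.coeff h) : RDGroupRing S) =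
      (1 + S.wordLength (g * h) : ℝ) ^ k * ‖f.coeff g * f'.coeff h‖ :=
    Finsupp.sum_single_index (h := fun x c => (1 + S.wordLength x : ℝ) ^ k * ‖c‖) (by simp)
  have hw : (S.wordLength (g * h) : ℝ) ≤ S.wordLength g + S.wordLength h := by
    exact_mod_cast S.wordLength_mul_le g h
  rw [hs, norm_mul, mul_mul_mul_comm, ← mul_pow]
  refine mul_le_mul_of_nonneg_right (pow_le_pow_left₀ (by positivity) ?_ k) (by positivity)
  have : (0 : ℝ) ≤ S.wordLength g * S.wordLength h := by positivity
  nlinarith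

theorem isTopologicalRing_of_submultiplicative {A ι : Type*} [Ring A] [Algebra ℂ A]
    [TopologicalSpace A] {p : SeminormFamily ℂ A ι} (hp : WithSeminorms p)
    (hmul : ∀ i a b, p i (a * b) ≤ p i a * p i b) : IsTopologicalRing A := by
  have := hp.topologicalAddGroup
  have h0 : ∀ i, Tendsto (p i) (𝓝 0) (𝓝 0) := fun i => by
    simpa using (hp.continuous_seminorm i).tendsto 0
  have hz : ∀ {X : Type _} (l : Filter X) (u : X → A),
      (∀ i, Tendsto (fun x => p i (u x)) l (𝓝 0)) → Tendsto u l (𝓝 0) := by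
    intro X l u h
    rw [hp.tendsto_nhds]
    intro i ε hε
    simpa using (h i).eventually (gt_mem_nhds hε)
  refine IsTopologicalRing.of_addGroup_of_nhds_zero ?_ ?_ ?_
  · refine hz _ _ fun i => ?_
    refine squeeze_zero (fun _ => apply_nonneg _ _) (fun x => hmul i x.1 x.2) ?_
    simpa using ((h0 i).comp tendsto_fst).mul ((h0 i).comp tendsto_snd)
  · refine fun a => hz _ _ fun i => ?_
    refine squeeze_zero (fun _ => apply_nonneg _ _) (fun x => hmul i a x) ?_
    simpa using (h0 i).const_mul (p i a)
  · refine fun a => hz _ _ fun i => ?_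
    refine squeeze_zero (fun _ => apply_nonneg _ _) (fun x => hmul i x a) ?_
    simpa using (h0 i).mul_const (p i a)

instance : TopologicalSpace (RDGroupRing S) :=
  SeminormFamily.moduleFilterBasis (𝕜 := ℂ) (rdNorm S) |>.topology

theorem rd_withSeminorms : WithSeminorms (𝕜 := ℂ) (rdNorm S) := ⟨rfl⟩

instance : IsTopologicalAddGroup (RDGroupRing S) := (rd_withSeminorms S).topologicalAddGroup

instance : UniformSpace (RDGroupRing S) :=
  IsTopologicalAddGroup.rightUniformSpace (RDGroupRing S)

instance : IsUniformAddGroup (RDGroupRing S) := isUniformAddGroup_of_addCommGroup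

instance : IsTopologicalRing (RDGroupRing S) :=
  isTopologicalRing_of_submultiplicative (rd_withSeminorms S) (rdNorm_mul_le S)

instance : ContinuousSMul ℂ (RDGroupRing S) := (rd_withSeminorms S).continuousSMul

instance : UniformContinuousConstSMul ℂ (RDGroupRing S) :=
  uniformContinuousConstSMul_of_continuousConstSMul ℂ (RDGroupRing S)

instance : PolynormableSpace ℂ (RDGroupRing S) := (rd_withSeminorms S).toPolynormableSpace

open UniformSpace in
instance completion_polynormable {E : Type*} [AddCommGroup E] [Module ℂ E] [UniformSpace E]
    [IsUniformAddGroup E] [UniformContinuousConstSMul ℂ E] [PolynormableSpace ℂ E] :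
    PolynormableSpace ℂ (Completion E) := by
  have hw := PolynormableSpace.withSeminorms ℂ E
  have huc : ∀ p : {p : Seminorm ℂ E // Continuous p}, UniformContinuous p.1 := fun p =>
    Seminorm.uniformContinuous_of_continuousAt_zero p.2.continuousAt
  let P : SeminormFamily ℂ (Completion E) {p : Seminorm ℂ E // Continuous p} := fun p =>
    Seminorm.of (Completion.extension p.1)
      (fun x y => Completion.induction_on₂ x y
        (isClosed_le (Completion.continuous_extension.comp continuous_add)
          ((Completion.continuous_extension.comp continuous_fst).add
            (Completion.continuous_extension.comp continuous_snd)))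
        fun a b => by
          rw [← Completion.coe_add]
          simp only [Completion.extension_coe (huc p)]
          exact map_add_le_add _ _ _)
      (fun c x => Completion.induction_on x
        (isClosed_eq (Completion.continuous_extension.comp (continuous_const_smul c))
          (continuous_const.mul Completion.continuous_extension))
        fun a => by
          rw [← Completion.coe_smul]
          simp only [Completion.extension_coe (huc p)]
          exact map_smul_eq_mul _ _ _)
  have hPc : ∀ p, Continuous (P p) := fun p => Completion.continuous_extension
  have hPcoe : ∀ p (a : E), P p (a : Completion E) = p.1 a := fun p a =>
    Completion.extension_coe (huc p) a
  have hP : WithSeminorms P := by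
    rw [SeminormFamily.withSeminorms_iff_nhds_eq_iInf]
    refine le_antisymm (le_iInf fun p => ?_) ?_
    · rw [← tendsto_iff_comap]
      simpa using (hPc p).tendsto 0
    · intro V hV
      obtain ⟨V', hV', hc, hsub⟩ := exists_mem_nhds_isClosed_subset hV
      have hpre : ((↑) : E → Completion E) ⁻¹' V' ∈ 𝓝 (0 : E) :=
        (Completion.continuous_coe E).continuousAt.preimage_mem_nhds (by rw [Completion.coe_zero]; exact hV')
      obtain ⟨⟨s, r⟩, hr, hb⟩ := hw.hasBasis_zero_ball.mem_iff.1 hpre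
      have hr : 0 < r := hr
      have hmem : {x | ∀ p ∈ s, P p x < r} ∈ ⨅ i, comap (P i) (𝓝 0) := by
        have : {x | ∀ p ∈ s, P p x < r} = ⋂ p ∈ s, {x | P p x < r} := by ext; simp
        rw [this, Filter.biInter_finset_mem]
        intro p _
        exact mem_iInf_of_mem p (preimage_mem_comap (gt_mem_nhds hr))
      refine mem_of_superset hmem fun x hx => hsub ?_
      have hopen : IsOpen {x | ∀ p ∈ s, P p x < r} := by
        have : {x | ∀ p ∈ s, P p x < r} = ⋂ p ∈ s, {x | P p x < r} := by ext; simp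
        rw [this]
        exact isOpen_biInter_finset fun p _ => isOpen_lt (hPc p) continuous_const
      have hx' := Completion.denseRange_coe.open_subset_closure_inter hopen hx
      refine closure_minimal ?_ hc hx'
      rintro _ ⟨hy, a, rfl⟩
      refine hb ?_
      simp only [Seminorm.mem_ball, sub_zero]
      exact Seminorm.finset_sup_apply_lt hr fun p hp => by simpa [hPcoe] using hy p hp
  exact hP.toPolynormableSpace

/-- The Fréchet algebra `ℓ¹_∞ G` : the completion of `ℂ G` for the norms `‖-‖_{k,1}`. -/
abbrev L1RD : Type _ := UniformSpace.Completion (RDGroupRing S)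

/-- The inclusion `ℂ G → ℓ¹_∞ G`. -/
def toL1RD : MonoidAlgebra ℂ G →ₐ[ℂ] L1RD S :=
  { (UniformSpace.Completion.coeRingHom : RDGroupRing S →+* L1RD S) with
    commutes' := fun _ => rfl }

/-- The natural map `HH_n(ℂ G) → HH^cont_n(ℓ¹_∞ G)`. -/
def hochschildComparison (n : ℕ) :
    (hochschildComplex (MonoidAlgebra ℂ G)).homology n ⟶
      (contHochschildComplex (L1RD S)).homology n :=
  HomologicalComplex.homologyMap (hochschildToCont (toL1RD S)) n

end RD

end RapidDecay

end

/-! The proof is by duality. If a Hochschild cycle `c` over `ℂG` is not a boundary, some linear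
functional kills all boundaries but not `c`. It is a cocycle, with no control on its growth. If it
can be replaced by a cocycle of polynomial growth that is still nonzero at `c`, the series over
tuples of group elements converges on `ℓ¹_∞ G` and gives a continuous functional on the completed
tensor power that vanishes on boundaries (`exists_functional_of_polynomial`). Then the image of `c`
is not a boundary either.

Faces preserve the conjugacy class of the product of a tuple, so the cocycle may be restricted to
one class. The tuples with product conjugate to `h` are `(rₙ⁻¹ h r₀, r₀⁻¹ r₁, …)`, with `r` unique
up to left multiplication by the centralizer `Z`, and Hochschild faces become omissions of one `r_j`
(`face_cyclicTuple`). Cocycles on the class are therefore `Z`-invariant homogeneous cocycles on `G`;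
the conjugacy bound keeps `r` polynomial in the size of the tuple.

The growth is improved in `exists_polynomial_cocycle`. Every augmented chain endomorphism `φ` of the
homogeneous complex of `G` is homotopic to the identity by coning from first vertices, naturally
enough that an equivariant `φ` changes an invariant cocycle by an invariant coboundary only. Let `φ`
pass through `EZ`: an equivariant map `G → Z` of linear growth (quasi-isometric embedding), then
minimal fillings in `EZ`, then an equivariant vertex map back to `G`. Modulo `Z` there are finitely
many simplices in each dimension, so the cocycle is bounded on simplices and its growth is that of
the fillings. This is polynomial by the Dehn functions and, in the lowest degree, by paths along
words (`exists_norm_equivFill_le`).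

Fillings exist because a contractible complex is acyclic (`exists_d_eq_of_contractible`), by
subdivision and approximation of a contraction by vertex maps. Dehn functions concern oriented
chains, the construction uses ordered ones; sorting compares them (`exists_filling_norm_le`). -/

noncomputable section

namespace RapidDecay

section

/-! ### Chains on lists

Ordered simplicial chains, with a list `[v₀, …, vₙ]` regarded as an ordered `n`-simplex, and with
the empty list in degree `-1`, so that the complex is augmented. -/

/-- Integral combinations of lists. -/
abbrev ListChain (V : Type*) : Type _ := List V →₀ ℤ

namespace ListChain

variable {V W : Type*}

/-- The chain of a single list. -/
abbrev of (l : List V) : ListChain V := Finsupp.single l 1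

/-- Linear extension of a function on lists. -/
abbrev ext {M : Type*} [AddCommGroup M] (f : List V → M) : ListChain V →ₗ[ℤ] M :=
  Finsupp.linearCombination ℤ f

theorem ext_of {M : Type*} [AddCommGroup M] (f : List V → M) (l : List V) :
    ext f (of l) = f l := by simp

theorem hom_ext {M : Type*} [AddCommGroup M] {f g : ListChain V →ₗ[ℤ] M}
    (h : ∀ l, f (of l) = g (of l)) : f = g :=
  Finsupp.lhom_ext' fun l => LinearMap.ext_ring (h l)

/-- The chains carried by a set of lists. -/
abbrev supp (s : Set (List V)) : Submodule ℤ (ListChain V) := Finsupp.supported ℤ ℤ s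

theorem of_mem {s : Set (List V)} {l : List V} (h : l ∈ s) : of l ∈ supp s :=
  Finsupp.single_mem_supported ℤ 1 h

theorem supp_mono {s t : Set (List V)} (h : s ⊆ t) : supp s ≤ supp t :=
  Finsupp.supported_mono h

theorem map_mem {M : Type*} [AddCommGroup M] {N : Submodule ℤ M} {s : Set (List V)}
    (f : ListChain V →ₗ[ℤ] M) (h : ∀ l ∈ s, f (of l) ∈ N) {c : ListChain V} (hc : c ∈ supp s) :
    f c ∈ N := by
  rw [supp, Finsupp.supported_eq_span_single] at hc
  refine Submodule.span_induction (p := fun c _ => f c ∈ N) ?_ ?_ ?_ ?_ hc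
  · rintro _ ⟨l, hl, rfl⟩
    exact h l hl
  · simp
  · intro x y _ _ hx hy
    rw [map_add]
    exact N.add_mem hx hy
  · intro a x _ hx
    rw [map_smul]
    exact N.smul_mem a hx

theorem map_congr {M : Type*} [AddCommGroup M] {s : Set (List V)}
    {f g : ListChain V →ₗ[ℤ] M} (h : ∀ l ∈ s, f (of l) = g (of l)) {c : ListChain V}
    (hc : c ∈ supp s) : f c = g c := by
  have := map_mem (N := (⊥ : Submodule ℤ M)) (f - g) (fun l hl => by simp [h l hl]) hc
  simpa [sub_eq_zero] using this

/-- Prepend a vertex. -/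
def cone (v : V) : ListChain V →ₗ[ℤ] ListChain V := Finsupp.lmapDomain ℤ ℤ (List.cons v)

@[simp] theorem cone_of (v : V) (l : List V) : cone v (of l) = of (v :: l) := by simp [cone]

/-- The boundary of a list. -/
def dList : List V → ListChain V
  | [] => 0
  | v :: l => of l - cone v (dList l)

/-- The boundary operator. -/
def d : ListChain V →ₗ[ℤ] ListChain V := ext dList

@[simp] theorem d_nil : d (of ([] : List V)) = 0 := by simp [d, dList]

theorem d_cons (v : V) (l : List V) : d (of (v :: l)) = of l - cone v (d (of l)) := by
  simp [d, dList]

/-- Coning is a contracting homotopy in every degree: the empty list in degree `-1` absorbs the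
usual exception for vertices. Hence the cone over a cycle has that cycle as boundary. -/
theorem d_cone (v : V) (c : ListChain V) : d (cone v c) = c - cone v (d c) := by
  have : d ∘ₗ cone v = LinearMap.id - cone v ∘ₗ d := hom_ext fun l => by simp [d_cons]
  exact LinearMap.congr_fun this c

@[simp] theorem d_d (c : ListChain V) : d (d c) = 0 := by
  have : d ∘ₗ d = (0 : ListChain V →ₗ[ℤ] ListChain V) := hom_ext fun l => by
    induction l with
    | nil => simp
    | cons v l ih =>
      have ih : d (d (of l)) = 0 := ih
      simp [d_cons, d_cone, ih]
  exact LinearMap.congr_fun this c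

theorem d_of_mem (l : List V) :
    d (of l) ∈ supp {m | m.Sublist l ∧ m.length + 1 = l.length} := by
  induction l with
  | nil => simp
  | cons v l ih =>
    rw [d_cons]
    refine Submodule.sub_mem _ ?_ (map_mem _ (fun m hm => ?_) ih)
    · apply of_mem
      exact ⟨List.sublist_cons_self v l, rfl⟩
    · rw [cone_of]
      apply of_mem
      exact ⟨hm.1.cons_cons v, by simpa using hm.2⟩

/-- The lists of length `n` with a property `P`. -/
def lists (P : List V → Prop) (n : ℕ) : Set (List V) := {l | P l ∧ l.length = n}

/-- A property of lists inherited by sublists. -/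
def Hereditary (P : List V → Prop) : Prop := ∀ l m : List V, m.Sublist l → P l → P m

theorem d_mem {P : List V → Prop} (hP : Hereditary P) {n : ℕ} {c : ListChain V}
    (hc : c ∈ supp (lists P (n + 1))) : d c ∈ supp (lists P n) := by
  refine map_mem _ (fun l hl => ?_) hc
  have hsub : {m | m.Sublist l ∧ m.length + 1 = l.length} ⊆ lists P n := fun m hm =>
    ⟨hP l m hm.1 hl.1, by have h1 := hm.2; have h2 := hl.2; omega⟩
  exact supp_mono hsub (d_of_mem l)

theorem d_mem_length {n : ℕ} {l : List V} (hl : l.length = n + 1) :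
    d (of l) ∈ supp (lists (fun m => m.Sublist l) n) := by
  have hsub : {m | m.Sublist l ∧ m.length + 1 = l.length} ⊆ lists (fun m => m.Sublist l) n :=
    fun m hm => ⟨hm.1, by have := hm.2; omega⟩
  exact supp_mono hsub (d_of_mem l)

theorem cone_mem {P Q : List V → Prop} {n : ℕ} {v : V} (h : ∀ l, P l → Q (v :: l))
    {c : ListChain V} (hc : c ∈ supp (lists P n)) : cone v c ∈ supp (lists Q (n + 1)) :=
  map_mem _ (fun l hl => by
    rw [cone_of]
    exact of_mem ⟨h l hl.1, by simpa using hl.2⟩) hc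

/-- The chain map induced by a map of vertices. -/
def map (f : V → W) : ListChain V →ₗ[ℤ] ListChain W := Finsupp.lmapDomain ℤ ℤ (List.map f)

@[simp] theorem map_of (f : V → W) (l : List V) : map f (of l) = of (l.map f) := by simp [map]

theorem map_cone (f : V → W) (v : V) (c : ListChain V) :
    map f (cone v c) = cone (f v) (map f c) := by
  have : map f ∘ₗ cone v = cone (f v) ∘ₗ map f := hom_ext fun l => by simp
  exact LinearMap.congr_fun this c

theorem d_map (f : V → W) (c : ListChain V) : d (map f c) = map f (d c) := by
  have : d ∘ₗ map f = map f ∘ₗ d := hom_ext fun l => by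
    induction l with
    | nil => simp
    | cons v l ih =>
      have ih : d (map f (of l)) = map f (d (of l)) := ih
      rw [map_of] at ih
      simp only [LinearMap.comp_apply, map_of, List.map_cons, d_cons, map_sub, map_cone, ih]
  exact LinearMap.congr_fun this c

theorem map_mem_lists {P : List V → Prop} {Q : List W → Prop} {f : V → W} {n : ℕ}
    (h : ∀ l, P l → Q (l.map f)) {c : ListChain V} (hc : c ∈ supp (lists P n)) :
    map f c ∈ supp (lists Q n) :=
  map_mem _ (fun l hl => by
    rw [map_of]
    exact of_mem ⟨h l hl.1, by simpa using hl.2⟩) hc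

/-- The prism on a list, a homotopy between two maps of vertices. -/
def prismList (f g : V → W) : List V → ListChain W
  | [] => 0
  | v :: l => of (f v :: g v :: l.map g) - cone (f v) (prismList f g l)

/-- The prism operator. -/
def prism (f g : V → W) : ListChain V →ₗ[ℤ] ListChain W := ext (prismList f g)

@[simp] theorem prism_nil (f g : V → W) : prism f g (of []) = 0 := by simp [prism, prismList]

theorem prism_cons (f g : V → W) (v : V) (l : List V) :
    prism f g (of (v :: l)) = cone (f v) (cone (g v) (map g (of l))) -
      cone (f v) (prism f g (of l)) := by
  simp [prism, prismList]

theorem prism_cone (f g : V → W) (v : V) (c : ListChain V) :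
    prism f g (cone v c) = cone (f v) (cone (g v) (map g c)) - cone (f v) (prism f g c) := by
  have : prism f g ∘ₗ cone v = cone (f v) ∘ₗ cone (g v) ∘ₗ map g - cone (f v) ∘ₗ prism f g :=
    hom_ext fun l => by
      rw [LinearMap.comp_apply, cone_of, prism_cons]
      rfl
  exact LinearMap.congr_fun this c

/-- The prism over `v :: l` is a cone from `f v`. The cone formula and the identity for `l` leave
only the two ends and the prism over the faces. -/
theorem d_prism (f g : V → W) (c : ListChain V) :
    d (prism f g c) = map g c - map f c - prism f g (d c) := by
  have : d ∘ₗ prism f g = map g - map f - prism f g ∘ₗ d := hom_ext fun l => by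
    induction l with
    | nil => simp
    | cons v l ih =>
      have ih : d (prism f g (of l)) = map g (of l) - map f (of l) - prism f g (d (of l)) := ih
      simp only [LinearMap.comp_apply, LinearMap.sub_apply, d_cons, prism_cons, map_sub, d_cone,
        ih, prism_cone, map_of, List.map_cons, cone_of, ← d_map]
      abel
  exact LinearMap.congr_fun this c

/-- The prism has no vertices besides the images of `l` under `f` and `g`. `P` is generalized
because the induction is applied to the tail with the property of having entries of this kind. -/
theorem prism_mem {P : List W → Prop} {f g : V → W} (l : List V)
    (h : ∀ m : List W, (∀ w ∈ m, ∃ v ∈ l, w = f v ∨ w = g v) → P m) :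
    prism f g (of l) ∈ supp (lists P (l.length + 1)) := by
  induction l generalizing P with
  | nil => simp
  | cons v l ih =>
    rw [prism_cons]
    refine Submodule.sub_mem _ ?_ ?_
    · rw [map_of, cone_of, cone_of]
      refine of_mem ⟨h _ fun w hw => ?_, by simp⟩
      simp only [List.mem_cons, List.mem_map] at hw
      rcases hw with rfl | rfl | ⟨a, ha, rfl⟩
      · exact ⟨v, by simp, Or.inl rfl⟩
      · exact ⟨v, by simp, Or.inr rfl⟩
      · exact ⟨a, by simp [ha], Or.inr rfl⟩
    · refine cone_mem (P := fun m => ∀ w ∈ m, ∃ v ∈ l, w = f v ∨ w = g v) (fun m hm => ?_)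
        (ih fun m hm => hm)
      refine h _ fun w hw => ?_
      rcases List.mem_cons.1 hw with rfl | hw
      · exact ⟨v, by simp, Or.inl rfl⟩
      · obtain ⟨a, ha, h⟩ := hm w hw
        exact ⟨a, by simp [ha], h⟩

/-! #### The `ℓ¹`-norm -/

/-- The `ℓ¹`-norm of a chain. -/
def norm (c : ListChain V) : ℕ := c.sum fun _ m => m.natAbs

@[simp] theorem norm_zero : norm (0 : ListChain V) = 0 := by simp [norm]

@[simp] theorem norm_of (l : List V) : norm (of l) = 1 := by simp [norm]

theorem norm_add_le (c c' : ListChain V) : norm (c + c') ≤ norm c + norm c' := by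
  classical
  have h0 : ∀ l ∈ c.support ∪ c'.support, (0 : ℤ).natAbs = 0 := by simp
  rw [norm, norm, norm, Finsupp.sum_of_support_subset _ Finsupp.support_add _ h0,
    Finsupp.sum_of_support_subset c Finset.subset_union_left _ h0,
    Finsupp.sum_of_support_subset c' Finset.subset_union_right _ h0, ← Finset.sum_add_distrib]
  exact Finset.sum_le_sum fun l _ => Int.natAbs_add_le _ _

@[simp] theorem norm_neg (c : ListChain V) : norm (-c) = norm c := by
  rw [norm, Finsupp.sum_neg_index (by simp)]
  simp [norm]

theorem norm_sub_le (c c' : ListChain V) : norm (c - c') ≤ norm c + norm c' := by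
  simpa [sub_eq_add_neg] using norm_add_le c (-c')

theorem norm_smul (m : ℤ) (c : ListChain V) : norm (m • c) = m.natAbs * norm c := by
  rw [norm, Finsupp.sum_smul_index' (by simp), norm, Finsupp.mul_sum]
  simp [Int.natAbs_mul]

theorem norm_sum_le {ι : Type*} (s : Finset ι) (f : ι → ListChain V) :
    norm (∑ i ∈ s, f i) ≤ ∑ i ∈ s, norm (f i) :=
  Finset.le_sum_of_subadditive norm norm_zero.le norm_add_le _ _

theorem norm_map_le {s : Set (List V)} (f : ListChain V →ₗ[ℤ] ListChain W) {B : ℕ}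
    (hf : ∀ l ∈ s, norm (f (of l)) ≤ B) {c : ListChain V} (hc : c ∈ supp s) :
    norm (f c) ≤ B * norm c := by
  have h1 : f c = ∑ l ∈ c.support, c l • f (of l) := by
    conv_lhs => rw [← c.sum_single]
    rw [Finsupp.sum, map_sum]
    refine Finset.sum_congr rfl fun l _ => ?_
    rw [← map_smul, Finsupp.smul_single, smul_eq_mul, mul_one]
  rw [h1]
  refine (norm_sum_le _ _).trans ?_
  rw [norm, Finsupp.sum, Finset.mul_sum]
  refine Finset.sum_le_sum fun l hl => ?_
  rw [norm_smul, mul_comm]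
  exact Nat.mul_le_mul_right _ (hf l (hc hl))

theorem norm_cone_le (v : V) (c : ListChain V) : norm (cone v c) ≤ norm c := by
  simpa using norm_map_le (s := Set.univ) (B := 1) (cone v) (fun l _ => by simp)
    (c := c) (by simp [supp])

theorem norm_map_vertices_le (f : V → W) (c : ListChain V) : norm (map f c) ≤ norm c := by
  simpa using norm_map_le (s := Set.univ) (B := 1) (map f) (fun l _ => by simp)
    (c := c) (by simp [supp])

theorem norm_d_of_le (l : List V) : norm (d (of l)) ≤ l.length := by
  induction l with
  | nil => simp
  | cons v l ih =>
    rw [d_cons]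
    refine (norm_sub_le _ _).trans ?_
    have := norm_cone_le v (d (of l))
    simp only [norm_of, List.length_cons]
    omega

/-! #### Chain maps and homotopies -/

/-- A family of linear maps (one for each degree) is an augmented chain map on the lists with a
property `P`. -/
structure IsChainMap (P : List V → Prop) (φ : ℕ → ListChain V →ₗ[ℤ] ListChain W) : Prop where
  nil : φ 0 (of []) = of []
  d_comm : ∀ (n : ℕ) (l : List V), P l → l.length = n + 1 → d (φ (n + 1) (of l)) = φ n (d (of l))

theorem IsChainMap.d_comm_apply {P : List V → Prop} {φ : ℕ → ListChain V →ₗ[ℤ] ListChain W}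
    (h : IsChainMap P φ) {n : ℕ} {c : ListChain V} (hc : c ∈ supp (lists P (n + 1))) :
    d (φ (n + 1) c) = φ n (d c) :=
  map_congr (f := d ∘ₗ φ (n + 1)) (g := φ n ∘ₗ d) (fun l hl => h.d_comm n l hl.1 hl.2) hc

theorem IsChainMap.comp {U : Type*} {P : List V → Prop} {Q : List W → Prop}
    {φ : ℕ → ListChain V →ₗ[ℤ] ListChain W} {ψ : ℕ → ListChain W →ₗ[ℤ] ListChain U}
    (hψ : IsChainMap Q ψ) (hφ : IsChainMap P φ)
    (hmem : ∀ n, ∀ l ∈ lists P n, φ n (of l) ∈ supp (lists Q n)) :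
    IsChainMap P fun n => ψ n ∘ₗ φ n where
  nil := by rw [LinearMap.comp_apply, hφ.nil, hψ.nil]
  d_comm n l hl hn := by
    rw [LinearMap.comp_apply, hψ.d_comm_apply (hmem _ l ⟨hl, hn⟩), hφ.d_comm n l hl hn]
    rfl

theorem isChainMap_map (P : List V → Prop) (f : V → W) : IsChainMap P fun _ => map f where
  nil := by simp
  d_comm _ l _ _ := d_map f (of l)

/-- The homotopy between the identity and a chain endomorphism obtained by coning from the first
vertex of each list. -/
def headHomotopy (φ : ℕ → ListChain V →ₗ[ℤ] ListChain V) : ℕ → ListChain V →ₗ[ℤ] ListChain V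
  | 0 => 0
  | n + 1 => ext fun l => match l with
    | [] => 0
    | v :: l => cone v (φ (n + 1) (of (v :: l)) - of (v :: l) -
        headHomotopy φ n (d (of (v :: l))))

theorem headHomotopy_cons (φ : ℕ → ListChain V →ₗ[ℤ] ListChain V) (n : ℕ) (v : V) (l : List V) :
    headHomotopy φ (n + 1) (of (v :: l)) = cone v (φ (n + 1) (of (v :: l)) - of (v :: l) -
        headHomotopy φ n (d (of (v :: l)))) := by
  rw [headHomotopy, ext_of]

/-- With `H` the homotopy, `φ l - l - H (d l)` is a cycle, because `φ` commutes with `d` and the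
identity one degree lower gives `d H d = φ d - d`. Its cone from the head of the list therefore
fills it. The induction starts from `H = 0` since `φ` fixes the empty list. -/
theorem d_headHomotopy {P : List V → Prop} (hP : Hereditary P)
    {φ : ℕ → ListChain V →ₗ[ℤ] ListChain V} (h : IsChainMap P φ) (n : ℕ) :
    ∀ c ∈ supp (lists P (n + 1)), d (headHomotopy φ (n + 1) c) =
      φ (n + 1) c - c - headHomotopy φ n (d c) := by
  induction n with
  | zero =>
    intro c hc
    refine map_congr (f := d ∘ₗ headHomotopy φ 1)
      (g := φ 1 - LinearMap.id - headHomotopy φ 0 ∘ₗ d) (fun l hl => ?_) hc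
    obtain ⟨hl, hn⟩ := hl
    obtain ⟨v, rfl⟩ := List.length_eq_one_iff.1 hn
    have h1 := h.d_comm 0 _ hl rfl
    have h2 : d (of [v]) = of [] := by simp [d_cons]
    rw [h2, h.nil] at h1
    simp only [LinearMap.comp_apply, LinearMap.sub_apply, headHomotopy_cons, d_cone, map_sub, h1,
      h2]
    simp [headHomotopy]
  | succ n ih =>
    intro c hc
    refine map_congr (f := d ∘ₗ headHomotopy φ (n + 2))
      (g := φ (n + 2) - LinearMap.id - headHomotopy φ (n + 1) ∘ₗ d) (fun l hl => ?_) hc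
    have hd := d_mem hP (of_mem hl)
    obtain ⟨hl, hn⟩ := hl
    match l, hn with
    | v :: l, hn =>
      have h1 := h.d_comm (n + 1) _ hl hn
      have h2 := ih _ hd
      have h3 : d (φ (n + 2) (of (v :: l)) - of (v :: l) -
          headHomotopy φ (n + 1) (d (of (v :: l)))) = 0 := by
        rw [map_sub, map_sub, h1, h2]
        simp
      simp only [LinearMap.comp_apply, headHomotopy_cons, d_cone, h3]
      simp

/-- If `φ` maps each list into a carrier containing it, so does the homotopy. -/
theorem headHomotopy_mem {s : Set V} {φ : ℕ → ListChain V →ₗ[ℤ] ListChain V}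
    (h : ∀ n, ∀ l ∈ lists (fun l => ∀ v ∈ l, v ∈ s) n,
      φ n (of l) ∈ supp (lists (fun l => ∀ v ∈ l, v ∈ s) n)) (n : ℕ) :
    ∀ c ∈ supp (lists (fun l => ∀ v ∈ l, v ∈ s) n),
      headHomotopy φ n c ∈ supp (lists (fun l => ∀ v ∈ l, v ∈ s) (n + 1)) := by
  have hP : Hereditary fun l => ∀ v ∈ l, v ∈ s := fun l m hm hl v hv => hl v (hm.subset hv)
  induction n with
  | zero =>
    intro c _
    simp [headHomotopy]
  | succ n ih =>
    intro c hc
    refine map_mem _ (fun l hl => ?_) hc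
    have hd := ih _ (d_mem hP (of_mem hl))
    have hφ := h _ l hl
    obtain ⟨h1, h2⟩ := hl
    match l, h2 with
    | v :: l, h2 =>
      rw [headHomotopy_cons]
      refine cone_mem (P := fun l => ∀ v ∈ l, v ∈ s) (fun m hm w hw => ?_)
        (Submodule.sub_mem _ (Submodule.sub_mem _ hφ (of_mem ⟨h1, h2⟩)) hd)
      rcases List.mem_cons.1 hw with rfl | hw
      · exact h1 w (by simp)
      · exact hm w hw

/-- The homotopy has bounded norm if `φ` has. -/
theorem exists_norm_headHomotopy_le {φ : ℕ → ListChain V →ₗ[ℤ] ListChain V}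
    (h : ∀ n l, norm (φ n (of l)) ≤ 1) (n : ℕ) :
    ∃ B, ∀ c ∈ supp (lists (fun _ : List V => True) n), norm (headHomotopy φ n c) ≤ B * norm c := by
  induction n with
  | zero => exact ⟨0, fun c _ => by simp [headHomotopy]⟩
  | succ n ih =>
    obtain ⟨B, hB⟩ := ih
    -- The `2` comes from `φ l` and `l`; the boundary has norm at most the number `n + 1` of faces.
    refine ⟨2 + B * (n + 1), fun c hc => norm_map_le _ (fun l hl => ?_) hc⟩
    have hd := hB _ (d_mem (fun _ _ _ _ => trivial) (of_mem hl))
    have h2 := hl.2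
    match l, h2 with
    | v :: l, h2 =>
      rw [headHomotopy_cons]
      have h3 := norm_d_of_le (v :: l)
      rw [h2] at h3
      refine (norm_cone_le _ _).trans ((norm_sub_le _ _).trans ?_)
      refine Nat.add_le_add ((norm_sub_le _ _).trans ?_) (hd.trans (Nat.mul_le_mul_left _ h3))
      rw [norm_of]
      have := h (n + 1) (v :: l)
      omega

/-- The homotopy is natural for the bijections of the vertices which commute with `φ`. -/
theorem map_headHomotopy {φ : ℕ → ListChain V →ₗ[ℤ] ListChain V} {g : V → V}
    (h : ∀ n l, φ n (map g (of l)) = map g (φ n (of l))) (n : ℕ) (c : ListChain V) :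
    headHomotopy φ n (map g c) = map g (headHomotopy φ n c) := by
  induction n generalizing c with
  | zero => simp [headHomotopy]
  | succ n ih =>
    have : headHomotopy φ (n + 1) ∘ₗ map g = map g ∘ₗ headHomotopy φ (n + 1) :=
      hom_ext fun l => by
        match l with
        | [] => simp [headHomotopy]
        | v :: l =>
          have h1 := h (n + 1) (v :: l)
          have h2 := ih (d (of (v :: l)))
          rw [← d_map] at h2
          rw [map_of, List.map_cons] at h1 h2
          simp only [LinearMap.comp_apply, map_of, List.map_cons]
          rw [headHomotopy_cons, headHomotopy_cons, h1, h2, map_cone, map_sub (map g),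
            map_sub (map g), map_of, List.map_cons]
    exact LinearMap.congr_fun this c

end ListChain

end

section

/-! ### Ordered chains and oriented chains -/

namespace ListChain

variable {V : Type*} [LinearOrder V]

/-- Insertion of a vertex into a strictly increasing list, with the sign of the permutation
involved; it is `0` if the vertex is already there. -/
def insList (v : V) : List V → ListChain V
  | [] => of [v]
  | w :: l => if v < w then of (v :: w :: l) else if v = w then 0 else -cone w (insList v l)

/-- The linear extension of `insList`. -/
def ins (v : V) : ListChain V →ₗ[ℤ] ListChain V := ext (insList v)

@[simp] theorem ins_nil (v : V) : ins v (of []) = of [v] := by simp [ins, insList]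

theorem ins_cons_of_lt {v w : V} (h : v < w) (l : List V) :
    ins v (of (w :: l)) = of (v :: w :: l) := by simp [ins, insList, h]

theorem ins_cons_self (v : V) (l : List V) : ins v (of (v :: l)) = 0 := by simp [ins, insList]

theorem ins_cons_of_gt {v w : V} (h : w < v) (l : List V) :
    ins v (of (w :: l)) = -cone w (ins v (of l)) := by
  simp [ins, insList, h.not_gt, h.ne']

theorem ins_of_forall_lt {v : V} {l : List V} (h : ∀ w ∈ l, v < w) :
    ins v (of l) = cone v (of l) := by
  match l with
  | [] => simp
  | w :: l => rw [ins_cons_of_lt (h w (by simp)), cone_of]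

theorem ins_cone_self (v : V) (c : ListChain V) : ins v (cone v c) = 0 := by
  have : ins v ∘ₗ cone v = 0 := hom_ext fun l => by
    rw [LinearMap.comp_apply, cone_of, ins_cons_self]; rfl
  exact LinearMap.congr_fun this c

theorem ins_cone_of_gt {v w : V} (h : w < v) (c : ListChain V) :
    ins v (cone w c) = -cone w (ins v c) := by
  have : ins v ∘ₗ cone w = -(cone w ∘ₗ ins v) := hom_ext fun l => by
    rw [LinearMap.comp_apply, cone_of, ins_cons_of_gt h]; rfl
  exact LinearMap.congr_fun this c

/-- Signed insertion is an antisymmetrized cone, so on increasing lists it satisfies the same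
boundary formula as `cone`. -/
theorem d_ins (v : V) {l : List V} (hl : l.Pairwise (· < ·)) :
    d (ins v (of l)) = of l - ins v (d (of l)) := by
  induction l with
  | nil => simp [d_cons]
  | cons w m ih =>
    obtain ⟨hw, hm⟩ := List.pairwise_cons.1 hl
    rcases lt_trichotomy v w with h | rfl | h
    · have h1 : ins v (d (of (w :: m))) = cone v (d (of (w :: m))) := by
        refine map_congr (fun l hl => ins_of_forall_lt fun x hx => ?_) (d_of_mem (w :: m))
        rcases List.mem_cons.1 (hl.1.subset hx) with rfl | hx
        · exact h
        · exact h.trans (hw x hx)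
      rw [ins_cons_of_lt h, h1, d_cons]
    -- If `v` is already the head, insertion kills the list and all its faces that contain `v`,
    -- while the face opposite `v` gives the list back.
    · rw [ins_cons_self, d_cons, map_sub, ins_cone_self, ins_of_forall_lt hw]
      simp
    · rw [ins_cons_of_gt h, map_neg, d_cone, ih hm, d_cons, map_sub (ins v), ins_cone_of_gt h,
        map_sub, cone_of]
      abel

theorem ins_mem (v : V) {l : List V} (hl : l.Pairwise (· < ·)) :
    ins v (of l) ∈ supp (lists (fun m => m.Pairwise (· < ·) ∧ ∀ x ∈ m, x ∈ v :: l)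
      (l.length + 1)) := by
  induction l with
  | nil =>
    rw [ins_nil]
    apply of_mem
    simp [lists]
  | cons w m ih =>
    obtain ⟨hw, hm⟩ := List.pairwise_cons.1 hl
    rcases lt_trichotomy v w with h | rfl | h
    · rw [ins_cons_of_lt h]
      apply of_mem
      refine ⟨⟨List.pairwise_cons.2 ⟨fun x hx => ?_, hl⟩, fun x hx => hx⟩, rfl⟩
      rcases List.mem_cons.1 hx with rfl | hx
      · exact h
      · exact h.trans (hw x hx)
    · rw [ins_cons_self]
      exact Submodule.zero_mem _
    · rw [ins_cons_of_gt h]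
      refine Submodule.neg_mem _ (cone_mem (fun l hl => ?_) (ih hm))
      refine ⟨List.pairwise_cons.2 ⟨fun x hx => ?_, hl.1⟩, fun x hx => ?_⟩
      · rcases List.mem_cons.1 (hl.2 x hx) with rfl | hx
        · exact h
        · exact hw x hx
      · rcases List.mem_cons.1 hx with rfl | hx
        · simp
        · have := hl.2 x hx
          simp only [List.mem_cons] at this ⊢
          tauto

theorem norm_ins_of_le (v : V) (l : List V) : norm (ins v (of l)) ≤ 1 := by
  induction l with
  | nil => simp
  | cons w l ih =>
    rcases lt_trichotomy v w with h | rfl | h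
    · simp [ins_cons_of_lt h]
    · simp [ins_cons_self]
    · rw [ins_cons_of_gt h, norm_neg]
      exact (norm_cone_le _ _).trans ih

/-- The increasing rearrangement of a list, with a sign; `0` if the list has repetitions. -/
def sortList : List V → ListChain V
  | [] => of []
  | v :: l => ins v (sortList l)

/-- The linear extension of `sortList`. -/
def sort : ListChain V →ₗ[ℤ] ListChain V := ext sortList

@[simp] theorem sort_nil : sort (of ([] : List V)) = of [] := by simp [sort, sortList]

theorem sort_cons (v : V) (l : List V) : sort (of (v :: l)) = ins v (sort (of l)) := by
  simp [sort, sortList]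

theorem sort_cone (v : V) (c : ListChain V) : sort (cone v c) = ins v (sort c) := by
  have : sort ∘ₗ cone v = ins v ∘ₗ sort := hom_ext fun l => by
    rw [LinearMap.comp_apply, cone_of, sort_cons]; rfl
  exact LinearMap.congr_fun this c

theorem sort_mem (l : List V) :
    sort (of l) ∈ supp (lists (fun m => m.Pairwise (· < ·) ∧ ∀ x ∈ m, x ∈ l) l.length) := by
  induction l with
  | nil =>
    rw [sort_nil]
    apply of_mem
    simp [lists]
  | cons v l ih =>
    rw [sort_cons]
    refine map_mem _ (fun m hm => ?_) ih
    have hsub : lists (fun k => k.Pairwise (· < ·) ∧ ∀ x ∈ k, x ∈ v :: m) (m.length + 1) ⊆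
        lists (fun k => k.Pairwise (· < ·) ∧ ∀ x ∈ k, x ∈ v :: l) (v :: l).length := by
      rintro k ⟨⟨h1, h2⟩, h3⟩
      refine ⟨⟨h1, fun x hx => ?_⟩, by rw [h3, hm.2]; rfl⟩
      have := h2 x hx
      simp only [List.mem_cons] at this ⊢
      exact this.imp_right (hm.1.2 x)
    exact supp_mono hsub (ins_mem v hm.1.1)

/-- Sorting turns coning into insertion, and the two have the same boundary formula. -/
theorem d_sort (c : ListChain V) : d (sort c) = sort (d c) := by
  have : d ∘ₗ sort = sort ∘ₗ (d : ListChain V →ₗ[ℤ] ListChain V) := hom_ext fun l => by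
    induction l with
    | nil => simp
    | cons v l ih =>
      have ih : d (sort (of l)) = sort (d (of l)) := ih
      have h1 : d (ins v (sort (of l))) = sort (of l) - ins v (d (sort (of l))) :=
        map_congr (f := d ∘ₗ ins v) (g := LinearMap.id - ins v ∘ₗ d)
          (fun m hm => d_ins v hm.1.1) (sort_mem l)
      rw [LinearMap.comp_apply, LinearMap.comp_apply, sort_cons, h1, ih, d_cons, map_sub,
        sort_cone]
  exact LinearMap.congr_fun this c

theorem isChainMap_sort : IsChainMap (fun _ : List V => True) fun _ => sort where
  nil := sort_nil
  d_comm _ l _ _ := d_sort (of l)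

theorem norm_sort_of_le (l : List V) : norm (sort (of l)) ≤ 1 := by
  induction l with
  | nil => simp
  | cons v l ih =>
    rw [sort_cons]
    have := norm_map_le (s := Set.univ) (B := 1) (ins v) (fun m _ => norm_ins_of_le v m)
      (c := sort (of l)) (by simp [supp])
    omega

theorem norm_sort_le (c : ListChain V) : norm (sort c) ≤ norm c := by
  simpa using norm_map_le (s := Set.univ) (B := 1) sort (fun l _ => norm_sort_of_le l)
    (c := c) (by simp [supp])

/-- This matches the recursive boundary with the convention of `boundary`, where the sign counts the
smaller vertices. -/
theorem d_of_pairwise {l : List V} (hl : l.Pairwise (· < ·)) :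
    d (of l) = ∑ v ∈ l.toFinset,
      (-1 : ℤ) ^ (l.toFinset.filter (· < v)).card • of (l.erase v) := by
  induction l with
  | nil => simp
  | cons w m ih =>
    obtain ⟨hw, hm⟩ := List.pairwise_cons.1 hl
    have hwm : w ∉ m.toFinset := fun h => lt_irrefl w (hw w (by simpa using h))
    rw [d_cons, ih hm, List.toFinset_cons, Finset.sum_insert hwm, map_sum, sub_eq_add_neg,
      ← Finset.sum_neg_distrib]
    congr 1
    · have : (insert w m.toFinset).filter (· < w) = ∅ := by
        refine Finset.filter_eq_empty_iff.2 fun x hx => ?_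
        rcases Finset.mem_insert.1 hx with rfl | hx
        · exact lt_irrefl x
        · exact (hw x (by simpa using hx)).not_gt
      rw [this]
      simp
    -- For a vertex of the tail, the head `w` is one more smaller vertex; the resulting sign is the
    -- minus sign in the recursion for `d`.
    · refine Finset.sum_congr rfl fun v hv => ?_
      have hwv : w < v := hw v (by simpa using hv)
      have hw' : w ∉ m.toFinset.filter (· < v) := fun h => hwm (Finset.mem_filter.1 h).1
      rw [Finset.filter_insert, if_pos hwv, Finset.card_insert_of_notMem hw',
        List.erase_cons_tail (by simpa using hwv.ne), map_smul, cone_of, pow_succ]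
      simp

end ListChain

/-! ### Oriented simplicial chains as chains on increasing lists -/

open ListChain

variable {V : Type*} [LinearOrder V] {X : AbstractSimplicialComplex V} {n : ℕ}

/-- The increasing list of the vertices of a simplex. -/
def Simplices.toList (s : Simplices X n) : List V := s.1.sort (· ≤ ·)

theorem Simplices.toList_pairwise (s : Simplices X n) : s.toList.Pairwise (· < ·) :=
  (s.1.sortedLT_sort).pairwise

theorem Simplices.toFinset_toList (s : Simplices X n) : s.toList.toFinset = s.1 := by
  simp [Simplices.toList]

theorem Simplices.toList_injective :
    Function.Injective (Simplices.toList : Simplices X n → List V) := fun s t h => by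
  apply Subtype.ext
  rw [← s.toFinset_toList, h, t.toFinset_toList]

theorem eq_of_pairwise_lt_of_toFinset_eq {l m : List V} (hl : l.Pairwise (· < ·))
    (hm : m.Pairwise (· < ·)) (h : l.toFinset = m.toFinset) : l = m := by
  refine List.Perm.eq_of_pairwise (le := (· < ·)) (fun a b _ _ h1 h2 => (h1.not_gt h2).elim)
    hl hm ?_
  exact List.perm_of_nodup_nodup_toFinset_eq (hl.imp fun h => h.ne) (hm.imp fun h => h.ne) h

/-- Oriented chains as chains on increasing lists. -/
def orientedToList (X : AbstractSimplicialComplex V) (n : ℕ) : Chains X n →ₗ[ℤ] ListChain V :=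
  Finsupp.lmapDomain ℤ ℤ Simplices.toList

theorem orientedToList_injective : Function.Injective (orientedToList X n) :=
  Finsupp.mapDomain_injective Simplices.toList_injective

theorem norm_orientedToList (c : Chains X n) : norm (orientedToList X n c) = chainNorm c :=
  Finsupp.sum_mapDomain_index_inj Simplices.toList_injective

theorem orientedToList_mem (c : Chains X n) :
    orientedToList X n c ∈ supp (lists (fun l => ∃ s ∈ X.faces, ∀ v ∈ l, v ∈ s) (n + 1)) := by
  induction c using Finsupp.induction_linear with
  | zero => simp
  | add f g hf hg =>
    rw [map_add]
    exact Submodule.add_mem _ hf hg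
  | single s a =>
    have h : orientedToList X n (Finsupp.single s a) = Finsupp.single s.toList a :=
      Finsupp.mapDomain_single
    rw [h]
    refine Finsupp.single_mem_supported ℤ a ⟨⟨s.1, s.2.1, fun v hv => ?_⟩, ?_⟩
    · rw [← s.toFinset_toList]
      simpa using hv
    · simp [Simplices.toList, s.2.2]

theorem exists_orientedToList_eq {c : ListChain V}
    (hc : c ∈ supp (lists (fun l => l.Pairwise (· < ·) ∧ ∃ s ∈ X.faces, ∀ v ∈ l, v ∈ s)
      (n + 1))) : ∃ b, orientedToList X n b = c := by
  refine map_mem (N := LinearMap.range (orientedToList X n)) LinearMap.id (fun l hl => ?_) hc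
  obtain ⟨⟨h1, s, hs, h2⟩, h3⟩ := hl
  have hcard : l.toFinset.card = n + 1 := by
    rw [List.toFinset_card_of_nodup (h1.imp fun h => h.ne), h3]
  have hmem : l.toFinset ∈ X.faces :=
    (X.isRelLowerSet_faces hs).2 (fun v hv => h2 v (by simpa using hv))
      (Finset.card_pos.1 (by omega))
  let t : Simplices X n := ⟨l.toFinset, hmem, hcard⟩
  refine ⟨Finsupp.single t 1, ?_⟩
  have h : orientedToList X n (Finsupp.single t 1) = of t.toList := Finsupp.mapDomain_single
  rw [h, eq_of_pairwise_lt_of_toFinset_eq t.toList_pairwise h1 t.toFinset_toList]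
  rfl

/-- Together with `norm_orientedToList` this is an isometric embedding of the oriented complex into
the complex of lists, so Dehn functions can be used there. -/
theorem d_orientedToList (c : Chains X (n + 1)) :
    d (orientedToList X (n + 1) c) = orientedToList X n (boundary X n c) := by
  have : d ∘ₗ orientedToList X (n + 1) = orientedToList X n ∘ₗ boundary X n := by
    refine Finsupp.lhom_ext' fun s => LinearMap.ext_ring ?_
    have h : ∀ {m : ℕ} (t : Simplices X m) (a : ℤ),
        orientedToList X m (Finsupp.single t a) = a • of t.toList := fun t a => by
      rw [orientedToList, Finsupp.lmapDomain_apply, Finsupp.mapDomain_single]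
      simp
    simp only [LinearMap.comp_apply, Finsupp.lsingle_apply]
    rw [h, one_smul, d_of_pairwise s.toList_pairwise, s.toFinset_toList, boundary,
      Finsupp.linearCombination_single, one_smul, map_sum, ← Finset.sum_attach]
    refine Finset.sum_congr rfl fun v _ => ?_
    rw [h]
    congr 3
    refine eq_of_pairwise_lt_of_toFinset_eq (s.toList_pairwise.sublist List.erase_sublist)
      (Simplices.toList_pairwise _) ?_
    rw [Simplices.toFinset_toList]
    ext x
    rw [List.mem_toFinset, List.Nodup.mem_erase_iff (s.toList_pairwise.imp fun h => h.ne),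
      ← List.mem_toFinset, s.toFinset_toList]
    simp [Simplices.erase]
  exact LinearMap.congr_fun this c

end

section

/-! ### Barycentric subdivision -/

namespace ListChain

section Subdivision

variable {E : Type*} [NormedAddCommGroup E] [NormedSpace ℝ E]

/-- The barycenter of a list of points. -/
def barycenter (l : List E) : E := (l.length : ℝ)⁻¹ • l.sum

theorem barycenter_mem {C : Set E} (hC : Convex ℝ C) {l : List E} (hl : ∀ x ∈ l, x ∈ C)
    (h0 : l ≠ []) : barycenter l ∈ C := by
  have hpos : 0 < l.length := List.length_pos_iff.2 h0
  have hsum : l.sum = ∑ i : Fin l.length, l[i] := by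
    conv_lhs => rw [← List.ofFn_getElem (xs := l), List.sum_ofFn]
    rfl
  rw [barycenter, hsum, Finset.smul_sum]
  refine hC.sum_mem (fun _ _ => by positivity) ?_ fun i _ => hl _ (List.getElem_mem _)
  rw [Finset.sum_const, Finset.card_univ, Fintype.card_fin, nsmul_eq_mul]
  exact mul_inv_cancel₀ (by exact_mod_cast hpos.ne')

theorem norm_sum_sub_le {x : E} {δ : ℝ} (l : List E) (hl : ∀ y ∈ l, dist y x ≤ δ) :
    ‖l.sum - (l.length : ℝ) • x‖ ≤ l.length * δ := by
  induction l with
  | nil => simp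
  | cons y l ih =>
    have h1 := ih fun z hz => hl z (by simp [hz])
    have h2 := hl y (by simp)
    rw [dist_eq_norm] at h2
    have h3 : (y :: l).sum - ((y :: l).length : ℝ) • x =
        (y - x) + (l.sum - (l.length : ℝ) • x) := by
      simp only [List.sum_cons, List.length_cons, Nat.cast_add, Nat.cast_one, add_smul, one_smul]
      abel
    rw [h3]
    refine (_root_.norm_add_le _ _).trans ?_
    simp only [List.length_cons, Nat.cast_add, Nat.cast_one]
    linarith

/-- The lists of points with mutual distances at most `δ`. -/
def Small (δ : ℝ) (l : List E) : Prop := ∀ x ∈ l, ∀ y ∈ l, dist x y ≤ δ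

/-- The barycenter minus `x` is the mean of `n + 1` differences `y - x`. One of them is zero and the
others have norm at most `δ`, whence the factor `n / (n + 1)`. -/
theorem dist_barycenter_le {δ : ℝ} {n : ℕ} {l : List E} (hl : Small δ l)
    (hn : l.length = n + 1) {x : E} (hx : x ∈ l) :
    dist x (barycenter l) ≤ n / (n + 1) * δ := by
  obtain ⟨l₁, l₂, rfl⟩ := List.append_of_mem hx
  have h1 := norm_sum_sub_le (x := x) l₁ fun y hy => hl y (by simp [hy]) x hx
  have h2 := norm_sum_sub_le (x := x) l₂ fun y hy => hl y (by simp [hy]) x hx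
  have hn' : (l₁.length + l₂.length : ℝ) = n := by
    simp only [List.length_append, List.length_cons] at hn
    have : l₁.length + l₂.length = n := by omega
    exact_mod_cast this
  have hpos : (0 : ℝ) < n + 1 := by positivity
  have h3 : barycenter (l₁ ++ x :: l₂) - x = ((n : ℝ) + 1)⁻¹ •
      ((l₁.sum - (l₁.length : ℝ) • x) + (l₂.sum - (l₂.length : ℝ) • x)) := by
    have h4 : (l₁.sum - (l₁.length : ℝ) • x) + (l₂.sum - (l₂.length : ℝ) • x) =
        (l₁ ++ x :: l₂).sum - ((n : ℝ) + 1) • x := by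
      rw [← hn']
      simp only [List.sum_append, List.sum_cons, add_smul, one_smul]
      abel
    rw [h4, smul_sub, smul_smul, inv_mul_cancel₀ hpos.ne', one_smul, barycenter, hn]
    push_cast
    rfl
  rw [dist_comm, dist_eq_norm, h3, _root_.norm_smul, Real.norm_of_nonneg (by positivity), div_mul_eq_mul_div,
    inv_mul_eq_div]
  refine div_le_div_of_nonneg_right ((_root_.norm_add_le _ _).trans ?_) hpos.le
  rw [← hn', add_mul]
  exact add_le_add h1 h2

/-- Barycentric subdivision of lists of length `n`. -/
def subdiv : ℕ → ListChain E →ₗ[ℤ] ListChain E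
  | 0 => LinearMap.id
  | n + 1 => ext fun l => cone (barycenter l) (subdiv n (d (of l)))

theorem subdiv_succ (n : ℕ) (l : List E) :
    subdiv (n + 1) (of l) = cone (barycenter l) (subdiv n (d (of l))) := by
  rw [subdiv, ext_of]

theorem subdiv_mem {C : Set E} (hC : Convex ℝ C) (n : ℕ) :
    ∀ l ∈ lists (fun l => ∀ x ∈ l, x ∈ C) n,
      subdiv n (of l) ∈ supp (lists (fun l => ∀ x ∈ l, x ∈ C) n) := by
  induction n with
  | zero => exact fun l hl => of_mem hl
  | succ n ih =>
    intro l hl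
    rw [subdiv_succ]
    have hb : barycenter l ∈ C :=
      barycenter_mem hC hl.1 (List.length_pos_iff.1 (by rw [hl.2]; omega))
    refine cone_mem (P := fun l => ∀ x ∈ l, x ∈ C) (fun m hm x hx => ?_)
      (map_mem _ ih (d_mem (fun l m hm hl x hx => hl x (hm.subset hx)) (of_mem hl)))
    rcases List.mem_cons.1 hx with rfl | hx
    · exact hb
    · exact hm x hx

/-- The subdivided boundary of a list is a cycle by the previous degree, so its cone from the
barycenter fills it. -/
theorem isChainMap_subdiv : IsChainMap (fun _ : List E => True) subdiv where
  nil := rfl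
  d_comm n := by
    induction n with
    | zero =>
      intro l _ hl
      obtain ⟨v, rfl⟩ := List.length_eq_one_iff.1 hl
      simp [subdiv, d_cons]
    | succ n ih =>
      intro l _ hl
      have h1 : d.comp (subdiv (n + 1)) (d (of l)) = (subdiv n).comp d (d (of l)) :=
        map_congr (fun m hm => ih m trivial hm.2) (d_mem_length hl)
      rw [LinearMap.comp_apply, LinearMap.comp_apply] at h1
      rw [subdiv_succ, d_cone, h1]
      simp

/-- Distances to the barycenter shrink by `dist_barycenter_le`, those inside a subdivided face by
induction. `C` varies so that it can be intersected with a ball about the barycenter, which then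
contains the subdivided faces. The bound `N` on the dimension makes the factor the same in all
degrees. -/
theorem subdiv_mem_small {N : ℕ} {δ : ℝ} (hδ : 0 ≤ δ) (n : ℕ) (hn : n ≤ N + 1) (C : Set E)
    (hC : Convex ℝ C) : ∀ l ∈ lists (fun l => (∀ x ∈ l, x ∈ C) ∧ Small δ l) n,
      subdiv n (of l) ∈
        supp (lists (fun l => (∀ x ∈ l, x ∈ C) ∧ Small (N / (N + 1) * δ) l) n) := by
  induction n generalizing C with
  | zero =>
    intro l hl
    obtain rfl := List.length_eq_zero_iff.1 hl.2
    apply of_mem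
    simp [lists, Small]
  | succ n ih =>
    intro l hl
    obtain ⟨⟨hlC, hlδ⟩, hln⟩ := hl
    have hb : barycenter l ∈ C :=
      barycenter_mem hC hlC (List.length_pos_iff.1 (by rw [hln]; omega))
    have hr : (n : ℝ) / (n + 1) * δ ≤ N / (N + 1) * δ := by
      refine mul_le_mul_of_nonneg_right ?_ hδ
      rw [div_le_div_iff₀ (by positivity) (by positivity)]
      have : (n : ℝ) ≤ N := by exact_mod_cast (by omega : n ≤ N)
      nlinarith
    set r := (N : ℝ) / (N + 1) * δ with hrdef
    have hr0 : 0 ≤ r := by positivity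
    have hball : ∀ x ∈ l, x ∈ Metric.closedBall (barycenter l) r := fun x hx =>
      Metric.mem_closedBall.2 ((dist_barycenter_le hlδ hln hx).trans hr)
    have hd : d (of l) ∈ supp (lists
        (fun m => (∀ x ∈ m, x ∈ C ∩ Metric.closedBall (barycenter l) r) ∧ Small δ m) n) := by
      refine supp_mono (s := lists (fun m => m.Sublist l) n) ?_ (d_mem_length hln)
      rintro m ⟨hm, hmn⟩
      exact ⟨⟨fun x hx => ⟨hlC x (hm.subset hx), hball x (hm.subset hx)⟩,
        fun x hx y hy => hlδ x (hm.subset hx) y (hm.subset hy)⟩, hmn⟩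
    rw [subdiv_succ]
    refine cone_mem
      (P := fun m => (∀ x ∈ m, x ∈ C ∩ Metric.closedBall (barycenter l) r) ∧ Small r m)
      (fun m hm => ⟨fun x hx => ?_, fun x hx y hy => ?_⟩)
      (map_mem _ (ih (by omega) _ (hC.inter (convex_closedBall _ _))) hd)
    · rcases List.mem_cons.1 hx with rfl | hx
      · exact hb
      · exact (hm.1 x hx).1
    · rcases List.mem_cons.1 hx with rfl | hx <;> rcases List.mem_cons.1 hy with rfl | hy
      · simpa using hr0
      · rw [dist_comm]
        exact (hm.1 y hy).2
      · exact (hm.1 x hx).2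
      · exact hm.2 x hx y hy

/-- The iterated subdivision. -/
def subdivIter (M n : ℕ) : ListChain E →ₗ[ℤ] ListChain E := subdiv n ^ M

theorem subdivIter_succ (M n : ℕ) (c : ListChain E) :
    subdivIter (M + 1) n c = subdiv n (subdivIter M n c) := by
  rw [subdivIter, pow_succ']
  rfl

theorem subdivIter_mem {C : Set E} (hC : Convex ℝ C) (M n : ℕ) :
    ∀ l ∈ lists (fun l => ∀ x ∈ l, x ∈ C) n,
      subdivIter M n (of l) ∈ supp (lists (fun l => ∀ x ∈ l, x ∈ C) n) := by
  induction M with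
  | zero => exact fun l hl => of_mem hl
  | succ M ih =>
    intro l hl
    rw [subdivIter_succ]
    exact map_mem _ (subdiv_mem hC n) (ih l hl)

theorem isChainMap_subdivIter (M : ℕ) :
    IsChainMap (fun _ : List E => True) (subdivIter M) := by
  induction M with
  | zero => exact ⟨rfl, fun _ _ _ _ => rfl⟩
  | succ M ih =>
    have h : (subdivIter (M + 1) : ℕ → ListChain E →ₗ[ℤ] ListChain E) =
        fun n => subdiv n ∘ₗ subdivIter M n := by
      funext n
      rw [subdivIter, pow_succ']
      rfl
    rw [h]
    refine isChainMap_subdiv.comp ih fun n l hl => ?_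
    have h1 := subdivIter_mem (convex_univ (𝕜 := ℝ) (E := E)) M n l ⟨fun x _ => trivial, hl.2⟩
    have hsub : lists (fun l : List E => ∀ x ∈ l, x ∈ Set.univ) n ⊆ lists (fun _ => True) n :=
      fun m hm => ⟨trivial, hm.2⟩
    exact supp_mono hsub h1

theorem subdivIter_mem_small {N : ℕ} {δ : ℝ} (hδ : 0 ≤ δ) {n : ℕ} (hn : n ≤ N + 1) {C : Set E}
    (hC : Convex ℝ C) (M : ℕ) : ∀ l ∈ lists (fun l => (∀ x ∈ l, x ∈ C) ∧ Small δ l) n,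
      subdivIter M n (of l) ∈
        supp (lists (fun l => (∀ x ∈ l, x ∈ C) ∧ Small ((N / (N + 1)) ^ M * δ) l) n) := by
  induction M with
  | zero =>
    intro l hl
    simpa [subdivIter] using of_mem hl
  | succ M ih =>
    intro l hl
    rw [subdivIter_succ, pow_succ', mul_assoc]
    exact map_mem _ (subdiv_mem_small (by positivity) n hn C hC) (ih l hl)

end Subdivision

end ListChain

end

section

open ListChain

/-! ### Contractible simplicial complexes are acyclic -/

/-- The lists of vertices which lie in a common face. -/
def Faced {V : Type*} (X : AbstractSimplicialComplex V) (l : List V) : Prop :=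
  ∃ s ∈ X.faces, ∀ v ∈ l, v ∈ s

section Acyclic

variable {V : Type*}

/-- The closed simplex on `s` in the coordinates indexed by `F`. -/
def closedSimplex (F s : Finset V) : Set (F → ℝ) :=
  {y | (∀ v, 0 ≤ y v) ∧ (∀ v : F, v.1 ∉ s → y v = 0) ∧ ∑ v, y v = 1}

theorem convex_closedSimplex (F s : Finset V) : Convex ℝ (closedSimplex F s) := by
  intro x hx y hy a b ha hb hab
  refine ⟨fun v => ?_, fun v hv => ?_, ?_⟩
  · have h1 := hx.1 v
    have h2 := hy.1 v
    simp only [Pi.add_apply, Pi.smul_apply, smul_eq_mul]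
    positivity
  · simp [hx.2.1 v hv, hy.2.1 v hv]
  · simp only [Pi.add_apply, Pi.smul_apply, smul_eq_mul]
    rw [Finset.sum_add_distrib, ← Finset.mul_sum, ← Finset.mul_sum, hx.2.2, hy.2.2]
    simpa using hab

theorem isClosed_closedSimplex (F s : Finset V) : IsClosed (closedSimplex F s) := by
  have : closedSimplex F s = (⋂ v, {y | 0 ≤ y v}) ∩
      ((⋂ v : F, ⋂ _ : v.1 ∉ s, {y | y v = 0}) ∩ {y | ∑ v, y v = 1}) := by
    ext y
    simp [closedSimplex]
  rw [this]
  refine (isClosed_iInter fun v => isClosed_le continuous_const (continuous_apply v)).inter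
    ((isClosed_iInter fun v => isClosed_iInter fun _ =>
      isClosed_eq (continuous_apply v) continuous_const).inter
      (isClosed_eq (by fun_prop) continuous_const))

theorem closedSimplex_subset (F s : Finset V) : closedSimplex F s ⊆ stdSimplex ℝ F :=
  fun _ hy => ⟨hy.1, hy.2.2⟩

theorem isCompact_closedSimplex (F s : Finset V) : IsCompact (closedSimplex F s) :=
  (isCompact_stdSimplex ℝ F).of_isClosed_subset (isClosed_closedSimplex F s)
    (closedSimplex_subset F s)

/-- In the sup metric all coordinates lie in `[0, 1]`. This is the mesh before any subdivision. -/
theorem small_closedSimplex (F s : Finset V) {l : List (F → ℝ)}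
    (hl : ∀ y ∈ l, y ∈ closedSimplex F s) : Small 1 l := by
  have h : ∀ y ∈ l, ∀ v, y v ≤ 1 := fun y hy v => by
    rw [← (hl y hy).2.2]
    exact Finset.single_le_sum (fun w _ => (hl y hy).1 w) (Finset.mem_univ v)
  intro x hx y hy
  refine (dist_pi_le_iff zero_le_one).2 fun v => ?_
  rw [Real.dist_eq, abs_le]
  have := h x hx v
  have := h y hy v
  have := (hl x hx).1 v
  have := (hl y hy).1 v
  constructor <;> linarith

open Classical in
/-- The vertex of the closed simplices corresponding to `v`. -/
def vertexPoint (F : Finset V) (v : V) : F → ℝ := fun w => if w.1 = v then 1 else 0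

theorem vertexPoint_mem {F s : Finset V} (hs : s ⊆ F) {v : V} (hv : v ∈ s) :
    vertexPoint F v ∈ closedSimplex F s := by
  classical
  refine ⟨fun w => ?_, fun w hw => if_neg fun h => hw (by rw [h]; exact hv), ?_⟩
  · unfold vertexPoint
    split_ifs <;> norm_num
  · rw [Finset.sum_eq_single ⟨v, hs hv⟩]
    · exact if_pos rfl
    · exact fun w _ hw => if_neg fun h => hw (Subtype.ext h)
    · simp

/-- The union of finitely many closed simplices. -/
def polyhedron (F : Finset V) (K : Finset (Finset V)) : Set (F → ℝ) :=
  ⋃ s ∈ K, closedSimplex F s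

theorem isCompact_polyhedron (F : Finset V) (K : Finset (Finset V)) :
    IsCompact (polyhedron F K) :=
  K.isCompact_biUnion fun s _ => isCompact_closedSimplex F s

variable {X : AbstractSimplicialComplex V} {F : Finset V} {K : Finset (Finset V)}

open Classical in
/-- The canonical map of a finite union of closed simplices into the geometric realization. -/
def realize (hK : ∀ s ∈ K, s ∈ X.faces ∧ s ⊆ F) (y : polyhedron F K) : Realization X :=
  ⟨fun v => if h : v ∈ F then y.1 ⟨v, h⟩ else 0, by
    obtain ⟨s, hs, hy⟩ := Set.mem_iUnion₂.1 y.2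
    refine ⟨fun v => ?_, s, (hK s hs).1, fun v hv => ?_, ?_⟩
    · dsimp only
      split_ifs with h
      · exact hy.1 _
      · exact le_rfl
    · dsimp only
      split_ifs with h
      · exact hy.2.1 _ hv
      · rfl
    · rw [Finset.sum_subset (hK s hs).2, ← Finset.sum_coe_sort, ← hy.2.2]
      · exact Finset.sum_congr rfl fun v _ => dif_pos v.2
      · intro v hv hvs
        rw [dif_pos hv]
        exact hy.2.1 _ hvs⟩

theorem realize_apply (hK : ∀ s ∈ K, s ∈ X.faces ∧ s ⊆ F) (y : polyhedron F K) {v : V}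
    (h : v ∈ F) : (realize hK y).1 v = y.1 ⟨v, h⟩ := dif_pos h

theorem realize_apply_of_notMem (hK : ∀ s ∈ K, s ∈ X.faces ∧ s ⊆ F) (y : polyhedron F K) {v : V}
    (h : v ∉ F) : (realize hK y).1 v = 0 := dif_neg h

theorem continuous_faceMap (s : X.faces) : Continuous (faceMap X s) :=
  continuous_iSup_rng continuous_coinduced_rng

/-- The open stars cover the realization (`exists_pos_coord`), and vertices whose stars share a
point lie in a common face (`exists_face_of_pos`). The approximation by vertex maps rests on these
facts. -/
theorem isOpen_star (X : AbstractSimplicialComplex V) (v : V) :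
    IsOpen {x : Realization X | 0 < x.1 v} := by
  classical
  refine isOpen_iSup_iff.2 fun s => isOpen_coinduced.2 ?_
  by_cases h : v ∈ (s : Finset V)
  · have : faceMap X s ⁻¹' {x | 0 < x.1 v} = {t | 0 < t.1 ⟨v, h⟩} := by
      ext t
      simp [faceMap, h]
    rw [this]
    exact isOpen_lt continuous_const ((continuous_apply _).comp continuous_subtype_val)
  · have : faceMap X s ⁻¹' {x | 0 < x.1 v} = ∅ := by
      ext t
      simp [faceMap, h]
    rw [this]
    exact isOpen_empty

theorem exists_pos_coord (x : Realization X) : ∃ v, 0 < x.1 v := by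
  obtain ⟨h0, s, hs, h1, h2⟩ := x.2
  by_contra! h
  have : ∑ v ∈ s, x.1 v = 0 := Finset.sum_eq_zero fun v _ => le_antisymm (h v) (h0 v)
  rw [h2] at this
  exact one_ne_zero this

theorem exists_face_of_pos (x : Realization X) : ∃ s ∈ X.faces, ∀ v, 0 < x.1 v → v ∈ s := by
  obtain ⟨-, s, hs, h1, -⟩ := x.2
  refine ⟨s, hs, fun v hv => ?_⟩
  by_contra h
  exact hv.ne' (h1 v h)

/-- Finitely many closed simplices cover the polyhedron, and on each of them the map factors through
a characteristic map. -/
theorem continuous_realize (hK : ∀ s ∈ K, s ∈ X.faces ∧ s ⊆ F) : Continuous (realize hK) := by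
  classical
  have hlf : LocallyFinite fun s : K => {y : polyhedron F K | y.1 ∈ closedSimplex F s.1} :=
    locallyFinite_of_finite _
  refine hlf.continuous ?_ (fun s => (isClosed_closedSimplex F s.1).preimage
    continuous_subtype_val) fun s => ?_
  · refine Set.eq_univ_of_forall fun y => ?_
    obtain ⟨s, hs, hy⟩ := Set.mem_iUnion₂.1 y.2
    exact Set.mem_iUnion.2 ⟨⟨s, hs⟩, hy⟩
  · rw [continuousOn_iff_continuous_domRestrict]
    have hmem : ∀ y : {y : polyhedron F K | y.1 ∈ closedSimplex F s.1},
        (fun v : s.1 => y.1.1 ⟨v.1, (hK s.1 s.2).2 v.2⟩) ∈ stdSimplex ℝ s.1 := fun y => by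
      refine ⟨fun v => y.2.1 _, ?_⟩
      have hy := y.2.2.2
      rw [← hy, Finset.sum_coe_sort_eq_attach, Finset.sum_coe_sort_eq_attach]
      have h1 : ∀ v, v ∈ s.1 → v ∈ F := fun v hv => (hK s.1 s.2).2 hv
      have h2 := Finset.sum_subset (hK s.1 s.2).2 (f := fun v => (realize hK y.1).1 v)
        fun v hv hvs => by rw [realize_apply hK _ hv]; exact y.2.2.1 _ hvs
      rw [← Finset.sum_attach, ← Finset.sum_attach F] at h2
      convert h2 using 2 with v _ v _
      · rw [realize_apply hK _ (h1 _ v.2)]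
      · rw [realize_apply hK _ v.2]
    have heq : Set.domRestrict {y : polyhedron F K | y.1 ∈ closedSimplex F s.1} (realize hK) =
        fun y => faceMap X ⟨s.1, (hK s.1 s.2).1⟩ ⟨_, hmem y⟩ := by
      funext y
      apply Subtype.ext
      funext v
      change (realize hK y.1).1 v = _
      by_cases hv : v ∈ s.1
      · simp [faceMap, hv, realize_apply hK _ ((hK s.1 s.2).2 hv)]
      · by_cases hF : v ∈ F
        · simpa [faceMap, hv, realize_apply hK _ hF] using y.2.2.1 ⟨v, hF⟩ hv
        · simp [faceMap, hv, realize_apply_of_notMem hK _ hF]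
    rw [heq]
    refine (continuous_faceMap _).comp (Continuous.subtype_mk ?_ _)
    exact continuous_pi fun v => (continuous_apply _).comp
      (continuous_subtype_val.comp continuous_subtype_val)

/-- The time `i / M` in the unit interval. -/
def timeStep (M i : ℕ) : unitInterval :=
  ⟨min ((i : ℝ) / M) 1, le_min (by positivity) zero_le_one, min_le_right _ _⟩

theorem dist_timeStep_le {M i : ℕ} (hM : 0 < M) :
    dist (timeStep M i) (timeStep M (i + 1)) ≤ (1 : ℝ) / M := by
  have hM' : (0 : ℝ) < M := by exact_mod_cast hM
  rw [Subtype.dist_eq, Real.dist_eq]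
  simp only [timeStep]
  refine (abs_min_sub_min_le_max _ _ _ _).trans ?_
  rw [sub_self, abs_zero, ← sub_div, max_le_iff]
  push_cast
  rw [show (i : ℝ) - (i + 1) = -1 by ring, abs_div, abs_neg, abs_one, abs_of_pos hM']
  exact ⟨le_rfl, by positivity⟩

/-- Approximations of a contraction by maps of vertices. -/
theorem exists_vertexMaps [ContractibleSpace (Realization X)]
    (hK : ∀ s ∈ K, s ∈ X.faces ∧ s ⊆ F) :
    ∃ (δ : ℝ) (M : ℕ) (v : ℕ → (F → ℝ) → V), 0 < δ ∧
      (∀ s ∈ K, ∀ l : List (F → ℝ), (∀ y ∈ l, y ∈ closedSimplex F s) → Small δ l → ∀ i < M,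
        ∀ m : List V, (∀ w ∈ m, ∃ y ∈ l, w = v i y ∨ w = v (i + 1) y) → Faced X m) ∧
      (∀ s ∈ K, ∀ y ∈ closedSimplex F s, v 0 y ∈ s) ∧
      (∃ s ∈ X.faces, s.Nonempty ∧ ∀ y ∈ polyhedron F K, v M y ∈ s) := by
  classical
  obtain ⟨p, ⟨H⟩⟩ := id_nullhomotopic (Realization X)
  have hcomp : CompactSpace (polyhedron F K) :=
    isCompact_iff_compactSpace.1 (isCompact_polyhedron F K)
  obtain ⟨w₀, hw₀⟩ := exists_pos_coord p
  obtain ⟨s₀, hs₀, hp⟩ := exists_face_of_pos p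
  let h : polyhedron F K × unitInterval → Realization X := fun q => H (q.2, realize hK q.1)
  have hcont : Continuous h := H.continuous.comp
    (continuous_snd.prodMk ((continuous_realize hK).comp continuous_fst))
  -- A Lebesgue number for the cover of the cylinder by the preimages of the open stars under the
  -- contraction: the `δ`-ball about `q` is sent into the star of one vertex `W q`.
  obtain ⟨δ, hδ, hball⟩ := lebesgue_number_lemma_of_metric
    (isCompact_univ (X := polyhedron F K × unitInterval)) (c := fun w => {q | 0 < (h q).1 w})
    (fun w => (isOpen_star X w).preimage hcont)
    (fun q _ => Set.mem_iUnion.2 (exists_pos_coord (h q)))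
  choose W hW using fun q => hball q (Set.mem_univ q)
  obtain ⟨M, hM⟩ := exists_nat_one_div_lt hδ
  let v : ℕ → (F → ℝ) → V := fun i y =>
    if hy : y ∈ polyhedron F K then W (⟨y, hy⟩, timeStep (M + 1) i) else w₀
  have hv : ∀ i (y : polyhedron F K) (q : polyhedron F K × unitInterval),
      dist q.1 y < δ → dist q.2 (timeStep (M + 1) i) < δ → 0 < (h q).1 (v i y) := by
    intro i y q h1 h2
    have h3 : v i y = W (y, timeStep (M + 1) i) := dif_pos y.2
    rw [h3]
    exact hW (y, timeStep (M + 1) i) (Metric.mem_ball.2 (by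
      rw [Prod.dist_eq]
      exact max_lt h1 h2))
  have hmem : ∀ s ∈ K, ∀ y ∈ closedSimplex F s, y ∈ polyhedron F K := fun s hs y hy =>
    Set.mem_iUnion₂.2 ⟨s, hs, hy⟩
  -- `δ / 2` turns the weak inequality of `Small` into a strict one, and `M + 1` time steps have
  -- length below `δ`.
  refine ⟨δ / 2, M + 1, v, by positivity, ?_, ?_, ?_⟩
  · intro s hs l hl hsmall i _ m hm
    match l with
    | [] =>
      have : m = [] := List.eq_nil_iff_forall_not_mem.2 fun w hw => by simpa using hm w hw
      exact ⟨s₀, hs₀, by simp [this]⟩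
    | y₀ :: l =>
      have hy₀ := hmem s hs y₀ (hl y₀ (by simp))
      -- `q` is within `δ` of the points over every `y` in the list at the times `i` and `i + 1`.
      -- Its image thus lies in the stars of all the vertices chosen there, and a face carrying this
      -- image contains them.
      let q : polyhedron F K × unitInterval := (⟨y₀, hy₀⟩, timeStep (M + 1) i)
      obtain ⟨t, ht, hpos⟩ := exists_face_of_pos (h q)
      refine ⟨t, ht, fun w hw => hpos w ?_⟩
      obtain ⟨y, hy, hwy⟩ := hm w hw
      have hyK := hmem s hs y (hl y hy)
      have hd : dist q.1 ⟨y, hyK⟩ < δ :=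
        (hsmall y₀ (by simp) y hy).trans_lt (by linarith)
      rcases hwy with rfl | rfl
      · exact hv i ⟨y, hyK⟩ q hd (by rw [dist_self]; exact hδ)
      · refine hv (i + 1) ⟨y, hyK⟩ q hd ((dist_timeStep_le (Nat.succ_pos M)).trans_lt ?_)
        push_cast
        exact hM
  · intro s hs y hy
    -- At time `0` the contraction is the identity, so `y` itself has a positive coordinate at `v 0
    -- y`.
    have h0 : timeStep (M + 1) 0 = 0 := Subtype.ext (by simp [timeStep])
    have h1 := hv 0 ⟨y, hmem s hs y hy⟩ (⟨y, hmem s hs y hy⟩, 0) (by rw [dist_self]; exact hδ)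
      (by rw [h0, dist_self]; exact hδ)
    have h2 : h (⟨y, hmem s hs y hy⟩, 0) = realize hK ⟨y, hmem s hs y hy⟩ := H.apply_zero _
    rw [h2] at h1
    by_contra hvs
    by_cases hF : v 0 y ∈ F
    · rw [realize_apply hK _ hF] at h1
      exact h1.ne' (hy.2.1 _ hvs)
    · rw [realize_apply_of_notMem hK _ hF] at h1
      exact lt_irrefl _ h1
  -- At time `1` every point is at `p`, so the chosen vertices lie in the face carrying `p`.
  · refine ⟨s₀, hs₀, ⟨w₀, hp w₀ hw₀⟩, fun y hy => hp _ ?_⟩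
    have h0 : timeStep (M + 1) (M + 1) = 1 := Subtype.ext (by
      have : ((M : ℝ) + 1) ≠ 0 := by positivity
      simp [timeStep, this])
    have h1 := hv (M + 1) ⟨y, hy⟩ (⟨y, hy⟩, 1) (by rw [dist_self]; exact hδ)
      (by rw [h0, dist_self]; exact hδ)
    have h2 : h (⟨y, hy⟩, 1) = p := H.apply_one _
    rwa [h2] at h1

/-- Ordered simplicial cycles (for the augmented complex) of a contractible simplicial complex are
boundaries. -/
theorem exists_d_eq_of_contractible (X : AbstractSimplicialComplex V)
    [ContractibleSpace (Realization X)] {n : ℕ} {c : ListChain V}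
    (hc : c ∈ supp (lists (Faced X) (n + 1))) (hd : d c = 0) :
    ∃ a ∈ supp (lists (Faced X) (n + 2)), d a = c := by
  classical
  -- The lists occurring in `c` lie in finitely many faces, so a compact polyhedron suffices.
  choose! S hS using fun l (hl : l ∈ c.support) => (hc hl).1
  let K := c.support.image S
  let F := K.biUnion id
  have hK : ∀ s ∈ K, s ∈ X.faces ∧ s ⊆ F := fun s hs => by
    refine ⟨?_, fun v hv => Finset.mem_biUnion.2 ⟨s, hs, hv⟩⟩
    obtain ⟨l, hl, rfl⟩ := Finset.mem_image.1 hs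
    exact (hS l hl).1
  have hcS : c ∈ supp {l : List V | (∃ s ∈ K, ∀ v ∈ l, v ∈ s) ∧ l.length = n + 1} :=
    fun l hl => ⟨⟨S l, Finset.mem_image_of_mem S hl, (hS l hl).2⟩, (hc hl).2⟩
  obtain ⟨δ, M, v, hδ, hv, hv0, s₁, hs₁, ⟨w₁, hw₁⟩, hvM⟩ := exists_vertexMaps hK
  have hκ0 : (0 : ℝ) ≤ (n : ℝ) / (n + 1) := by positivity
  have hκ1 : (n : ℝ) / (n + 1) < 1 := by
    rw [div_lt_one (by positivity)]
    linarith
  -- The number of subdivisions that brings the mesh, initially at most `1`, below `δ`.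
  obtain ⟨m, hm⟩ := exists_pow_lt_of_lt_one hδ hκ1
  have hpoint : ∀ s ∈ K, ∀ k, ∀ l ∈ lists (fun l : List V => ∀ v ∈ l, v ∈ s) k,
      l.map (vertexPoint F) ∈ lists (fun l => ∀ y ∈ l, y ∈ closedSimplex F s) k := by
    refine fun s hs k l hl => ⟨fun y hy => ?_, by rw [List.length_map, hl.2]⟩
    obtain ⟨w, hw, rfl⟩ := List.mem_map.1 hy
    exact vertexPoint_mem (hK s hs).2 (hl.1 w hw)
  -- Subdivision followed by the approximation at time `0`. This preserves every face in `K`, so its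
  -- homotopy to the identity stays in the complex.
  let φ : ℕ → ListChain V →ₗ[ℤ] ListChain V := fun k =>
    map (v 0) ∘ₗ (subdivIter m k ∘ₗ map (vertexPoint F))
  have hφ : IsChainMap (fun _ => True) φ := by
    have hsub : IsChainMap (fun _ : List V => True)
        fun k => (subdivIter m k : ListChain (F → ℝ) →ₗ[ℤ] _) ∘ₗ map (vertexPoint F) :=
      (isChainMap_subdivIter m).comp (isChainMap_map _ _) fun k l hl => by
        rw [map_of]
        apply of_mem
        exact ⟨trivial, by simpa using hl.2⟩
    refine (isChainMap_map (fun _ => True) (v 0)).comp hsub fun k l hl => ?_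
    have h1 := subdivIter_mem (convex_univ (𝕜 := ℝ) (E := F → ℝ)) m k (l.map (vertexPoint F))
      ⟨fun _ _ => trivial, by simpa using hl.2⟩
    have hsub : lists (fun l : List (F → ℝ) => ∀ x ∈ l, x ∈ Set.univ) k ⊆
        lists (fun _ => True) k := fun l hl => ⟨trivial, hl.2⟩
    rw [LinearMap.comp_apply, map_of]
    exact supp_mono hsub h1
  have hφs : ∀ s ∈ K, ∀ k, ∀ l ∈ lists (fun l : List V => ∀ v ∈ l, v ∈ (s : Set V)) k,
      φ k (of l) ∈ supp (lists (fun l => ∀ v ∈ l, v ∈ (s : Set V)) k) := by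
    intro s hs k l hl
    have h1 := subdivIter_mem (convex_closedSimplex F s) m k _ (hpoint s hs k l hl)
    have h2 : φ k (of l) = map (v 0) (subdivIter m k (of (l.map (vertexPoint F)))) := by
      simp [φ]
    rw [h2]
    refine map_mem_lists (fun l' hl' w hw => ?_) h1
    obtain ⟨y, hy, rfl⟩ := List.mem_map.1 hw
    exact hv0 s hs y (hl' y hy)
  have hsubT : lists (Faced X) (n + 1) ⊆ lists (fun _ => True) (n + 1) :=
    fun l hl => ⟨trivial, hl.2⟩
  have hD := d_headHomotopy (fun _ _ _ _ => trivial) hφ n c (supp_mono hsubT hc)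
  rw [hd, map_zero, sub_zero] at hD
  have hDmem : headHomotopy φ (n + 1) c ∈ supp (lists (Faced X) (n + 2)) := by
    refine map_mem _ (fun l hl => ?_) hcS
    obtain ⟨⟨s, hs, hl⟩, hn⟩ := hl
    have h1 := headHomotopy_mem (hφs s hs) (n + 1) (of l) (of_mem ⟨hl, hn⟩)
    have hsub : lists (fun l => ∀ v ∈ l, v ∈ (s : Set V)) (n + 1 + 1) ⊆
        lists (Faced X) (n + 2) := fun l hl => ⟨⟨s, (hK s hs).1, hl.1⟩, hl.2⟩
    exact supp_mono hsub h1
  let c' := subdivIter m (n + 1) (map (vertexPoint F) c)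
  have hφc : φ (n + 1) c = map (v 0) c' := rfl
  have hc'd : d c' = 0 := by
    have h1 : map (vertexPoint F) c ∈ supp (lists (fun _ => True) (n + 1)) :=
      map_mem_lists (P := Faced X) (fun _ _ => trivial) hc
    have h2 := (isChainMap_subdivIter m).d_comm_apply h1
    rw [d_map, hd, map_zero, map_zero] at h2
    exact h2
  have hc' : c' ∈ supp (lists (fun l => (∃ s ∈ K, ∀ y ∈ l, y ∈ closedSimplex F s) ∧ Small δ l)
      (n + 1)) := by
    refine map_mem (subdivIter m (n + 1) ∘ₗ map (vertexPoint F)) (fun l hl => ?_) hcS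
    obtain ⟨⟨s, hs, hl⟩, hn⟩ := hl
    have h1 := hpoint s hs (n + 1) l ⟨hl, hn⟩
    have h2 := subdivIter_mem_small (N := n) zero_le_one le_rfl (convex_closedSimplex F s) m _
      ⟨⟨h1.1, small_closedSimplex F s h1.1⟩, h1.2⟩
    rw [LinearMap.comp_apply, map_of]
    have hsub : lists (fun l => (∀ x ∈ l, x ∈ closedSimplex F s) ∧
        Small (((n : ℝ) / (n + 1)) ^ m * 1) l) (n + 1) ⊆
        lists (fun l => (∃ s ∈ K, ∀ y ∈ l, y ∈ closedSimplex F s) ∧ Small δ l) (n + 1) := by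
      rintro l' ⟨⟨h3, h4⟩, h5⟩
      exact ⟨⟨⟨s, hs, h3⟩, fun x hx y hy => (h4 x hx y hy).trans (by rw [mul_one]; exact hm.le)⟩,
        h5⟩
    exact supp_mono hsub h2
  let B : Submodule ℤ (ListChain V) := (supp (lists (Faced X) (n + 2))).map d
  -- Consecutive approximations differ on the cycle `c'` by the boundary of a prism, which lies in
  -- the complex because the lists of `c'` are small. The differences telescope.
  have hstep : ∀ i ≤ M, map (v i) c' - map (v 0) c' ∈ B := by
    intro i
    induction i with
    | zero =>
      intro _
      rw [sub_self]
      exact B.zero_mem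
    | succ i ih =>
      intro hi
      have h1 := d_prism (v i) (v (i + 1)) c'
      rw [hc'd, map_zero, sub_zero] at h1
      have h2 : map (v (i + 1)) c' - map (v i) c' ∈ B := by
        refine ⟨prism (v i) (v (i + 1)) c', ?_, h1⟩
        refine map_mem _ (fun l hl => ?_) hc'
        obtain ⟨⟨⟨s, hs, hl⟩, hsm⟩, hn⟩ := hl
        have h3 := prism_mem (P := Faced X) l (hv s hs l hl hsm i (by omega))
        rw [hn] at h3
        exact h3
      have := B.add_mem h2 (ih (by omega))
      rwa [sub_add_sub_cancel] at this
  -- The last approximation takes values in a single face, where a cycle is filled by a cone.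
  have hend : map (v M) c' ∈ B := by
    have h1 : map (v M) c' ∈ supp (lists (fun l => ∀ w ∈ l, w ∈ s₁) (n + 1)) := by
      refine map_mem_lists (fun l hl w hw => ?_) hc'
      obtain ⟨y, hy, rfl⟩ := List.mem_map.1 hw
      obtain ⟨⟨s, hs, hl⟩, -⟩ := hl
      exact hvM y (Set.mem_iUnion₂.2 ⟨s, hs, hl y hy⟩)
    refine ⟨cone w₁ (map (v M) c'), ?_, ?_⟩
    · refine cone_mem (fun l hl => ⟨s₁, hs₁, fun w hw => ?_⟩) h1
      rcases List.mem_cons.1 hw with rfl | hw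
      · exact hw₁
      · exact hl w hw
    · rw [d_cone, d_map, hc'd, map_zero, map_zero, sub_zero]
  -- Modulo boundaries, `c` equals its image under `φ`, that is `map (v 0) c'`, then `map (v M) c'`,
  -- then zero.
  have hfinal : c ∈ B := by
    have h1 : φ (n + 1) c - c ∈ B := ⟨_, hDmem, hD⟩
    have h2 := B.sub_mem (B.sub_mem hend (hstep M le_rfl)) h1
    rw [hφc] at h2
    have h3 : map (v M) c' - (map (v M) c' - map (v 0) c') - (map (v 0) c' - c) = c := by abel
    rwa [h3] at h2
  obtain ⟨a, ha, h⟩ := hfinal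
  exact ⟨a, ha, h⟩

end Acyclic

end

section

open ListChain

/-! ### Polynomial bounds for fillings of ordered cycles -/

theorem exists_eval_le (P : Polynomial ℕ) : ∃ C m : ℕ, ∀ k, P.eval k ≤ C * (1 + k) ^ m := by
  refine ⟨∑ i ∈ Finset.range (P.natDegree + 1), P.coeff i, P.natDegree, fun k => ?_⟩
  rw [Polynomial.eval_eq_sum_range, Finset.sum_mul]
  refine Finset.sum_le_sum fun i hi => Nat.mul_le_mul_left _ ?_
  exact (Nat.pow_le_pow_left (by omega) i).trans
    (Nat.pow_le_pow_right (by omega) (by simpa [Nat.lt_succ_iff] using hi))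

/-- Growth is always recorded as `C * (1 + x) ^ m`; this form is stable under composition. -/
theorem polynomial_comp_le {x y C C' m m' : ℕ} (h : y ≤ C' * (1 + x) ^ m') :
    C * (1 + y) ^ m ≤ C * (1 + C') ^ m * (1 + x) ^ (m' * m) := by
  rw [pow_mul, mul_assoc, ← mul_pow]
  refine Nat.mul_le_mul_left _ (Nat.pow_le_pow_left ?_ m)
  have : 1 ≤ (1 + x) ^ m' := Nat.one_le_pow _ _ (by omega)
  nlinarith

section Filling

variable {V : Type*} {X : AbstractSimplicialComplex V}

theorem headHomotopy_sort_mem_faced [LinearOrder V] {n : ℕ} {c : ListChain V}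
    (hc : c ∈ supp (lists (Faced X) n)) :
    headHomotopy (fun _ => sort) n c ∈ supp (lists (Faced X) (n + 1)) := by
  refine map_mem _ (fun l hl => ?_) hc
  obtain ⟨⟨s, hs, hls⟩, hn⟩ := hl
  have h1 : ∀ k, ∀ l ∈ lists (fun l : List V => ∀ v ∈ l, v ∈ (s : Set V)) k,
      sort (of l) ∈ supp (lists (fun l => ∀ v ∈ l, v ∈ (s : Set V)) k) := by
    intro k l hl
    have hsub : lists (fun m => m.Pairwise (· < ·) ∧ ∀ x ∈ m, x ∈ l) l.length ⊆
        lists (fun l => ∀ v ∈ l, v ∈ (s : Set V)) k :=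
      fun m hm => ⟨fun v hv => hl.1 v (hm.1.2 v hv), hm.2.trans hl.2⟩
    exact supp_mono hsub (sort_mem l)
  have hsub : lists (fun l => ∀ v ∈ l, v ∈ (s : Set V)) (n + 1) ⊆ lists (Faced X) (n + 1) :=
    fun m hm => ⟨⟨s, hs, hm.1⟩, hm.2⟩
  exact supp_mono hsub (headHomotopy_mem h1 n (of l) (of_mem ⟨hls, hn⟩))

theorem sort_mem_faced [LinearOrder V] {n : ℕ} {c : ListChain V}
    (hc : c ∈ supp (lists (Faced X) n)) : sort c ∈ supp (lists (fun l => l.Pairwise (· < ·) ∧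
      ∃ s ∈ X.faces, ∀ v ∈ l, v ∈ s) n) := by
  refine map_mem _ (fun l hl => ?_) hc
  obtain ⟨⟨s, hs, hls⟩, hn⟩ := hl
  have hsub : lists (fun m => m.Pairwise (· < ·) ∧ ∀ x ∈ m, x ∈ l) l.length ⊆
      lists (fun l => l.Pairwise (· < ·) ∧ ∃ s ∈ X.faces, ∀ v ∈ l, v ∈ s) n :=
    fun m hm => ⟨⟨hm.1.1, s, hs, fun v hv => hls v (hm.1.2 v hv)⟩, hm.2.trans hn⟩
  exact supp_mono hsub (sort_mem l)

/-- Ordered cycles have fillings bounded by the Dehn functions. -/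
theorem exists_filling_norm_le [LinearOrder V] [ContractibleSpace (Realization X)] {n : ℕ}
    {P : Polynomial ℕ} (hP : ∀ k : ℕ, dehnFunction X n k ≤ (P.eval k : ℕ)) :
    ∃ C m : ℕ, ∀ c ∈ supp (lists (Faced X) (n + 1)), d c = 0 →
      ∃ a ∈ supp (lists (Faced X) (n + 2)), d a = c ∧ norm a ≤ C * (1 + norm c) ^ m := by
  obtain ⟨C, m, hCm⟩ := exists_eval_le P
  obtain ⟨B, hB⟩ := exists_norm_headHomotopy_le (φ := fun _ => sort (V := V))
    (fun _ l => norm_sort_of_le l) (n + 1)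
  refine ⟨C + B, m + 1, fun c hc hd => ?_⟩
  have hsubT : lists (Faced X) (n + 1) ⊆ lists (fun _ => True) (n + 1) :=
    fun l hl => ⟨trivial, hl.2⟩
  -- The Dehn function is applied to the sorted cycle, which is an oriented chain.
  obtain ⟨b, hb⟩ := exists_orientedToList_eq (sort_mem_faced hc)
  have hrange : b ∈ LinearMap.range (boundary X n) := by
    obtain ⟨a, ha, hac⟩ := exists_d_eq_of_contractible X hc hd
    obtain ⟨a', ha'⟩ := exists_orientedToList_eq (sort_mem_faced ha)
    refine ⟨a', orientedToList_injective ?_⟩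
    rw [← d_orientedToList, ha', d_sort, hac, hb]
  have hnorm : chainNorm b ≤ norm c := by
    rw [← norm_orientedToList, hb]
    exact norm_sort_le c
  have hfill : fillingNorm X n b ≤ (P.eval (norm c) : ℕ) := by
    refine le_trans ?_ (hP (norm c))
    exact le_iSup₂_of_le b hrange (le_iSup_of_le hnorm le_rfl)
  -- The strict inequality extracts an actual filling from the infimum in `ℕ∞`.
  have hlt : fillingNorm X n b < (P.eval (norm c) + 1 : ℕ) :=
    hfill.trans_lt (by exact_mod_cast Nat.lt_succ_self _)
  simp only [fillingNorm, iInf_lt_iff] at hlt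
  obtain ⟨a, hab, ha⟩ := hlt
  have ha : chainNorm a ≤ P.eval (norm c) := by
    have : chainNorm a < P.eval (norm c) + 1 := by exact_mod_cast ha
    omega
  have hD := d_headHomotopy (fun _ _ _ _ => trivial) isChainMap_sort n c (supp_mono hsubT hc)
  rw [hd, map_zero, sub_zero] at hD
  -- Since the homotopy `H` satisfies `d (H c) = sort c - c`, subtracting `H c` corrects a filling
  -- of `sort c` to one of `c`, at a cost linear in the norm.
  refine ⟨orientedToList X (n + 1) a - headHomotopy (fun _ => sort) (n + 1) c,
    Submodule.sub_mem _ (orientedToList_mem a) (headHomotopy_sort_mem_faced hc), ?_, ?_⟩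
  · rw [map_sub, d_orientedToList, hab, hb, hD]
    abel
  · refine (norm_sub_le _ _).trans ?_
    rw [norm_orientedToList, add_mul]
    refine Nat.add_le_add (ha.trans ((hCm _).trans ?_)) ((hB c (supp_mono hsubT hc)).trans ?_)
    · exact Nat.mul_le_mul_left _ (Nat.pow_le_pow_right (by omega) (by omega))
    · refine Nat.mul_le_mul_left _ ?_
      rw [pow_succ]
      have : 1 ≤ (1 + norm c) ^ m := Nat.one_le_pow _ _ (by omega)
      nlinarith

end Filling

/-! ### Word lengths -/

section WordLength

variable {G : Type*} [Group G] (S : GenSet G)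

theorem GenSet.exists_minimal_word (g : G) : ∃ l : List G, (∀ s ∈ l, s ∈ S.carrier) ∧
    l.prod = g ∧ l.length = S.wordLength g := by
  obtain ⟨l, hl, hg⟩ := S.exists_word g
  exact Nat.sInf_mem (s := {n : ℕ | ∃ l : List G,
    (∀ s ∈ l, s ∈ S.carrier) ∧ l.prod = g ∧ l.length = n}) ⟨_, l, hl, hg, rfl⟩

theorem GenSet.wordLength_le_length {l : List G} (hl : ∀ s ∈ l, s ∈ S.carrier) :
    S.wordLength l.prod ≤ l.length := Nat.sInf_le ⟨l, hl, rfl, rfl⟩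

@[simp] theorem GenSet.wordLength_one : S.wordLength 1 = 0 := by
  simpa using S.wordLength_le_length (l := []) (by simp)

theorem GenSet.wordLength_inv_le (g : G) : S.wordLength g⁻¹ ≤ S.wordLength g := by
  obtain ⟨l, hl, rfl, hlen⟩ := S.exists_minimal_word g
  rw [← hlen, List.prod_inv_reverse]
  refine (S.wordLength_le_length fun s hs => ?_).trans (by simp)
  simp only [List.mem_reverse, List.mem_map] at hs
  obtain ⟨t, ht, rfl⟩ := hs
  exact S.inv_mem t (hl t ht)

/-- The sum of the lengths of the elements of a list. -/
def GenSet.listLength (l : List G) : ℕ := (l.map S.wordLength).sum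

theorem GenSet.listLength_cons (g : G) (l : List G) :
    S.listLength (g :: l) = S.wordLength g + S.listLength l := by
  simp [GenSet.listLength]

theorem GenSet.listLength_le_of_sublist {l m : List G} (h : l.Sublist m) :
    S.listLength l ≤ S.listLength m :=
  List.Sublist.sum_le_sum (h.map _) (fun _ _ => Nat.zero_le _)

theorem GenSet.listLength_map_le {H : Type*} [Group H] (T : GenSet H) {f : G → H} {A B : ℕ}
    (hf : ∀ g, T.wordLength (f g) ≤ A * S.wordLength g + B) (l : List G) :
    T.listLength (l.map f) ≤ A * S.listLength l + l.length * B := by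
  induction l with
  | nil => simp [GenSet.listLength]
  | cons g l ih =>
    rw [List.map_cons, T.listLength_cons, S.listLength_cons, List.length_cons]
    have := hf g
    nlinarith

end WordLength

end

section

open ListChain

/-! ### The equivariant chain map from the homogeneous complex -/

namespace ListChain

variable {U V W : Type*}

theorem map_map (f : V → W) (g : U → V) (c : ListChain U) :
    map f (map g c) = map (f ∘ g) c := by
  have : map f ∘ₗ map g = map (f ∘ g) := hom_ext fun l => by simp
  exact LinearMap.congr_fun this c

theorem map_id (c : ListChain V) : map id c = c := by
  have : map (id : V → V) = LinearMap.id := hom_ext fun l => by simp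
  exact LinearMap.congr_fun this c

theorem comp_congr {M N : Type*} [AddCommGroup M] [AddCommGroup N] {s : Set (List V)}
    {f : ListChain W →ₗ[ℤ] M} {g : ListChain V →ₗ[ℤ] ListChain W} {f' : N →ₗ[ℤ] M}
    {g' : ListChain V →ₗ[ℤ] N} (h : ∀ l ∈ s, f (g (of l)) = f' (g' (of l))) {c : ListChain V}
    (hc : c ∈ supp s) : f (g c) = f' (g' c) :=
  map_congr (f := f ∘ₗ g) (g := f' ∘ₗ g') h hc

end ListChain

section Act

variable {Z V : Type*} [Group Z] [MulAction Z V]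

/-- The action of a group element on chains. -/
abbrev act (z : Z) : ListChain V →ₗ[ℤ] ListChain V := map (z • ·)

theorem act_mul (z w : Z) (c : ListChain V) : act (z * w) c = act z (act w c) := by
  rw [act, act, act, map_map]
  congr 2
  funext v
  exact mul_smul z w v

theorem act_one (c : ListChain V) : act (1 : Z) c = c := by
  have : ((1 : Z) • · : V → V) = id := funext fun v => one_smul Z v
  rw [act, this, ListChain.map_id]

/-- The complex is invariant under the action. -/
def FaceInvariant (Z : Type*) [Group Z] {V : Type*} [MulAction Z V]
    (X : AbstractSimplicialComplex V) : Prop :=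
  ∀ (z : Z) (l : List V), Faced X l → Faced X (l.map (z • ·))

theorem act_mem {X : AbstractSimplicialComplex V} (hX : FaceInvariant Z X) (z : Z) {n : ℕ}
    {c : ListChain V} (hc : c ∈ supp (lists (Faced X) n)) :
    act z c ∈ supp (lists (Faced X) n) :=
  map_mem_lists (hX z) hc

end Act

/-! ### Fillings of minimal norm -/

section MinFill

variable {V : Type*} (X : AbstractSimplicialComplex V)

theorem exists_minimal_filling {n : ℕ} {c : ListChain V}
    (h : ∃ a ∈ supp (lists (Faced X) (n + 1)), d a = c) :
    ∃ a ∈ supp (lists (Faced X) (n + 1)), d a = c ∧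
      ∀ a' ∈ supp (lists (Faced X) (n + 1)), d a' = c → norm a ≤ norm a' := by
  let s : Set (ListChain V) := {a | a ∈ supp (lists (Faced X) (n + 1)) ∧ d a = c}
  have hs : s.Nonempty := h
  obtain ⟨h1, h2⟩ := Function.argminOn_mem norm s hs
  exact ⟨Function.argminOn norm s hs, h1, h2, fun a' ha' hd =>
    Function.argminOn_le norm s (⟨ha', hd⟩ : a' ∈ s)⟩

open Classical in
/-- A filling of minimal norm of a chain, if there is a filling. -/
def minFill (n : ℕ) (c : ListChain V) : ListChain V :=
  if h : ∃ a ∈ supp (lists (Faced X) (n + 1)), d a = c then (exists_minimal_filling X h).choose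
  else 0

variable {X}

theorem minFill_spec {n : ℕ} {c : ListChain V}
    (h : ∃ a ∈ supp (lists (Faced X) (n + 1)), d a = c) :
    minFill X n c ∈ supp (lists (Faced X) (n + 1)) ∧ d (minFill X n c) = c ∧
      ∀ a' ∈ supp (lists (Faced X) (n + 1)), d a' = c → norm (minFill X n c) ≤ norm a' := by
  rw [minFill, dif_pos h]
  exact (exists_minimal_filling X h).choose_spec

/-- Degrees `≥ 0` are acyclicity. In degree `-1` the empty list is filled by a vertex, which exists
because a contractible space is nonempty. -/
theorem exists_filling [ContractibleSpace (Realization X)] {n : ℕ} {c : ListChain V}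
    (hc : c ∈ supp (lists (Faced X) n)) (hd : d c = 0) :
    ∃ a ∈ supp (lists (Faced X) (n + 1)), d a = c := by
  match n with
  | n + 1 => exact exists_d_eq_of_contractible X hc hd
  | 0 =>
    obtain ⟨p⟩ : Nonempty (Realization X) := inferInstance
    obtain ⟨v, -⟩ := exists_pos_coord p
    refine map_mem (N := (supp (lists (Faced X) 1)).map d) LinearMap.id (fun l hl => ?_) hc
    obtain rfl := List.length_eq_zero_iff.1 hl.2
    refine ⟨of [v], ?_, by simp [d_cons]⟩
    apply of_mem
    exact ⟨⟨{v}, X.singleton_mem v, by simp⟩, rfl⟩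

end MinFill

section Equivariant

variable {Z V : Type*} [Group Z] [MulAction Z V] (X : AbstractSimplicialComplex V)

/-- The equivariant chain map from the homogeneous complex of `Z` obtained by choosing minimal
fillings for the lists which begin with `1`. -/
def equivFill : ℕ → ListChain Z →ₗ[ℤ] ListChain V
  | 0 => ext fun _ => of []
  | n + 1 => ext fun l => match l with
    | [] => 0
    | z :: l => act z (minFill X n (equivFill n (d (of (1 :: l.map (z⁻¹ * ·))))))

theorem equivFill_cons (n : ℕ) (z : Z) (l : List Z) :
    equivFill X (n + 1) (of (z :: l)) =
      act z (minFill X n (equivFill X n (d (of (1 :: l.map (z⁻¹ * ·)))))) := by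
  rw [equivFill, ext_of]

theorem equivFill_zero (l : List Z) : equivFill X 0 (of l) = of [] := by
  rw [equivFill, ext_of]

/-- Translating a list does not change its normalization `1 :: w⁻¹ l`; only the translation applied
after filling acquires the factor `z`. -/
theorem equivFill_act (n : ℕ) (z : Z) (c : ListChain Z) :
    equivFill X n (act z c) = act z (equivFill X n c) := by
  have : equivFill X n ∘ₗ (act z : ListChain Z →ₗ[ℤ] ListChain Z) =
      (act z : ListChain V →ₗ[ℤ] ListChain V) ∘ₗ equivFill X n :=
    hom_ext fun l => by
      match n, l with
      | 0, l => simp [equivFill]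
      | n + 1, [] => simp [equivFill]
      | n + 1, w :: l =>
        have h1 : act z (of (w :: l)) = of (z * w :: l.map (z * ·)) := by simp
        have h2 : (l.map (z * ·)).map ((z * w)⁻¹ * ·) = l.map (w⁻¹ * ·) := by
          rw [List.map_map]
          congr 1
          funext x
          simp [mul_assoc]
        rw [LinearMap.comp_apply, LinearMap.comp_apply, h1, equivFill_cons, equivFill_cons, h2,
          act_mul]
  exact LinearMap.congr_fun this c

attribute [irreducible] equivFill

variable {X}

theorem d_equivFill_cons {n : ℕ} {z : Z} {l : List Z}
    (h : ∃ a ∈ supp (lists (Faced X) (n + 1)),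
      d a = equivFill X n (d (of (1 :: l.map (z⁻¹ * ·))))) :
    d (equivFill X (n + 1) (of (z :: l))) = equivFill X n (d (of (z :: l))) := by
  have h1 : act z (of (1 :: l.map (z⁻¹ * ·))) = of (z :: l) := by
    rw [act, map_of, List.map_cons, List.map_map]
    have : ((z • ·) ∘ (z⁻¹ * ·) : Z → Z) = id := funext fun x => by simp
    rw [this, List.map_id, smul_eq_mul, mul_one]
  rw [equivFill_cons, d_map, (minFill_spec h).2.1, ← equivFill_act, ← d_map, h1]

variable [ContractibleSpace (Realization X)]

/-- The statements are proved together: the image of a boundary can be filled because it is a cycle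
in the complex, and the filling gives both statements one degree up. -/
theorem equivFill_mem_and_d (hX : FaceInvariant Z X) (n : ℕ) :
    (∀ c ∈ supp (lists (fun _ : List Z => True) n), equivFill X n c ∈ supp (lists (Faced X) n)) ∧
      ∀ c ∈ supp (lists (fun _ : List Z => True) (n + 1)), d (equivFill X n (d c)) = 0 := by
  induction n with
  | zero =>
    obtain ⟨p⟩ : Nonempty (Realization X) := inferInstance
    obtain ⟨v, -⟩ := exists_pos_coord p
    constructor
    · refine fun c hc => map_mem _ (fun l _ => ?_) hc
      rw [equivFill_zero]
      apply of_mem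
      exact ⟨⟨{v}, X.singleton_mem v, by simp⟩, rfl⟩
    · intro c _
      have : d ∘ₗ (equivFill X 0 : ListChain Z →ₗ[ℤ] ListChain V) = 0 :=
        hom_ext fun l => by simp [equivFill_zero]
      exact LinearMap.congr_fun this (d c)
  | succ n ih =>
    have hfill : ∀ z : Z, ∀ l : List Z, l.length = n → ∃ a ∈ supp (lists (Faced X) (n + 1)),
        d a = equivFill X n (d (of (1 :: l.map (z⁻¹ * ·)))) := fun z l hl => by
      have h1 : of (1 :: l.map (z⁻¹ * ·)) ∈ supp (lists (fun _ : List Z => True) (n + 1)) := by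
        apply of_mem
        exact ⟨trivial, by simp [hl]⟩
      exact exists_filling (ih.1 _ (d_mem (fun _ _ _ _ => trivial) h1)) (ih.2 _ h1)
    have hd : ∀ c ∈ supp (lists (fun _ : List Z => True) (n + 1)),
        d (equivFill X (n + 1) c) = equivFill X n (d c) := by
      intro c hc
      refine comp_congr (fun l hl => ?_) hc
      match l, hl with
      | z :: l, hl => exact d_equivFill_cons (hfill z l (by simpa using hl.2))
    constructor
    · refine fun c hc => map_mem _ (fun l hl => ?_) hc
      match l, hl with
      | z :: l, hl =>
        rw [equivFill_cons]
        exact act_mem hX z (minFill_spec (hfill z l (by simpa using hl.2))).1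
    · intro c hc
      rw [hd _ (d_mem (fun _ _ _ _ => trivial) hc), d_d, map_zero]

theorem equivFill_mem (hX : FaceInvariant Z X) {n : ℕ} {c : ListChain Z}
    (hc : c ∈ supp (lists (fun _ : List Z => True) n)) :
    equivFill X n c ∈ supp (lists (Faced X) n) :=
  (equivFill_mem_and_d hX n).1 c hc

theorem exists_filling_equivFill (hX : FaceInvariant Z X) {n : ℕ} (z : Z) {l : List Z}
    (hl : l.length = n) : ∃ a ∈ supp (lists (Faced X) (n + 1)),
      d a = equivFill X n (d (of (1 :: l.map (z⁻¹ * ·)))) := by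
  have h1 : of (1 :: l.map (z⁻¹ * ·)) ∈ supp (lists (fun _ : List Z => True) (n + 1)) := by
    apply of_mem
    exact ⟨trivial, by simp [hl]⟩
  exact exists_filling (equivFill_mem hX (d_mem (fun _ _ _ _ => trivial) h1))
    ((equivFill_mem_and_d hX n).2 _ h1)

theorem isChainMap_equivFill (hX : FaceInvariant Z X) :
    IsChainMap (fun _ : List Z => True) (equivFill X) where
  nil := equivFill_zero X []
  d_comm n l _ hl := by
    match l, hl with
    | z :: l, hl => exact d_equivFill_cons (exists_filling_equivFill hX z (by simpa using hl))

/-! #### Polynomial bounds -/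

variable (T : GenSet Z)

/-- This replaces the Dehn function in degree `0`, which need not be finite. The chain `a` serves as
base point: `s • a - a` is filled once for each generator `s`, and the fillings are strung along a
shortest word for `z`. -/
theorem exists_path_norm_le (hX : FaceInvariant Z X) {a : ListChain V}
    (ha : a ∈ supp (lists (Faced X) 1)) (hd : d a = of []) :
    ∃ A : ℕ, ∀ z : Z, ∃ p ∈ supp (lists (Faced X) 2), d p = act z a - a ∧
      norm p ≤ A * T.wordLength z := by
  have hfill : ∀ z : Z, ∃ p ∈ supp (lists (Faced X) 2), d p = act z a - a := fun z =>
    exists_filling (Submodule.sub_mem _ (act_mem hX z ha) ha) (by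
      rw [map_sub, d_map, hd]
      simp)
  choose p hp hdp using hfill
  let A := ∑ s ∈ T.carrier, norm (p s)
  refine ⟨A, fun z => ?_⟩
  obtain ⟨l, hl, rfl, hlen⟩ := T.exists_minimal_word z
  rw [← hlen]
  clear hlen
  induction l with
  | nil => exact ⟨0, Submodule.zero_mem _, by simp [act_one], by simp⟩
  | cons s l ih =>
    obtain ⟨q, hq, hdq, hnq⟩ := ih fun t ht => hl t (by simp [ht])
    -- The translated path of `l` followed by the path of `s`: `s (l a - a) + (s a - a) = s l a -
    -- a`.
    refine ⟨act s q + p s, Submodule.add_mem _ (act_mem hX s hq) (hp s), ?_, ?_⟩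
    · rw [map_add, d_map, hdq, hdp, map_sub, List.prod_cons, act_mul]
      abel
    · have h1 : norm (p s) ≤ A :=
        Finset.single_le_sum (f := fun s => norm (p s)) (fun _ _ => Nat.zero_le _)
          (hl s (by simp))
      have h2 := norm_map_vertices_le (s • ·) q
      refine (norm_add_le _ _).trans ?_
      rw [List.length_cons, mul_add, mul_one]
      exact Nat.add_le_add (h2.trans hnq) h1

/-- Multiplication by `z⁻¹` adds at most `|z|` to each entry. -/
theorem listLength_normalize_le (z : Z) (l : List Z) :
    T.listLength (1 :: l.map (z⁻¹ * ·)) ≤ (l.length + 1) * T.listLength (z :: l) := by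
  have h1 := T.listLength_map_le T (f := (z⁻¹ * ·)) (A := 1) (B := T.wordLength z) (fun g => by
    have h1 := T.wordLength_mul_le z⁻¹ g
    have h2 := T.wordLength_inv_le z
    omega) l
  rw [T.listLength_cons, T.listLength_cons, T.wordLength_one]
  nlinarith [Nat.zero_le (l.length * T.listLength l)]

theorem norm_equivFill_cons_le (hX : FaceInvariant Z X) {n : ℕ} (z : Z) {l : List Z}
    (hl : l.length = n) {a : ListChain V} (ha : a ∈ supp (lists (Faced X) (n + 1)))
    (hd : d a = equivFill X n (d (of (1 :: l.map (z⁻¹ * ·))))) :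
    norm (equivFill X (n + 1) (of (z :: l))) ≤ norm a := by
  rw [equivFill_cons]
  exact (norm_map_vertices_le _ _).trans
    ((minFill_spec (exists_filling_equivFill hX z hl)).2.2 a ha hd)

/-- Induction on the length. Single elements give translates of one fixed chain, pairs are filled
along words. From length three on, the Dehn function bounds a filling of the image of the boundary,
which is itself polynomially bounded; minimality transfers the bound to the chosen filling. -/
theorem exists_norm_equivFill_le [LinearOrder V] (hX : FaceInvariant Z X)
    (hdehn : ∀ n : ℕ, 1 ≤ n → ∃ P : Polynomial ℕ, ∀ k : ℕ,
      dehnFunction X n k ≤ (P.eval k : ℕ)) (n : ℕ) :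
    ∃ C m : ℕ, ∀ l : List Z, l.length = n →
      norm (equivFill X n (of l)) ≤ C * (1 + T.listLength l) ^ m := by
  induction n with
  | zero => exact ⟨1, 0, fun l _ => by simp [equivFill_zero]⟩
  | succ n ih =>
    match n with
    | 0 =>
      refine ⟨norm (equivFill X 1 (of [(1 : Z)])), 0, fun l hl => ?_⟩
      obtain ⟨z, rfl⟩ := List.length_eq_one_iff.1 hl
      obtain ⟨a, ha, hd⟩ := exists_filling_equivFill hX (1 : Z) (l := []) rfl
      have h1 := minFill_spec (exists_filling_equivFill hX (1 : Z) (l := []) rfl)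
      refine (norm_equivFill_cons_le hX z (l := []) rfl h1.1 h1.2.1).trans ?_
      rw [equivFill_cons, act_one]
      simp
    | 1 =>
      have hc := isChainMap_equivFill (Z := Z) hX
      have h1 : of [(1 : Z)] ∈ supp (lists (fun _ : List Z => True) 1) := by
        apply of_mem
        exact ⟨trivial, rfl⟩
      have h2 : d (equivFill X 1 (of [(1 : Z)])) = of [] := by
        rw [hc.d_comm 0 _ trivial rfl, d_cons]
        simp [hc.nil]
      obtain ⟨A, hA⟩ := exists_path_norm_le T hX (equivFill_mem hX h1) h2
      refine ⟨A * 2, 1, fun l hl => ?_⟩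
      match l, hl with
      | [z, w], _ =>
        obtain ⟨p, hp, hdp, hnp⟩ := hA (z⁻¹ * w)
        refine (norm_equivFill_cons_le (n := 1) hX z (l := [w]) rfl hp ?_).trans (hnp.trans ?_)
        · rw [hdp, ← equivFill_act, ← map_sub]
          congr 1
          simp [d_cons]
        · have h3 := listLength_normalize_le T z [w]
          have h4 : T.listLength (1 :: [w].map (z⁻¹ * ·)) = T.wordLength (z⁻¹ * w) := by
            simp [GenSet.listLength]
          rw [h4] at h3
          rw [mul_assoc, pow_one]
          refine Nat.mul_le_mul_left _ ?_
          simp only [List.length_cons, List.length_nil] at h3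
          omega
    | k + 2 =>
      obtain ⟨C, m, hCm⟩ := ih
      -- The boundary to be filled consists of lists of length `k + 2`, that is, of simplices of
      -- dimension `k + 1 ≥ 1`, where the Dehn function is available.
      obtain ⟨P, hP⟩ := hdehn (k + 1) (by omega)
      obtain ⟨C', m', hfill⟩ := exists_filling_norm_le hP
      -- The factor under the power `m` is the loss in normalizing the list; the last one is the
      -- number of faces.
      let D := C * (k + 3) ^ m * (k + 3)
      refine ⟨C' * (1 + D) ^ m', m * m', fun l hl => ?_⟩
      match l, hl with
      | z :: l, hl =>
        have hl : l.length = k + 2 := by simpa using hl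
        let l₀ := 1 :: l.map (z⁻¹ * ·)
        have hl₀ : l₀.length = k + 3 := by simp [l₀, hl]
        have hl₀mem : of l₀ ∈ supp (lists (fun _ : List Z => True) (k + 3)) := by
          apply of_mem
          exact ⟨trivial, hl₀⟩
        obtain ⟨a, ha, hda, hna⟩ := hfill (equivFill X (k + 2) (d (of l₀)))
          (equivFill_mem hX (d_mem (fun _ _ _ _ => trivial) hl₀mem))
          ((equivFill_mem_and_d hX (k + 2)).2 _ hl₀mem)
        refine (norm_equivFill_cons_le hX z hl ha hda).trans (hna.trans (polynomial_comp_le ?_))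
        refine (norm_map_le (B := C * (1 + T.listLength l₀) ^ m) _ (fun t ht => ?_)
          (d_mem_length hl₀)).trans ?_
        · refine (hCm t ht.2).trans (Nat.mul_le_mul_left _ (Nat.pow_le_pow_left ?_ m))
          have := T.listLength_le_of_sublist ht.1
          omega
        · have h1 : norm (d (of l₀)) ≤ k + 3 := hl₀ ▸ norm_d_of_le l₀
          have h2 : 1 + T.listLength l₀ ≤ (k + 3) * (1 + T.listLength (z :: l)) := by
            have := listLength_normalize_le T z l
            rw [hl] at this
            have h3 : T.listLength l₀ = T.listLength (1 :: l.map (z⁻¹ * ·)) := rfl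
            rw [h3]
            nlinarith
          calc C * (1 + T.listLength l₀) ^ m * norm (d (of l₀))
              ≤ C * ((k + 3) * (1 + T.listLength (z :: l))) ^ m * (k + 3) :=
                Nat.mul_le_mul (Nat.mul_le_mul_left _ (Nat.pow_le_pow_left h2 m)) h1
            _ = D * (1 + T.listLength (z :: l)) ^ m := by
                simp only [D]
                rw [mul_pow]
                ring

end Equivariant

end

section

open ListChain

/-! ### Invariant cocycles of polynomial growth -/

/-! ### Equivariant maps to the group from free actions -/

section EquivariantMap

/-- Choose a shortest element `m a` in each orbit and let `τ a` carry `m a` to `a`. Freeness makes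
`τ a` unique, hence equivariant, and `(τ a)⁻¹ • a = m a` is no longer than `a`. -/
theorem exists_equivariant_of_free {Z α : Type*} [Group Z] [MulAction Z α]
    (hfree : ∀ (z : Z) (a : α), z • a = a → z = 1) (len : α → ℕ) :
    ∃ τ : α → Z, (∀ (z : Z) (a : α), τ (z • a) = z * τ a) ∧ ∀ a, len ((τ a)⁻¹ • a) ≤ len a := by
  have hne : ∀ a : α, (MulAction.orbit Z a).Nonempty := fun a => MulAction.nonempty_orbit a
  let m : α → α := fun a => Function.argminOn len (MulAction.orbit Z a) (hne a)
  have hm : ∀ a, ∃ z : Z, z • m a = a := fun a => by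
    obtain ⟨z, hz⟩ := Function.argminOn_mem len (MulAction.orbit Z a) (hne a)
    refine ⟨z⁻¹, ?_⟩
    have hz : z • a = m a := hz
    rw [← hz, inv_smul_smul]
  have hmz : ∀ (z : Z) a, m (z • a) = m a := fun z a => by
    have h : MulAction.orbit Z (z • a) = MulAction.orbit Z a := MulAction.orbit_smul z a
    simp only [m, h]
  choose τ hτ using hm
  refine ⟨τ, fun z a => ?_, fun a => ?_⟩
  · have h1 : ((z * τ a)⁻¹ * τ (z • a)) • m a = m a := by
      rw [mul_smul, ← hmz z a, hτ, hmz, inv_smul_eq_iff, mul_smul, hτ]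
    have h2 := hfree _ _ h1
    rw [inv_mul_eq_one] at h2
    exact h2.symm
  · have h1 : (τ a)⁻¹ • a = m a := by
      rw [inv_smul_eq_iff, hτ]
    rw [h1]
    exact Function.argminOn_le len _ (MulAction.mem_orbit_self a)

variable {G : Type*} [Group G] {S : GenSet G} {Z : Subgroup G}

/-- A quasi-isometrically embedded subgroup has an equivariant retraction of linear growth. -/
theorem exists_equivariant_retraction (hqi : IsQIEmbeddedSubgroup S Z) :
    ∃ (T : GenSet Z) (τ : G → Z) (A B : ℕ), (∀ (z : Z) (g : G), τ (z • g) = z * τ g) ∧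
      ∀ g, T.wordLength (τ g) ≤ A * S.wordLength g + B := by
  obtain ⟨T, L, C, hL, hC, h⟩ := hqi
  obtain ⟨τ, hτ, hlen⟩ := exists_equivariant_of_free (Z := Z) (α := G)
    (fun z g h => Subtype.ext (mul_eq_right.1 h)) S.wordLength
  refine ⟨T, τ, ⌈2 * L⌉₊, ⌈L * C⌉₊, hτ, fun g => ?_⟩
  have h1 := (h 1 (τ g)).1
  simp only [inv_one, one_mul, OneMemClass.coe_one] at h1
  -- `τ g` is `g` times the inverse of the shortest element of its orbit, which is no longer than
  -- `g`. The quasi-isometry inequality then bounds the length in the subgroup.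
  have h2 : S.wordLength (τ g : G) ≤ 2 * S.wordLength g := by
    have h3 : (τ g : G) = g * ((τ g)⁻¹ • g)⁻¹ := by
      rw [Subgroup.smul_def, smul_eq_mul]
      simp
    have h4 := S.wordLength_mul_le g ((τ g)⁻¹ • g)⁻¹
    rw [← h3] at h4
    have h5 := S.wordLength_inv_le ((τ g)⁻¹ • g)
    have h6 := hlen g
    omega
  have h2' : (S.wordLength (τ g : G) : ℝ) ≤ 2 * S.wordLength g := by exact_mod_cast h2
  have h3 : (T.wordLength (τ g) : ℝ) ≤ L * (S.wordLength (τ g : G) + C) := by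
    rw [mul_comm, ← div_le_iff₀ (by linarith)]
    linarith
  have h4 : (T.wordLength (τ g) : ℝ) ≤ (⌈2 * L⌉₊ * S.wordLength g + ⌈L * C⌉₊ : ℕ) := by
    push_cast
    have h5 := Nat.le_ceil (2 * L)
    have h6 := Nat.le_ceil (L * C)
    have h7 : (0 : ℝ) ≤ S.wordLength g := Nat.cast_nonneg _
    nlinarith
  exact_mod_cast h4

end EquivariantMap

/-! ### Replacing invariant cocycles by cocycles of polynomial growth -/

section Cocycle

variable {G : Type*} [Group G] {Z : Subgroup G}

/-- A function on lists invariant under the diagonal action of a subgroup. -/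
def ListInvariant (Z : Subgroup G) (u : List G → ℂ) : Prop :=
  ∀ (z : Z) (l : List G), u (l.map (z • ·)) = u l

theorem ListInvariant.ext_act {u : List G → ℂ} (hu : ListInvariant Z u) (z : Z)
    (c : ListChain G) : ext u (act z c) = ext u c := by
  have : ext u ∘ₗ (act z : ListChain G →ₗ[ℤ] ListChain G) = ext u := hom_ext fun l => by
    rw [LinearMap.comp_apply, map_of, ext_of, ext_of, hu]
  exact LinearMap.congr_fun this c

theorem SimplicialEG.faceInvariant {H : Type*} [Group H] (E : SimplicialEG H) :
    FaceInvariant H E.X := by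
  classical
  rintro z l ⟨s, hs, hl⟩
  refine ⟨_, E.smul_mem z s hs, fun v hv => ?_⟩
  obtain ⟨w, hw, rfl⟩ := List.mem_map.1 hv
  exact Finset.mem_image_of_mem _ (hl w hw)

theorem SimplicialEG.eq_one_of_smul_eq {H : Type*} [Group H] (E : SimplicialEG H) (z : H)
    (v : E.V) (h : z • v = v) : z = 1 :=
  E.eq_one_of_smul_mem {v} (E.X.singleton_mem v) v (by simp) z (by simp [h])

/-- An invariant function is bounded on the simplices of a given dimension. -/
theorem SimplicialEG.exists_bound {E : SimplicialEG Z} (hE : E.HasFiniteSkeleta)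
    {γ : E.V → G} (hγ : ∀ (z : Z) v, γ (z • v) = z • γ v) {u : List G → ℂ}
    (hu : ListInvariant Z u) (n : ℕ) :
    ∃ K : ℕ, ∀ l ∈ lists (Faced E.X) (n + 1), ‖u (l.map γ)‖ ≤ K := by
  classical
  choose F hF using hE
  -- Vertices of orbit representatives of the faces of all dimensions up to `n`: a list of length `n
  -- + 1` may have repetitions and span a smaller face.
  let A : Finset E.V := (Finset.range (n + 1)).biUnion fun k => (F k).biUnion id
  have hfin : Set.Finite {l : List E.V | l.length = n + 1 ∧ ∀ v ∈ l, v ∈ A} := by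
    refine ((List.finite_length_eq A (n + 1)).image (List.map Subtype.val)).subset ?_
    rintro l ⟨hl, hA⟩
    exact ⟨l.attach.map fun v => ⟨v.1, hA v.1 v.2⟩, by simp [hl], by simp [Function.comp_def]⟩
  obtain ⟨K, hK⟩ := exists_nat_ge (∑ l ∈ hfin.toFinset, ‖u (l.map γ)‖)
  refine ⟨K, fun l hl => ?_⟩
  obtain ⟨⟨s, hs, hls⟩, hn⟩ := hl
  have hne : l.toFinset.Nonempty := by
    rw [List.toFinset_nonempty_iff]
    exact List.length_pos_iff.1 (by omega)
  have hface : l.toFinset ∈ E.X.faces :=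
    (E.X.isRelLowerSet_faces hs).2 (fun v hv => hls v (by simpa using hv)) hne
  have hcard := Finset.card_pos.2 hne
  have hcard' := l.toFinset_card_le
  obtain ⟨t, ht, g, hg⟩ := hF (l.toFinset.card - 1) l.toFinset hface (by omega)
  have hmem : l.map (g⁻¹ • ·) ∈ hfin.toFinset := by
    rw [Set.Finite.mem_toFinset]
    refine ⟨by simp [hn], fun v hv => ?_⟩
    obtain ⟨w, hw, rfl⟩ := List.mem_map.1 hv
    have hw : w ∈ l.toFinset := by simpa using hw
    rw [hg] at hw
    obtain ⟨x, hx, rfl⟩ := Finset.mem_image.1 hw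
    rw [inv_smul_smul]
    refine Finset.mem_biUnion.2 ⟨l.toFinset.card - 1, Finset.mem_range.2 (by omega), ?_⟩
    exact Finset.mem_biUnion.2 ⟨t, ht, hx⟩
  have heq : u ((l.map (g⁻¹ • ·)).map γ) = u (l.map γ) := by
    rw [← hu g⁻¹ (l.map γ), List.map_map, List.map_map]
    congr 2
    funext v
    exact hγ g⁻¹ v
  rw [← heq]
  exact (Finset.single_le_sum (f := fun l : List E.V => ‖u (l.map γ)‖)
    (fun _ _ => norm_nonneg _) hmem).trans hK

theorem norm_ext_le {V : Type*} {u : List V → ℂ} {s : Set (List V)} {K : ℝ}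
    (hK : ∀ l ∈ s, ‖u l‖ ≤ K) {c : ListChain V} (hc : c ∈ supp s) :
    ‖ext u c‖ ≤ K * c.norm := by
  rw [ext, Finsupp.linearCombination_apply, Finsupp.sum, ListChain.norm, Finsupp.sum, Nat.cast_sum,
    Finset.mul_sum]
  refine norm_sum_le_of_le _ fun l hl => ?_
  rw [zsmul_eq_mul, norm_mul, mul_comm]
  refine mul_le_mul (hK l (hc hl)) (le_of_eq ?_) (norm_nonneg _)
    ((norm_nonneg _).trans (hK l (hc hl)))
  rw [Complex.norm_intCast, Nat.cast_natAbs, Int.cast_abs]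

/-- Every invariant cocycle on the homogeneous complex of `G` is cohomologous, by an invariant
cochain, to one of polynomial growth. -/
theorem exists_polynomial_cocycle {S : GenSet G} (hqi : IsQIEmbeddedSubgroup S Z)
    (hdehn : HasPolyBoundedDehnFunctions Z) {n : ℕ} {u₀ : List G → ℂ} (hu₀ : ListInvariant Z u₀)
    (hcocycle : ∀ l : List G, l.length = n + 2 → ext u₀ (d (of l)) = 0) :
    ∃ u ψ : List G → ℂ, ListInvariant Z u ∧ ListInvariant Z ψ ∧
      (∀ l : List G, l.length = n + 1 → u l = u₀ l + ext ψ (d (of l))) ∧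
      (n = 0 → ψ = 0) ∧
      ∃ C m : ℕ, ∀ l : List G, l.length = n + 1 → ‖u l‖ ≤ C * (1 + S.listLength l) ^ m := by
  obtain ⟨E, hfin, hdehn⟩ := hdehn
  have hcontr := E.contractible
  obtain ⟨T, τ, A, B, hτ, hlen⟩ := exists_equivariant_retraction hqi
  -- The size of this equivariant map plays no role, so the length function is taken constant.
  obtain ⟨γ', hγ', -⟩ := exists_equivariant_of_free E.eq_one_of_smul_eq (fun _ => 0)
  let γ : E.V → G := fun v => γ' v
  have hγ : ∀ (z : Z) v, γ (z • v) = z • γ v := fun z v => by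
    simp only [γ, hγ', Subgroup.coe_mul, Subgroup.smul_def, smul_eq_mul]
  have hX := E.faceInvariant
  -- The detour through the contractible complex, an equivariant chain endomorphism of the
  -- homogeneous complex of `G`.
  let φ : ℕ → ListChain G →ₗ[ℤ] ListChain G := fun k => map γ ∘ₗ (equivFill E.X k ∘ₗ map τ)
  have hτmem : ∀ k, ∀ l ∈ lists (fun _ : List G => True) k,
      map τ (of l) ∈ supp (lists (fun _ : List Z => True) k) := fun k l hl =>
    map_mem_lists (P := fun _ => True) (fun _ _ => trivial) (of_mem hl)
  have hφ : IsChainMap (fun _ => True) φ := by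
    refine (isChainMap_map (Faced E.X) γ).comp
      ((isChainMap_equivFill hX).comp (isChainMap_map _ τ) hτmem) fun k l hl => ?_
    exact equivFill_mem hX (hτmem k l hl)
  have hφact : ∀ (z : Z) k (c : ListChain G), φ k (act z c) = act z (φ k c) := fun z k c => by
    have h1 : τ ∘ (z • ·) = (z • ·) ∘ τ := funext fun g => hτ z g
    have h2 : γ ∘ (z • ·) = (z • ·) ∘ γ := funext fun v => hγ z v
    simp only [φ, LinearMap.comp_apply]
    rw [act, ListChain.map_map, h1, ← ListChain.map_map, equivFill_act, act, ListChain.map_map, h2,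
      ← ListChain.map_map]
  have hφmem : ∀ k, ∀ l ∈ lists (fun l : List G => ∀ v ∈ l, v ∈ Set.univ) k,
      φ k (of l) ∈ supp (lists (fun l => ∀ v ∈ l, v ∈ Set.univ) k) := fun k l hl =>
    map_mem_lists (P := Faced E.X) (fun _ _ _ _ => trivial)
      (equivFill_mem hX (hτmem k l ⟨trivial, hl.2⟩))
  let H := headHomotopy φ
  -- `u = u₀ ∘ φ` and `ψ = u₀ ∘ H`; both are invariant because `φ`, and with it `H`, is equivariant.
  refine ⟨fun l => ext u₀ (φ (n + 1) (of l)), fun l => ext u₀ (H n (of l)), fun z l => ?_,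
    fun z l => ?_, fun l hl => ?_, ?_, ?_⟩
  · beta_reduce
    rw [← map_of, hφact, hu₀.ext_act]
  · beta_reduce
    rw [← map_of]
    have h1 := map_headHomotopy (fun k l => hφact z k (of l)) n (of l)
    exact (congrArg (ext u₀) h1).trans (hu₀.ext_act z _)
  · have hl' : of l ∈ supp (lists (fun _ : List G => True) (n + 1)) := by
      apply of_mem
      exact ⟨trivial, hl⟩
    have hd := d_headHomotopy (fun _ _ _ _ => trivial) hφ n _ hl'
    -- The cocycle vanishes on `d (H l) = φ l - l - H (d l)`, which is the relation between `u`,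
    -- `u₀` and `ψ`.
    have h0 : ext u₀ (d (H (n + 1) (of l))) = 0 := by
      have h1 : H (n + 1) (of l) ∈ supp (lists (fun l => ∀ v ∈ l, v ∈ Set.univ) (n + 2)) := by
        refine headHomotopy_mem hφmem (n + 1) (of l) ?_
        apply of_mem
        exact ⟨fun _ _ => trivial, hl⟩
      exact comp_congr (f' := (0 : ListChain G →ₗ[ℤ] ℂ)) (g' := LinearMap.id)
        (fun m hm => hcocycle m hm.2) h1
    have h1 : ext (fun l => ext u₀ (H n (of l))) = ext u₀ ∘ₗ H n := hom_ext fun l => by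
      rw [ext_of]
      rfl
    rw [hd, map_sub, map_sub, ext_of] at h0
    rw [h1, LinearMap.comp_apply]
    linear_combination h0
  -- `H` is zero on the empty list, so in degree `0` no multiple of the augmentation is added; such
  -- a multiple would not be a Hochschild coboundary.
  · rintro rfl
    funext l
    simp [H, headHomotopy]
  -- `u₀ ∘ γ` is bounded on simplices of fixed dimension, so `u` grows at most like the fillings
  -- composed with the linear growth of `τ`.
  · obtain ⟨K, hK⟩ := E.exists_bound hfin hγ hu₀ n
    obtain ⟨C, m, hCm⟩ := exists_norm_equivFill_le T hX hdehn (n + 1)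
    refine ⟨K * (C * (1 + (A + (n + 1) * B)) ^ m), 1 * m, fun l hl => ?_⟩
    have h1 : ext u₀ (φ (n + 1) (of l)) =
        ext (fun l => u₀ (l.map γ)) (equivFill E.X (n + 1) (of (l.map τ))) := by
      have h2 : ext u₀ ∘ₗ map γ = ext fun l => u₀ (l.map γ) := hom_ext fun l => by
        rw [LinearMap.comp_apply, map_of, ext_of, ext_of]
      rw [← h2]
      simp [φ]
    have hmem := equivFill_mem hX (hτmem (n + 1) l ⟨trivial, hl⟩)
    rw [map_of] at hmem
    beta_reduce
    rw [h1]
    refine (norm_ext_le hK hmem).trans ?_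
    have h2 := hCm (l.map τ) (by simp [hl])
    have h3 := S.listLength_map_le T hlen l
    rw [hl] at h3
    have h4 : T.listLength (l.map τ) ≤ (A + (n + 1) * B) * (1 + S.listLength l) ^ 1 := by
      rw [pow_one]
      nlinarith [Nat.zero_le (B * S.listLength l * (n + 1))]
    have h5 := h2.trans (polynomial_comp_le h4)
    have h6 := Nat.mul_le_mul_left K h5
    rw [← mul_assoc] at h6
    exact_mod_cast h6

end Cocycle

end

section

open ListChain

/-! ### The Hochschild complex of a group ring in terms of tuples -/

section Tuples

variable {G : Type*} [Group G] {n : ℕ}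

/-- The elementary tensor of a tuple of group elements. -/
def groupTensor (g : Fin (n + 1) → G) : TensorPow (MonoidAlgebra ℂ G) n :=
  PiTensorProduct.tprod ℂ fun i => MonoidAlgebra.single (g i) 1

/-- The basis of elementary tensors. -/
def groupTensorBasis (G : Type*) [Group G] (n : ℕ) :
    Module.Basis (Fin (n + 1) → G) ℂ (TensorPow (MonoidAlgebra ℂ G) n) :=
  Basis.piTensorProduct fun _ => MonoidAlgebra.basis G ℂ

theorem groupTensorBasis_apply (g : Fin (n + 1) → G) : groupTensorBasis G n g = groupTensor g := by
  rw [groupTensorBasis, Basis.piTensorProduct_apply]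
  rfl

/-- The functional on the Hochschild chains with given values on the tuples of group elements. -/
def tupleFunctional (u : (Fin (n + 1) → G) → ℂ) : TensorPow (MonoidAlgebra ℂ G) n →ₗ[ℂ] ℂ :=
  (groupTensorBasis G n).constr ℂ u

theorem tupleFunctional_groupTensor (u : (Fin (n + 1) → G) → ℂ) (g : Fin (n + 1) → G) :
    tupleFunctional u (groupTensor g) = u g := by
  rw [← groupTensorBasis_apply, tupleFunctional, Module.Basis.constr_basis]

theorem tupleFunctional_apply (u : (Fin (n + 1) → G) → ℂ) (c : TensorPow (MonoidAlgebra ℂ G) n) :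
    tupleFunctional u c = ((groupTensorBasis G n).repr c).sum fun g a => a * u g := by
  rw [tupleFunctional, Module.Basis.constr_apply]
  rfl

theorem tensor_hom_ext {M : Type*} [AddCommGroup M] [Module ℂ M]
    {f f' : TensorPow (MonoidAlgebra ℂ G) n →ₗ[ℂ] M}
    (h : ∀ g, f (groupTensor g) = f' (groupTensor g)) : f = f' :=
  (groupTensorBasis G n).ext fun g => by rw [groupTensorBasis_apply, h]

theorem face_single (j : Fin (n + 2)) (g : Fin (n + 2) → G) :
    (face j fun i => (MonoidAlgebra.single (g i) 1 : MonoidAlgebra ℂ G)) =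
      fun i => MonoidAlgebra.single (face j g i) 1 := by
  funext k
  simp only [face, Fin.contractNth]
  split_ifs <;> simp [MonoidAlgebra.single_mul_single]

theorem hochschildB_groupTensor (g : Fin (n + 2) → G) :
    hochschildB _ n (groupTensor g) =
      ∑ j : Fin (n + 2), (-1 : ℂ) ^ (j : ℕ) • groupTensor (face j g) := by
  rw [groupTensor, hochschildB_tprod]
  refine Finset.sum_congr rfl fun j _ => ?_
  rw [face_single]
  rfl

/-- The coboundary of a function on tuples. -/
def tupleCoboundary (u : (Fin (n + 1) → G) → ℂ) (g : Fin (n + 2) → G) : ℂ :=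
  ∑ j : Fin (n + 2), (-1 : ℂ) ^ (j : ℕ) * u (face j g)

theorem tupleFunctional_hochschildB (u : (Fin (n + 1) → G) → ℂ) :
    tupleFunctional u ∘ₗ hochschildB _ n = tupleFunctional (tupleCoboundary u) :=
  tensor_hom_ext fun g => by
    rw [LinearMap.comp_apply, hochschildB_groupTensor, tupleFunctional_groupTensor, map_sum]
    refine Finset.sum_congr rfl fun j _ => ?_
    rw [map_smul, tupleFunctional_groupTensor, smul_eq_mul]

/-- The tuple of group elements `(rₙ⁻¹ h r₀, r₀⁻¹ r₁, …, rₙ₋₁⁻¹ rₙ)`. -/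
def cyclicTuple (h : G) (r : Fin (n + 1) → G) : Fin (n + 1) → G :=
  Fin.cases ((r (Fin.last n))⁻¹ * h * r 0) fun k : Fin n => (r k.castSucc)⁻¹ * r k.succ

/-- Multiplying neighbours cancels one `r_j`, also in the cyclic face: `(rₙ⁻¹ rₙ₊₁)(rₙ₊₁⁻¹ h r₀) =
rₙ⁻¹ h r₀`. -/
theorem face_cyclicTuple (h : G) (r : Fin (n + 2) → G) (j : Fin (n + 2)) :
    face j (cyclicTuple h r) = cyclicTuple h (r ∘ j.succAbove) := by
  -- Extending `r` to all natural numbers reduces the claim to index arithmetic.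
  obtain ⟨r', rfl⟩ : ∃ r' : ℕ → G, r = fun i : Fin (n + 2) => r' i.1 :=
    ⟨fun i => if h : i < n + 2 then r ⟨i, h⟩ else r 0, by ext i; simp⟩
  have key : ∀ {m : ℕ} (s : Fin (m + 1) → G) (k : Fin (m + 1)), cyclicTuple h s k =
      if k = 0 then (s (Fin.last m))⁻¹ * h * s 0
      else (s ⟨k.1 - 1, by omega⟩)⁻¹ * s k := by
    intro m s k
    induction k using Fin.cases with
    | zero => simp [cyclicTuple]
    | succ k =>
      rw [if_neg (Fin.succ_ne_zero k)]
      rfl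
  funext k
  rcases j with ⟨j, hj⟩
  rcases k with ⟨k, hk⟩
  simp only [face, Fin.contractNth, key, Function.comp_apply, Fin.succAbove, Fin.lt_def,
    Fin.ext_iff, Fin.val_succ, Fin.val_castSucc, Fin.val_last, Fin.val_zero]
  grind [mul_assoc, mul_inv_cancel_left]

/-- The product of a tuple. -/
def tupleProd (g : Fin (n + 1) → G) : G := Fin.partialProd g (Fin.last (n + 1))

theorem partialProd_cyclicTuple (h : G) (r : Fin (n + 1) → G) (k : Fin (n + 1)) :
    Fin.partialProd (cyclicTuple h r) k.succ = (r (Fin.last n))⁻¹ * h * r k := by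
  induction k using Fin.induction with
  | zero =>
    rw [Fin.partialProd_succ, Fin.castSucc_zero, Fin.partialProd_zero, one_mul]
    rfl
  | succ k ih =>
    rw [Fin.partialProd_succ, ← Fin.succ_castSucc, ih]
    have : cyclicTuple h r k.succ = (r k.castSucc)⁻¹ * r k.succ := rfl
    rw [this]
    group

theorem tupleProd_cyclicTuple (h : G) (r : Fin (n + 1) → G) :
    tupleProd (cyclicTuple h r) = (r (Fin.last n))⁻¹ * h * r (Fin.last n) := by
  rw [tupleProd, ← Fin.succ_last, partialProd_cyclicTuple]

/-- For `r_k = ρ g₀ ⋯ g_k` one has `rₙ = ρ (ρ⁻¹ h ρ) = h ρ`, hence `rₙ⁻¹ h r₀ = g₀`; the other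
quotients telescope. -/
theorem cyclicTuple_partialProd {h ρ : G} {g : Fin (n + 1) → G} (hρ : tupleProd g = ρ⁻¹ * h * ρ) :
    cyclicTuple h (fun k => ρ * Fin.partialProd g k.succ) = g := by
  funext k
  induction k using Fin.cases with
  | zero =>
    have h1 : cyclicTuple h (fun k => ρ * Fin.partialProd g k.succ) 0 =
        (ρ * Fin.partialProd g (Fin.last n).succ)⁻¹ * h *
          (ρ * Fin.partialProd g (0 : Fin (n + 1)).succ) := rfl
    rw [h1, Fin.succ_last]
    change (ρ * tupleProd g)⁻¹ * h * _ = _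
    rw [hρ, Fin.partialProd_succ, Fin.castSucc_zero, Fin.partialProd_zero]
    group
  | succ k =>
    have h1 : cyclicTuple h (fun k => ρ * Fin.partialProd g k.succ) k.succ =
        (ρ * Fin.partialProd g k.castSucc.succ)⁻¹ * (ρ * Fin.partialProd g k.succ.succ) := rfl
    rw [h1, Fin.partialProd_succ g k.succ, Fin.succ_castSucc]
    group

theorem isConj_inv_mul_mul (h a : G) : IsConj h (a⁻¹ * h * a) :=
  isConj_iff.2 ⟨a⁻¹, by group⟩

/-- `g` is a cyclic tuple for its own product `h`, and its faces are cyclic tuples for the same `h`.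
This splits the Hochschild complex over the conjugacy classes. -/
theorem isConj_tupleProd_face (j : Fin (n + 2)) (g : Fin (n + 2) → G) :
    IsConj (tupleProd g) (tupleProd (face j g)) := by
  have h1 := cyclicTuple_partialProd (h := tupleProd g) (ρ := 1) (g := g) (by simp)
  conv_rhs => rw [← h1, face_cyclicTuple, tupleProd_cyclicTuple]
  exact isConj_inv_mul_mul _ _

theorem d_of_ofFn {α : Type*} (r : Fin (n + 1) → α) : d (of (List.ofFn r)) =
    ∑ j : Fin (n + 1), (-1 : ℤ) ^ (j : ℕ) • of (List.ofFn (r ∘ j.succAbove)) := by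
  induction n with
  | zero => simp [d_cons]
  | succ n ih =>
    rw [List.ofFn_succ, d_cons, ih, Fin.sum_univ_succ (n := n + 1), map_sum, sub_eq_add_neg,
      ← Finset.sum_neg_distrib]
    congr 1
    · simp [Function.comp_def]
    · refine Finset.sum_congr rfl fun j _ => ?_
      rw [map_smul, cone_of, ← neg_smul, Fin.val_succ, pow_succ, mul_neg_one]
      congr 2
      rw [List.ofFn_succ]
      simp [Function.comp_def]

variable {S : GenSet G} {h : G}

open Classical in
/-- An element conjugating `h` to `p`. -/
def conjugator (S : GenSet G) (h p : G) : G :=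
  if H : ∃ ρ, p = ρ⁻¹ * h * ρ then Function.argminOn S.wordLength {ρ | p = ρ⁻¹ * h * ρ} H else 1

theorem conjugator_spec {p : G} (hp : IsConj h p) :
    p = (conjugator S h p)⁻¹ * h * conjugator S h p ∧
      ∀ ρ, p = ρ⁻¹ * h * ρ → S.wordLength (conjugator S h p) ≤ S.wordLength ρ := by
  have H : ∃ ρ, p = ρ⁻¹ * h * ρ := by
    obtain ⟨c, hc⟩ := isConj_iff.1 hp
    exact ⟨c⁻¹, by rw [← hc]; group⟩
  rw [conjugator, dif_pos H]
  exact ⟨Function.argminOn_mem S.wordLength {ρ | p = ρ⁻¹ * h * ρ} H, fun ρ hρ =>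
    Function.argminOn_le S.wordLength {ρ | p = ρ⁻¹ * h * ρ} hρ⟩

/-- A tuple `r` with `cyclicTuple h r = g`. -/
def homogenize (S : GenSet G) (h : G) (g : Fin (n + 1) → G) (k : Fin (n + 1)) : G :=
  conjugator S h (tupleProd g) * Fin.partialProd g k.succ

theorem cyclicTuple_homogenize {g : Fin (n + 1) → G} (hg : IsConj h (tupleProd g)) :
    cyclicTuple h (homogenize S h g) = g :=
  cyclicTuple_partialProd (conjugator_spec hg).1

theorem isConj_tupleProd_cyclicTuple (r : Fin (n + 1) → G) :
    IsConj h (tupleProd (cyclicTuple h r)) := by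
  rw [tupleProd_cyclicTuple]
  exact isConj_inv_mul_mul _ _

/-- Both `rₙ` and the conjugator `ρ` carry `h` to the product of the tuple, so `ρ rₙ⁻¹` centralizes
`h`; the ambiguity is `z = ρ rₙ⁻¹ h`. -/
theorem exists_homogenize_cyclicTuple (S : GenSet G) (r : Fin (n + 1) → G) :
    ∃ z : Subgroup.centralizer {h}, homogenize S h (cyclicTuple h r) = fun k => z • r k := by
  have h1 := (conjugator_spec (S := S) (isConj_tupleProd_cyclicTuple (h := h) r)).1
  set ρ := conjugator S h (tupleProd (cyclicTuple h r)) with hρ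
  rw [tupleProd_cyclicTuple] at h1
  have hz : ρ * (r (Fin.last n))⁻¹ * h ∈ Subgroup.centralizer {h} := by
    rw [Subgroup.mem_centralizer_singleton_iff]
    have h2 : ρ * ((r (Fin.last n))⁻¹ * h * r (Fin.last n)) * (r (Fin.last n))⁻¹ * h =
        ρ * (ρ⁻¹ * h * ρ) * (r (Fin.last n))⁻¹ * h := by rw [h1]
    simpa [mul_assoc] using h2
  refine ⟨⟨_, hz⟩, funext fun k => ?_⟩
  rw [homogenize, partialProd_cyclicTuple, ← hρ, Subgroup.smul_def, smul_eq_mul]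
  group

open Classical in
/-- The function on tuples which corresponds to an invariant function on lists, supported on the
tuples with product conjugate to `h`. -/
def pull (S : GenSet G) (h : G) (n : ℕ) (w : List G → ℂ) (g : Fin (n + 1) → G) : ℂ :=
  if IsConj h (tupleProd g) then w (List.ofFn (homogenize S h g)) else 0

theorem pull_cyclicTuple {w : List G → ℂ} (hw : ListInvariant (Subgroup.centralizer {h}) w)
    (r : Fin (n + 1) → G) : pull S h n w (cyclicTuple h r) = w (List.ofFn r) := by
  rw [pull, if_pos (isConj_tupleProd_cyclicTuple r)]
  obtain ⟨z, hz⟩ := exists_homogenize_cyclicTuple (h := h) S r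
  rw [hz, ← hw z (List.ofFn r), List.map_ofFn]
  rfl

theorem pull_of_not_isConj {w : List G → ℂ} {g : Fin (n + 1) → G}
    (hg : ¬ IsConj h (tupleProd g)) : pull S h n w g = 0 := if_neg hg

theorem pull_of_isConj {w : List G → ℂ} {g : Fin (n + 1) → G}
    (hg : IsConj h (tupleProd g)) : pull S h n w g = w (List.ofFn (homogenize S h g)) := if_pos hg

theorem ext_d_ofFn {α : Type*} (w : List α → ℂ) (r : Fin (n + 1) → α) : ext w (d (of (List.ofFn r))) =
    ∑ j : Fin (n + 1), (-1 : ℂ) ^ (j : ℕ) * w (List.ofFn (r ∘ j.succAbove)) := by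
  rw [d_of_ofFn, map_sum]
  refine Finset.sum_congr rfl fun j _ => ?_
  rw [map_smul, ext_of, zsmul_eq_mul]
  push_cast
  rfl

/-- On the class of `h`, faces are omissions, so the two coboundaries agree. Off the class both
sides vanish, because faces stay in their class. -/
theorem tupleCoboundary_pull {w : List G → ℂ}
    (hw : ListInvariant (Subgroup.centralizer {h}) w) :
    tupleCoboundary (pull S h n w) = pull S h (n + 1) fun l => ext w (d (of l)) := by
  funext g
  by_cases hg : IsConj h (tupleProd g)
  · rw [pull_of_isConj hg, ext_d_ofFn, tupleCoboundary]
    refine Finset.sum_congr rfl fun j _ => ?_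
    rw [← pull_cyclicTuple (S := S) hw, ← face_cyclicTuple, cyclicTuple_homogenize hg]
  · rw [pull_of_not_isConj hg, tupleCoboundary]
    refine Finset.sum_eq_zero fun j _ => ?_
    rw [pull_of_not_isConj fun h' => hg (h'.trans (isConj_tupleProd_face j g).symm), mul_zero]

end Tuples

end

section

open ListChain

/-! ### Detecting Hochschild classes by cocycles of polynomial growth -/

section Detect

variable {G : Type*} [Group G] {S : GenSet G} {n : ℕ}

theorem exists_abs_eval_le (P : Polynomial ℝ) :
    ∃ C m : ℕ, ∀ k : ℕ, |P.eval (k : ℝ)| ≤ (C * (1 + k) ^ m : ℕ) := by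
  obtain ⟨C, hC⟩ := exists_nat_ge (∑ i ∈ Finset.range (P.natDegree + 1), |P.coeff i|)
  refine ⟨C, P.natDegree, fun k => ?_⟩
  rw [Polynomial.eval_eq_sum_range]
  refine (Finset.abs_sum_le_sum_abs _ _).trans ?_
  push_cast
  refine le_trans ?_ (mul_le_mul_of_nonneg_right hC (by positivity))
  rw [Finset.sum_mul]
  refine Finset.sum_le_sum fun i hi => ?_
  rw [abs_mul, abs_pow, Nat.abs_cast]
  refine mul_le_mul_of_nonneg_left ?_ (abs_nonneg _)
  have h1 : (1 : ℝ) ≤ 1 + k := by linarith [Nat.cast_nonneg (α := ℝ) k]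
  exact (pow_le_pow_left₀ (Nat.cast_nonneg k) (by linarith) i).trans
    (pow_le_pow_right₀ h1 (by simpa [Nat.lt_succ_iff] using hi))

theorem wordLength_partialProd_le (S : GenSet G) (g : Fin n → G) (k : Fin (n + 1)) :
    S.wordLength (Fin.partialProd g k) ≤ ∑ i, S.wordLength (g i) := by
  have h1 : ∀ l : List G, S.wordLength l.prod ≤ S.listLength l := fun l => by
    induction l with
    | nil => simp
    | cons a l ih =>
      rw [List.prod_cons, S.listLength_cons]
      exact (S.wordLength_mul_le _ _).trans (Nat.add_le_add_left ih _)
  refine (h1 _).trans ((S.listLength_le_of_sublist (List.take_sublist _ _)).trans ?_)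
  rw [GenSet.listLength, List.map_ofFn, List.sum_ofFn]
  rfl

/-- The entries are `ρ g₀ ⋯ g_k`. The conjugacy bound makes the shortest conjugator `ρ` polynomial
in the length of the full product, hence in the total length. -/
theorem exists_listLength_homogenize_le {h : G} (hconj : HasPolyConjugacyBound S h) (n : ℕ) :
    ∃ C m : ℕ, ∀ g : Fin (n + 1) → G, IsConj h (tupleProd g) →
      S.listLength (List.ofFn (homogenize S h g)) ≤ C * (1 + ∑ i, S.wordLength (g i)) ^ m := by
  obtain ⟨P, hP⟩ := hconj
  obtain ⟨C, m, hCm⟩ := exists_abs_eval_le P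
  -- There are `n + 1` entries, each of length at most `C (1 + s)^m + s`.
  refine ⟨(n + 1) * (C + 1), m + 1, fun g hg => ?_⟩
  set s := ∑ i, S.wordLength (g i) with hs
  obtain ⟨ρ, hρ, hlen⟩ := hP _ hg
  have h1 : S.wordLength (conjugator S h (tupleProd g)) ≤ C * (1 + s) ^ m := by
    refine ((conjugator_spec hg).2 ρ hρ).trans ?_
    have h2 := hlen.trans ((le_abs_self _).trans (hCm _))
    have h3 : S.wordLength ρ ≤ C * (1 + S.wordLength (tupleProd g)) ^ m := by exact_mod_cast h2
    refine h3.trans (Nat.mul_le_mul_left _ (Nat.pow_le_pow_left ?_ m))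
    exact Nat.add_le_add_left (wordLength_partialProd_le S g _) 1
  have h4 : ∀ k, S.wordLength (homogenize S h g k) ≤ (C + 1) * (1 + s) ^ (m + 1) := fun k => by
    refine (S.wordLength_mul_le _ _).trans ?_
    have h5 := wordLength_partialProd_le S g k.succ
    have h6 : 1 ≤ (1 + s) ^ m := Nat.one_le_pow _ _ (by omega)
    rw [pow_succ]
    have h7 : (1 + s) ≤ (1 + s) ^ m * (1 + s) := Nat.le_mul_of_pos_left _ h6
    have h8 : C * (1 + s) ^ m ≤ C * ((1 + s) ^ m * (1 + s)) :=
      Nat.mul_le_mul_left _ (Nat.le_mul_of_pos_right _ (by omega))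
    rw [add_mul, one_mul]
    omega
  rw [GenSet.listLength, List.map_ofFn, List.sum_ofFn]
  refine (Finset.sum_le_card_nsmul _ _ _ fun k _ => h4 k).trans ?_
  simp [mul_assoc]

/-- It converts a bound in the total length into a product of weights of the factors, the form
required by projective tensor norms. -/
theorem one_add_sum_le_prod {ι : Type*} (s : Finset ι) (f : ι → ℕ) :
    1 + ∑ i ∈ s, f i ≤ ∏ i ∈ s, (1 + f i) := by
  classical
  induction s using Finset.induction_on with
  | empty => simp
  | insert a s ha ih =>
    rw [Finset.sum_insert ha, Finset.prod_insert ha, add_mul, one_mul]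
    have : 1 ≤ ∏ i ∈ s, (1 + f i) := Finset.one_le_prod' fun i _ => by omega
    nlinarith

open Classical in
/-- A function on lists with given values on the lists of length `n + 1`, in terms of the
associated cyclic tuples. -/
def unpull (h : G) (n : ℕ) (u : (Fin (n + 1) → G) → ℂ) (l : List G) : ℂ :=
  if H : l.length = n + 1 then u (cyclicTuple h fun k => l[k.1]'(by omega)) else 0

theorem unpull_ofFn (h : G) (u : (Fin (n + 1) → G) → ℂ) (r : Fin (n + 1) → G) :
    unpull h n u (List.ofFn r) = u (cyclicTuple h r) := by
  rw [unpull, dif_pos (by simp)]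
  congr 2
  funext k
  exact List.getElem_ofFn _

theorem listInvariant_unpull (h : G) (u : (Fin (n + 1) → G) → ℂ) :
    ListInvariant (Subgroup.centralizer {h}) (unpull h n u) := by
  intro z l
  by_cases hl : l.length = n + 1
  · rw [unpull, unpull, dif_pos (by simpa using hl), dif_pos hl]
    congr 1
    funext k
    have hz := Subgroup.mem_centralizer_singleton_iff.1 z.2
    induction k using Fin.cases with
    | zero =>
      simp only [cyclicTuple, Fin.cases_zero, List.getElem_map, Subgroup.smul_def, smul_eq_mul,
        mul_inv_rev]
      have h1 : (z : G)⁻¹ * h * z = h := by rw [mul_assoc, ← hz, inv_mul_cancel_left]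
      rw [show ∀ a b : G, a * (z : G)⁻¹ * h * (z * b) = a * ((z : G)⁻¹ * h * z) * b by
        intros; group, h1]
    | succ k =>
      simp only [cyclicTuple, Fin.cases_succ, List.getElem_map, Subgroup.smul_def, smul_eq_mul,
        mul_inv_rev]
      group
  · rw [unpull, unpull, dif_neg (by simpa using hl), dif_neg hl]

theorem pull_unpull (h : G) (u : (Fin (n + 1) → G) → ℂ) {g : Fin (n + 1) → G}
    (hg : IsConj h (tupleProd g)) : pull S h n (unpull h n u) g = u g := by
  rw [pull_of_isConj hg, unpull_ofFn, cyclicTuple_homogenize hg]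

/-- Finitely many tuples, hence finitely many classes, occur in `c`, and `f c` is the sum of the
parts of `f` over these classes. -/
theorem exists_class_tupleFunctional_ne_zero {h : ConjClasses G → G}
    (hrep : ∀ x, ConjClasses.mk (h x) = x) {c : TensorPow (MonoidAlgebra ℂ G) n}
    {f : TensorPow (MonoidAlgebra ℂ G) n →ₗ[ℂ] ℂ} (hf : f c ≠ 0) :
    ∃ x, tupleFunctional (pull S (h x) n (unpull (h x) n fun g => f (groupTensor g))) c ≠ 0 := by
  classical
  by_contra! hzero
  have h1 : f = tupleFunctional fun g => f (groupTensor g) :=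
    tensor_hom_ext fun g => (tupleFunctional_groupTensor (fun g => f (groupTensor g)) g).symm
  rw [h1] at hf
  refine hf ?_
  set s := ((groupTensorBasis G n).repr c).support with hs
  have h2 : tupleFunctional (fun g => f (groupTensor g)) c =
      ∑ x ∈ s.image fun g => ConjClasses.mk (tupleProd g),
        tupleFunctional (pull S (h x) n (unpull (h x) n fun g => f (groupTensor g))) c := by
    simp only [tupleFunctional_apply, Finsupp.sum]
    rw [Finset.sum_comm]
    refine Finset.sum_congr rfl fun g hg => ?_
    rw [Finset.sum_eq_single (ConjClasses.mk (tupleProd g)), pull_unpull]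
    · rw [← ConjClasses.mk_eq_mk_iff_isConj, hrep]
    · intro x _ hx
      rw [pull_of_not_isConj, mul_zero]
      intro h'
      rw [← ConjClasses.mk_eq_mk_iff_isConj, hrep] at h'
      exact hx h'
    · exact fun h' => absurd (Finset.mem_image_of_mem _ hg) h'
  rw [h2]
  exact Finset.sum_eq_zero fun x _ => hzero x

/-- A Hochschild cycle which is not a boundary is detected by a cocycle of polynomial growth. -/
theorem exists_polynomial_tupleCocycle {h : ConjClasses G → G}
    (hrep : ∀ x, ConjClasses.mk (h x) = x) (hconj : ∀ x, HasPolyConjugacyBound S (h x))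
    (hqi : ∀ x, IsQIEmbeddedSubgroup S (Subgroup.centralizer {h x}))
    (hdehn : ∀ x, HasPolyBoundedDehnFunctions (Subgroup.centralizer {h x}))
    {c : TensorPow (MonoidAlgebra ℂ G) n}
    (hcycle : ∀ m, (e : n = m + 1) → hochschildB (MonoidAlgebra ℂ G) m (e ▸ c) = 0)
    (hc : c ∉ LinearMap.range (hochschildB (MonoidAlgebra ℂ G) n)) :
    ∃ φ : (Fin (n + 1) → G) → ℂ, (∀ g, tupleCoboundary φ g = 0) ∧
      (∃ C k : ℕ, ∀ g, ‖φ g‖ ≤ C * ∏ i, (1 + S.wordLength (g i) : ℝ) ^ k) ∧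
      tupleFunctional φ c ≠ 0 := by
  -- The separation is purely algebraic and gives no information on the growth of `f`.
  obtain ⟨f, hfc, hf⟩ := Submodule.exists_le_ker_of_notMem hc
  obtain ⟨x, hx⟩ := exists_class_tupleFunctional_ne_zero (S := S) hrep hfc
  set u₀ := unpull (h x) n fun g => f (groupTensor g) with hu₀def
  have hu₀ : ListInvariant (Subgroup.centralizer {h x}) u₀ := listInvariant_unpull _ _
  have hcocycle : ∀ l : List G, l.length = n + 2 → ext u₀ (d (of l)) = 0 := by
    intro l hl
    obtain ⟨r, rfl⟩ : ∃ r : Fin (n + 2) → G, List.ofFn r = l :=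
      ⟨fun i => l[i.1]'(by omega), by
        refine List.ext_getElem (by rw [List.length_ofFn, hl]) fun i _ _ => ?_
        rw [List.getElem_ofFn]⟩
    have h1 : f (hochschildB _ n (groupTensor (cyclicTuple (h x) r))) = 0 := hf ⟨_, rfl⟩
    rw [hochschildB_groupTensor, map_sum] at h1
    rw [ext_d_ofFn, ← h1]
    refine Finset.sum_congr rfl fun j _ => ?_
    rw [hu₀def, unpull_ofFn, map_smul, face_cyclicTuple, smul_eq_mul]
  obtain ⟨u, ψ, hu, hψ, huψ, hψ0, C, m, hbound⟩ :=
    exists_polynomial_cocycle (hqi x) (hdehn x) hu₀ hcocycle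
  refine ⟨pull S (h x) n u, fun g => ?_, ?_, ?_⟩
  · rw [tupleCoboundary_pull hu]
    by_cases hg : IsConj (h x) (tupleProd g)
    · rw [pull_of_isConj hg]
      set l := List.ofFn (homogenize S (h x) g) with hl
      have hln : l.length = n + 2 := by simp [hl]
      -- `u` differs from `u₀` by a coboundary, so it is again a cocycle.
      have h1 : ext u (d (of l)) = (ext u₀ + ext ψ ∘ₗ d) (d (of l)) :=
        map_congr (fun m hm => by
          rw [ext_of, huψ m hm.2, LinearMap.add_apply, ext_of]
          rfl) (d_mem_length hln)
      rw [h1, LinearMap.add_apply, LinearMap.comp_apply, d_d, map_zero, hcocycle l hln, add_zero]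
    · exact pull_of_not_isConj hg
  · obtain ⟨C', m', hC'⟩ := exists_listLength_homogenize_le (hconj x) n
    refine ⟨C * (1 + C') ^ m, m' * m, fun g => ?_⟩
    rw [Finset.prod_pow]
    by_cases hg : IsConj (h x) (tupleProd g)
    · rw [pull_of_isConj hg]
      refine (hbound _ (by simp)).trans ?_
      have h1 := (polynomial_comp_le (C := C) (m := m) (hC' g hg)).trans
        (Nat.mul_le_mul_left _ (Nat.pow_le_pow_left (one_add_sum_le_prod Finset.univ _) _))
      exact_mod_cast h1
    · rw [pull_of_not_isConj hg, _root_.norm_zero]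
      positivity
  · have h1 : tupleFunctional (pull S (h x) n u) = tupleFunctional (pull S (h x) n u₀) +
        tupleFunctional (pull S (h x) n fun l => ext ψ (d (of l))) :=
      tensor_hom_ext fun g => by
        rw [LinearMap.add_apply, tupleFunctional_groupTensor, tupleFunctional_groupTensor,
          tupleFunctional_groupTensor]
        by_cases hg : IsConj (h x) (tupleProd g)
        · rw [pull_of_isConj hg, pull_of_isConj hg, pull_of_isConj hg, huψ _ (by simp)]
        · rw [pull_of_not_isConj hg, pull_of_not_isConj hg, pull_of_not_isConj hg, add_zero]
    -- The correcting coboundary vanishes on `c`: in positive degrees because `c` is a cycle, in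
    -- degree `0` because `ψ = 0`.
    have h2 : tupleFunctional (pull S (h x) n fun l => ext ψ (d (of l))) c = 0 := by
      match n with
      | 0 =>
        have h3 : (pull S (h x) 0 fun l => ext ψ (d (of l))) = 0 := by
          funext g
          simp [pull, hψ0 rfl]
        rw [h3, tupleFunctional_apply]
        simp
      | m + 1 =>
        rw [← tupleCoboundary_pull hψ, ← tupleFunctional_hochschildB, LinearMap.comp_apply]
        have h3 : hochschildB (MonoidAlgebra ℂ G) m c = 0 := hcycle m rfl
        rw [h3, map_zero]
    rw [h1, LinearMap.add_apply, h2, add_zero]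
    exact hx

end Detect

end

section

open scoped TensorProduct Topology
open Filter CategoryTheory

/-! ### Cochains of polynomial growth as continuous functionals -/

section Functional

theorem continuous_of_norm_le_seminorm {E : Type*} [AddCommGroup E] [Module ℂ E]
    [TopologicalSpace E] [IsTopologicalAddGroup E] (f : E →ₗ[ℂ] ℂ) {q : Seminorm ℂ E}
    (hq : Continuous q) (h : ∀ x, ‖f x‖ ≤ q x) : Continuous f := by
  refine continuous_of_continuousAt_zero f ?_
  rw [ContinuousAt, map_zero]
  refine squeeze_zero_norm h ?_
  simpa using hq.tendsto 0

variable {G : Type*} [Group G] (S : GenSet G)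

/-- The coefficient functional of a group element. -/
def coeffCLM (g : G) : RDGroupRing S →L[ℂ] ℂ where
  toFun f := f.coeff g
  map_add' _ _ := rfl
  map_smul' _ _ := rfl
  cont := by
    let f : RDGroupRing S →ₗ[ℂ] ℂ :=
      { toFun := fun f => f.coeff g
        map_add' := fun _ _ => rfl
        map_smul' := fun _ _ => rfl }
    refine continuous_of_norm_le_seminorm f ((rd_withSeminorms S).continuous_seminorm 0)
      fun x => ?_
    rw [rdNorm_apply]
    change ‖x.coeff g‖ ≤ _
    simp only [pow_zero, one_mul]
    by_cases hg : g ∈ x.coeff.support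
    · exact Finset.single_le_sum (f := fun g => ‖x.coeff g‖) (fun _ _ => norm_nonneg _) hg
    · rw [Finsupp.notMem_support_iff.1 hg, norm_zero]
      exact Finset.sum_nonneg fun _ _ => norm_nonneg _

/-- The extension of a coefficient functional to the completion. -/
def coeffExt (g : G) : L1RD S →L[ℂ] ℂ := (coeffCLM S g).fromCompletion

theorem coeffExt_coe (g : G) (f : RDGroupRing S) : coeffExt S g (f : L1RD S) = f.coeff g :=
  (coeffCLM S g).fromCompletion_apply_coe f

theorem uniformContinuous_rdNorm (k : ℕ) : UniformContinuous (rdNorm S k) :=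
  Seminorm.uniformContinuous_of_continuousAt_zero
    ((rd_withSeminorms S).continuous_seminorm k).continuousAt

/-- The extension of the norm `‖-‖_{k,1}` to the completion. -/
def rdNormExt (k : ℕ) : Seminorm ℂ (L1RD S) :=
  Seminorm.of (UniformSpace.Completion.extension (rdNorm S k))
    (fun x y => UniformSpace.Completion.induction_on₂ x y
      (isClosed_le (UniformSpace.Completion.continuous_extension.comp continuous_add)
        ((UniformSpace.Completion.continuous_extension.comp continuous_fst).add
          (UniformSpace.Completion.continuous_extension.comp continuous_snd)))
      fun a b => by
        rw [← UniformSpace.Completion.coe_add]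
        simp only [UniformSpace.Completion.extension_coe (uniformContinuous_rdNorm S k)]
        exact map_add_le_add _ _ _)
    (fun c x => UniformSpace.Completion.induction_on x
      (isClosed_eq (UniformSpace.Completion.continuous_extension.comp (continuous_const_smul c))
        (continuous_const.mul UniformSpace.Completion.continuous_extension))
      fun a => by
        rw [← UniformSpace.Completion.coe_smul]
        simp only [UniformSpace.Completion.extension_coe (uniformContinuous_rdNorm S k)]
        exact map_smul_eq_mul _ _ _)

theorem continuous_rdNormExt (k : ℕ) : Continuous (rdNormExt S k) :=
  UniformSpace.Completion.continuous_extension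

theorem rdNormExt_coe (k : ℕ) (f : RDGroupRing S) : rdNormExt S k (f : L1RD S) = rdNorm S k f :=
  UniformSpace.Completion.extension_coe (uniformContinuous_rdNorm S k) f

/-- On the group ring this is a partial sum of the norm. For finite `F` both sides are continuous,
so the inequality passes to the completion. -/
theorem sum_coeffExt_le (k : ℕ) (F : Finset G) (a : L1RD S) :
    ∑ g ∈ F, (1 + S.wordLength g : ℝ) ^ k * ‖coeffExt S g a‖ ≤ rdNormExt S k a := by
  classical
  refine UniformSpace.Completion.induction_on a (isClosed_le ?_ (continuous_rdNormExt S k))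
    fun f => ?_
  · exact continuous_finsetSum _ fun g _ =>
      continuous_const.mul (coeffExt S g).continuous.norm
  · rw [rdNormExt_coe, rdNorm_apply,
      Finsupp.sum_of_support_subset f.coeff Finset.subset_union_right _ (by simp) (s := F ∪ _)]
    simp only [coeffExt_coe]
    exact Finset.sum_le_sum_of_subset_of_nonneg Finset.subset_union_left
      fun _ _ _ => by positivity

/-- The image of a group element in the rapid decay algebra. -/
def rdSingle (g : G) : L1RD S := toL1RD S (MonoidAlgebra.single g 1)

theorem rdSingle_mul (g g' : G) : rdSingle S g * rdSingle S g' = rdSingle S (g * g') := by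
  rw [rdSingle, rdSingle, ← map_mul, MonoidAlgebra.single_mul_single, one_mul]
  rfl

theorem coeffExt_rdSingle (g g' : G) [Decidable (g' = g)] :
    coeffExt S g (rdSingle S g') = if g' = g then 1 else 0 := by
  classical
  refine (coeffExt_coe S g (MonoidAlgebra.single g' 1 : MonoidAlgebra ℂ G)).trans ?_
  refine (Finsupp.single_apply (a := g') (a' := g) (b := (1 : ℂ))).trans ?_
  split_ifs <;> rfl

theorem linearMap_eq_zero_of_rdSingle {f : L1RD S →ₗ[ℂ] ℂ} (hf : Continuous f)
    (h : ∀ g, f (rdSingle S g) = 0) : f = 0 := by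
  have h1 : f ∘ₗ (toL1RD S).toLinearMap = 0 :=
    (MonoidAlgebra.basis G ℂ).ext fun g => by
      rw [MonoidAlgebra.basis_apply]
      exact h g
  refine LinearMap.ext fun a => ?_
  exact UniformSpace.Completion.induction_on a (isClosed_eq hf continuous_const)
    fun x => LinearMap.congr_fun h1 x

variable {n : ℕ}

/-- The terms of the series defining the multilinear extension of a function on tuples. -/
def tupleTerm (φ : (Fin (n + 1) → G) → ℂ) (g : Fin (n + 1) → G) :
    MultilinearMap ℂ (fun _ : Fin (n + 1) => L1RD S) ℂ :=
  φ g • (MultilinearMap.mkPiAlgebra ℂ (Fin (n + 1)) ℂ).compLinearMap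
    fun i => (coeffExt S (g i)).toLinearMap

theorem tupleTerm_apply (φ : (Fin (n + 1) → G) → ℂ) (g : Fin (n + 1) → G)
    (a : Fin (n + 1) → L1RD S) :
    tupleTerm S φ g a = φ g * ∏ i, coeffExt S (g i) (a i) := by
  simp [tupleTerm]

variable {S} {φ : (Fin (n + 1) → G) → ℂ} {C k : ℕ}

/-- The weight is a product over the coordinates, so after enlarging `F` to a box the sum factors
into sums over single elements. Uniformity in `F` gives both convergence and the norm bound. -/
theorem sum_norm_tupleTerm_le (hφ : ∀ g, ‖φ g‖ ≤ C * ∏ i, (1 + S.wordLength (g i) : ℝ) ^ k)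
    (a : Fin (n + 1) → L1RD S) (F : Finset (Fin (n + 1) → G)) :
    ∑ g ∈ F, ‖tupleTerm S φ g a‖ ≤ C * ∏ i, rdNormExt S k (a i) := by
  classical
  let w : Fin (n + 1) → G → ℝ := fun i g => (1 + S.wordLength g : ℝ) ^ k * ‖coeffExt S g (a i)‖
  have hw : ∀ i g, 0 ≤ w i g := fun i g => by positivity
  calc ∑ g ∈ F, ‖tupleTerm S φ g a‖
      ≤ ∑ g ∈ F, C * ∏ i, w i (g i) := by
        refine Finset.sum_le_sum fun g _ => ?_
        rw [tupleTerm_apply, norm_mul, norm_prod, Finset.prod_mul_distrib, ← mul_assoc]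
        exact mul_le_mul_of_nonneg_right (hφ g) (Finset.prod_nonneg fun _ _ => norm_nonneg _)
    _ ≤ ∑ g ∈ Fintype.piFinset fun i => F.image (· i), C * ∏ i, w i (g i) := by
        refine Finset.sum_le_sum_of_subset_of_nonneg (fun g hg => ?_) fun g _ _ =>
          mul_nonneg (Nat.cast_nonneg _) (Finset.prod_nonneg fun i _ => hw i _)
        exact Fintype.mem_piFinset.2 fun i => Finset.mem_image_of_mem (· i) hg
    _ = C * ∏ i, ∑ g ∈ F.image (· i), w i g := by
        rw [← Finset.mul_sum, Finset.prod_univ_sum]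
    _ ≤ C * ∏ i, rdNormExt S k (a i) := by
        refine mul_le_mul_of_nonneg_left ?_ (Nat.cast_nonneg _)
        exact Finset.prod_le_prod (fun i _ => Finset.sum_nonneg fun g _ => hw i g)
          fun i _ => sum_coeffExt_le S k _ (a i)

theorem summable_norm_tupleTerm (hφ : ∀ g, ‖φ g‖ ≤ C * ∏ i, (1 + S.wordLength (g i) : ℝ) ^ k)
    (a : Fin (n + 1) → L1RD S) : Summable fun g => ‖tupleTerm S φ g a‖ :=
  summable_of_sum_le (fun _ => norm_nonneg _) (sum_norm_tupleTerm_le hφ a)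

/-- The multilinear extension of a function of polynomial growth on tuples. -/
def tupleMultilinear (hφ : ∀ g, ‖φ g‖ ≤ C * ∏ i, (1 + S.wordLength (g i) : ℝ) ^ k) :
    MultilinearMap ℂ (fun _ : Fin (n + 1) => L1RD S) ℂ where
  toFun a := ∑' g, tupleTerm S φ g a
  map_update_add' a i x y := by
    simp only [MultilinearMap.map_update_add]
    exact (summable_norm_tupleTerm hφ _).of_norm.tsum_add (summable_norm_tupleTerm hφ _).of_norm
  map_update_smul' a i c x := by
    simp only [MultilinearMap.map_update_smul, smul_eq_mul]
    exact tsum_mul_left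

theorem norm_tupleMultilinear_le
    (hφ : ∀ g, ‖φ g‖ ≤ C * ∏ i, (1 + S.wordLength (g i) : ℝ) ^ k) (a : Fin (n + 1) → L1RD S) :
    ‖tupleMultilinear hφ a‖ ≤ C * ∏ i, rdNormExt S k (a i) :=
  (norm_tsum_le_tsum_norm (summable_norm_tupleTerm hφ a)).trans
    ((summable_norm_tupleTerm hφ a).tsum_le_of_sum_le (sum_norm_tupleTerm_le hφ a))

theorem tupleMultilinear_rdSingle
    (hφ : ∀ g, ‖φ g‖ ≤ C * ∏ i, (1 + S.wordLength (g i) : ℝ) ^ k) (g : Fin (n + 1) → G) :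
    tupleMultilinear hφ (fun i => rdSingle S (g i)) = φ g := by
  classical
  have h1 : tupleMultilinear hφ (fun i => rdSingle S (g i)) =
      ∑' g', tupleTerm S φ g' fun i => rdSingle S (g i) := rfl
  rw [h1, tsum_eq_single g]
  · simp [tupleTerm_apply, coeffExt_rdSingle]
  · intro g' hg'
    obtain ⟨i, hi⟩ := Function.ne_iff.1 hg'
    rw [tupleTerm_apply, Finset.prod_eq_zero (Finset.mem_univ i), mul_zero]
    rw [coeffExt_rdSingle, if_neg (Ne.symm hi)]

/-- The continuous functional on the projective tensor power defined by a function of polynomial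
growth on tuples. -/
def tupleCLM (hφ : ∀ g, ‖φ g‖ ≤ C * ∏ i, (1 + S.wordLength (g i) : ℝ) ^ k) :
    ProjTensorPow (L1RD S) n →L[ℂ] ℂ where
  toLinearMap := PiTensorProduct.lift (tupleMultilinear hφ)
  cont := by
    let L : ProjTensorPow (L1RD S) n →ₗ[ℂ] ℂ := PiTensorProduct.lift (tupleMultilinear hφ)
    -- Since `C + 1 ≥ 1`, one has `C ≤ (C + 1) ^ (n + 1)`, which distributes the constant over the
    -- `n + 1` factors.
    let P : Seminorm ℂ (L1RD S) := ((C + 1 : ℕ) : NNReal) • rdNormExt S k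
    have hPx : ∀ x, P x = (C + 1 : ℕ) * rdNormExt S k x := fun x => by
      simp [P, NNReal.smul_def]
    have hq : ∀ a : Fin (n + 1) → L1RD S,
        ((normSeminorm ℂ ℂ).comp L) (ProjTensorPow.tprod a) ≤ ∏ i, P (a i) := fun a => by
      have h1 : ((normSeminorm ℂ ℂ).comp L) (ProjTensorPow.tprod a) =
          ‖tupleMultilinear hφ a‖ := by
        have h0 : L (ProjTensorPow.tprod a) = tupleMultilinear hφ a :=
          PiTensorProduct.lift.tprod a
        rw [← h0]
        rfl
      rw [h1]
      refine (norm_tupleMultilinear_le hφ a).trans ?_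
      simp only [hPx, Finset.prod_mul_distrib, Finset.prod_const, Finset.card_univ,
        Fintype.card_fin]
      refine mul_le_mul_of_nonneg_right ?_ (Finset.prod_nonneg fun _ _ => apply_nonneg _ _)
      have h2 : (1 : ℝ) ≤ (C + 1 : ℕ) := by
        push_cast
        linarith [Nat.cast_nonneg (α := ℝ) C]
      refine le_trans ?_ (le_self_pow₀ h2 (Nat.succ_ne_zero n))
      push_cast
      linarith
    have hc : Continuous ((normSeminorm ℂ ℂ).comp L) :=
      (projTensorPow_withSeminorms (L1RD S) n).continuous_seminorm
        ⟨(normSeminorm ℂ ℂ).comp L, P, continuous_const.smul (continuous_rdNormExt S k), hq⟩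
    exact continuous_of_norm_le_seminorm L hc fun _ => le_rfl

theorem tupleCLM_tprod (hφ : ∀ g, ‖φ g‖ ≤ C * ∏ i, (1 + S.wordLength (g i) : ℝ) ^ k)
    (a : Fin (n + 1) → L1RD S) :
    tupleCLM hφ (ProjTensorPow.tprod a) = tupleMultilinear hφ a :=
  PiTensorProduct.lift.tprod a

/-- Elementary tensors depend continuously on each factor. -/
theorem continuous_tprod_update {A : Type*} [AddCommGroup A] [Module ℂ A] [TopologicalSpace A]
    [IsTopologicalAddGroup A] [ContinuousSMul ℂ A]
    (a : Fin (n + 1) → A) (i : Fin (n + 1)) :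
    Continuous fun x => (ProjTensorPow.tprod (Function.update a i x) : ProjTensorPow A n) := by
  let l : A →ₗ[ℂ] ProjTensorPow A n := (PiTensorProduct.tprod ℂ).toLinearMap a i
  refine (projTensorPow_withSeminorms A n).continuous_of_continuous_comp l fun q => ?_
  obtain ⟨q, p, hp, hq⟩ := q
  have h0 : 0 ≤ ∏ j ∈ Finset.univ.erase i, p (a j) :=
    Finset.prod_nonneg fun _ _ => apply_nonneg _ _
  let K : NNReal := ⟨∏ j ∈ Finset.univ.erase i, p (a j), h0⟩
  refine Seminorm.continuous_of_le (q := K • p) (continuous_const.smul hp) fun x => ?_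
  refine (hq (Function.update a i x)).trans (le_of_eq ?_)
  rw [← Finset.mul_prod_erase _ _ (Finset.mem_univ i), Function.update_self, mul_comm]
  have h1 : ∀ j ∈ Finset.univ.erase i, p (Function.update a i x j) = p (a j) := fun j hj => by
    rw [Function.update_of_ne (Finset.ne_of_mem_erase hj)]
  rw [Finset.prod_congr rfl h1]
  rfl

/-- A continuous functional on the projective tensor power which vanishes on the tensors of group
elements is zero. -/
theorem clm_eq_zero_of_rdSingle {T : ProjTensorPow (L1RD S) n →L[ℂ] ℂ}
    (hT : ∀ g : Fin (n + 1) → G, T (ProjTensorPow.tprod fun i => rdSingle S (g i)) = 0)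
    (t : ProjTensorPow (L1RD S) n) : T t = 0 := by
  classical
  -- `s` is the set of factors already allowed to be arbitrary; each enlargement of `s` uses density
  -- in one variable.
  have key : ∀ (s : Finset (Fin (n + 1))) (a : Fin (n + 1) → L1RD S),
      (∀ i ∉ s, ∃ g, a i = rdSingle S g) → T (ProjTensorPow.tprod a) = 0 := by
    intro s
    induction s using Finset.induction_on with
    | empty =>
      intro a ha
      choose g hg using fun i => ha i (Finset.notMem_empty i)
      rw [funext hg]
      exact hT g
    | insert i s _ ih =>
      intro a ha
      let l : L1RD S →ₗ[ℂ] ℂ :=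
        (T.toLinearMap.compMultilinearMap (PiTensorProduct.tprod ℂ)).toLinearMap a i
      have := (PolynormableSpace.withSeminorms ℂ (L1RD S)).continuousSMul
      have hl : Continuous l := T.continuous.comp (continuous_tprod_update a i)
      have h1 : l = 0 := linearMap_eq_zero_of_rdSingle S hl fun g => by
        refine ih (Function.update a i (rdSingle S g)) fun j hj => ?_
        by_cases hji : j = i
        · subst hji
          exact ⟨g, Function.update_self _ _ _⟩
        · rw [Function.update_of_ne hji]
          exact ha j (by simp [hji, hj])
      have h2 := LinearMap.congr_fun h1 (a i)
      have h3 : l (a i) = T (ProjTensorPow.tprod (Function.update a i (a i))) := rfl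
      rw [h3, Function.update_eq_self] at h2
      exact h2
  have h1 : T.toLinearMap = 0 := PiTensorProduct.ext (MultilinearMap.ext fun a =>
    key Finset.univ a fun i hi => absurd (Finset.mem_univ i) hi)
  exact LinearMap.congr_fun h1 t

theorem face_rdSingle (j : Fin (n + 2)) (g : Fin (n + 2) → G) :
    (face j fun i => rdSingle S (g i)) = fun i => rdSingle S (face j g i) := by
  funext k
  simp only [face, Fin.contractNth]
  split_ifs <;> simp [rdSingle_mul]

/-- A cocycle of polynomial growth defines a continuous functional on the completed tensor power
which vanishes on the boundaries. -/
theorem exists_functional_of_polynomial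
    (hφ : ∀ g, ‖φ g‖ ≤ C * ∏ i, (1 + S.wordLength (g i) : ℝ) ^ k)
    (hcocycle : ∀ g, tupleCoboundary φ g = 0) :
    ∃ T : CompletedTensorPow (L1RD S) n →L[ℂ] ℂ,
      (∀ w, T ((hochschildBCont (L1RD S) n).completion w) = 0) ∧
      ∀ c, T (toCompletedTensorPow (L1RD S) n
        (PiTensorProduct.map (fun _ => (toL1RD S).toLinearMap) c)) = tupleFunctional φ c := by
  refine ⟨(tupleCLM hφ).fromCompletion, fun w => ?_, fun c => ?_⟩
  -- By density, vanishing on boundaries is tested on tensors of group elements, where it is the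
  -- cocycle identity.
  · refine UniformSpace.Completion.induction_on w (isClosed_eq ?_ continuous_const) fun t => ?_
    · exact (ContinuousLinearMap.continuous _).comp (ContinuousLinearMap.continuous _)
    · rw [ContinuousLinearMap.completion_apply_coe, ContinuousLinearMap.fromCompletion_apply_coe]
      refine clm_eq_zero_of_rdSingle (T := (tupleCLM hφ).comp (hochschildBCont (L1RD S) n))
        (fun g => ?_) t
      have h1 : hochschildBCont (L1RD S) n (ProjTensorPow.tprod fun i => rdSingle S (g i)) =
          ∑ j : Fin (n + 2), (-1 : ℂ) ^ (j : ℕ) •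
            ProjTensorPow.tprod (face j fun i => rdSingle S (g i)) := hochschildB_tprod _ n _
      rw [ContinuousLinearMap.comp_apply, h1, map_sum, ← hcocycle g]
      refine Finset.sum_congr rfl fun j _ => ?_
      rw [map_smul, tupleCLM_tprod, face_rdSingle, tupleMultilinear_rdSingle, smul_eq_mul]
  · have h1 : (tupleCLM hφ).toLinearMap ∘ₗ
        (PiTensorProduct.map fun _ => (toL1RD S).toLinearMap) = tupleFunctional φ :=
      tensor_hom_ext fun g => by
        rw [tupleFunctional_groupTensor, ← tupleMultilinear_rdSingle hφ g, ← tupleCLM_tprod]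
        exact congrArg (fun t : ProjTensorPow (L1RD S) n => tupleCLM hφ t)
          (PiTensorProduct.map_tprod (fun _ : Fin (n + 1) => (toL1RD S).toLinearMap) _)
    rw [← h1]
    exact ContinuousLinearMap.fromCompletion_apply_coe _ _

end Functional

end

/-! ### Injectivity in homology -/

section

open CategoryTheory

/-- A chain map of complexes of modules is injective in homology as soon as every cycle whose image
is a boundary is a boundary. -/
theorem homologyMap_injective_of_boundary {R : Type*} [Ring R]
    {K L : ChainComplex (ModuleCat R) ℕ} (f : K ⟶ L) (n : ℕ)
    (hf : ∀ c : K.X n, (∀ m, K.d n m c = 0) → (∃ w, L.d (n + 1) n w = f.f n c) →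
      ∃ v, K.d (n + 1) n v = c) :
    Function.Injective (HomologicalComplex.homologyMap f n) := by
  -- A cycle has trivial class exactly when it is the image of a chain under the differential.
  have hex : ∀ (M : ChainComplex (ModuleCat R) ℕ) (z : M.cycles n),
      M.homologyπ n z = 0 ↔ ∃ w, M.d (n + 1) n w = M.iCycles n z := by
    intro M z
    have hexact : (ShortComplex.mk (M.toCycles (n + 1) n) (M.homologyπ n) (by simp)).Exact :=
      ShortComplex.exact_of_g_is_cokernel _ (M.homologyIsCokernel (n + 1) n (by simp))
    have hinj : Function.Injective (M.iCycles n) :=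
      (ModuleCat.mono_iff_injective _).1 inferInstance
    constructor
    · intro hz
      obtain ⟨w, hw⟩ := (ShortComplex.moduleCat_exact_iff _).1 hexact z hz
      refine ⟨w, ?_⟩
      rw [← M.toCycles_i (n + 1) n, ModuleCat.comp_apply]
      exact congrArg _ hw
    · rintro ⟨w, hw⟩
      have : M.toCycles (n + 1) n w = z := hinj (by
        rw [← hw, ← ModuleCat.comp_apply, M.toCycles_i])
      rw [← this, ← ModuleCat.comp_apply]
      simp
  rw [injective_iff_map_eq_zero]
  intro x hx
  obtain ⟨z, rfl⟩ := (ModuleCat.epi_iff_surjective (K.homologyπ n)).1 inferInstance x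
  rw [hex]
  rw [← ModuleCat.comp_apply, HomologicalComplex.homologyπ_naturality, ModuleCat.comp_apply,
    hex] at hx
  refine hf _ (fun m => ?_) ?_
  · rw [← ModuleCat.comp_apply, K.iCycles_d]
    rfl
  · rwa [← ModuleCat.comp_apply, HomologicalComplex.cyclesMap_i, ModuleCat.comp_apply] at hx

variable {G : Type*} [Group G] {S : GenSet G}

/-- If `c` did not bound, a functional killing all boundaries of the completed complex would be
nonzero on the image of `c`. -/
theorem hochschildComparison_injective {h : ConjClasses G → G}
    (hrep : ∀ x, ConjClasses.mk (h x) = x) (hconj : ∀ x, HasPolyConjugacyBound S (h x))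
    (hqi : ∀ x, IsQIEmbeddedSubgroup S (Subgroup.centralizer {h x}))
    (hdehn : ∀ x, HasPolyBoundedDehnFunctions (Subgroup.centralizer {h x})) (n : ℕ) :
    Function.Injective (hochschildComparison S n) := by
  refine homologyMap_injective_of_boundary _ n ?_
  intro c hc hw
  obtain ⟨w, hw⟩ := hw
  change TensorPow (MonoidAlgebra ℂ G) n at c
  have hd : (hochschildComplex (MonoidAlgebra ℂ G)).d (n + 1) n =
      ModuleCat.ofHom (hochschildB (MonoidAlgebra ℂ G) n) := by
    simp only [hochschildComplex, ChainComplex.of_d]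
  have hd' : (contHochschildComplex (L1RD S)).d (n + 1) n =
      ModuleCat.ofHom (hochschildBCont (L1RD S) n).completion.toLinearMap := by
    simp only [contHochschildComplex, ChainComplex.of_d]
  rw [hd'] at hw
  rw [hd]
  by_contra hcon
  have hcycle : ∀ m, (e : n = m + 1) → hochschildB (MonoidAlgebra ℂ G) m (e ▸ c) = 0 := by
    intro m e
    subst e
    have h1 := hc m
    have h2 : (hochschildComplex (MonoidAlgebra ℂ G)).d (m + 1) m =
      ModuleCat.ofHom (hochschildB (MonoidAlgebra ℂ G) m) := by
      simp only [hochschildComplex, ChainComplex.of_d]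
    rw [h2] at h1
    exact h1
  obtain ⟨φ, hφ0, ⟨C, k, hφ⟩, hφc⟩ :=
    exists_polynomial_tupleCocycle hrep hconj hqi hdehn hcycle hcon
  obtain ⟨T, hT, hTc⟩ := exists_functional_of_polynomial hφ hφ0
  refine hφc ?_
  rw [← hTc, ← hT w]
  exact congrArg T hw.symm

end

end RapidDecay

end

theorem mainTheorem4 {G : Type*} [Group G] [Countable G] (S : RapidDecay.GenSet G)
    (h : ConjClasses G → G) (hrep : ∀ x, ConjClasses.mk (h x) = x)
    (hconj : ∀ x, RapidDecay.HasPolyConjugacyBound S (h x))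
    (hfin : ∀ x, RapidDecay.IsTypeFInfty (Subgroup.centralizer {h x}))
    (hqi : ∀ x, RapidDecay.IsQIEmbeddedSubgroup S (Subgroup.centralizer {h x}))
    (hdehn : ∀ x, RapidDecay.HasPolyBoundedDehnFunctions (Subgroup.centralizer {h x}))
    (n : ℕ) :
    Function.Injective (RapidDecay.hochschildComparison S n) :=
  RapidDecay.hochschildComparison_injective hrep hconj hqi hdehn n
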